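/- A (finite, simple) graph $G=(V,E)$ is \emph{outerplanar} if it has an embedding in the plane (vertices are distinct points, edges are simple polygonal arcs that meet one another and the vertices only at common endpoints) in which every vertex lies on the boundary of the outer (unbounded) face. A \emph{touching triangles representation} of $G$ assigns to every vertex $v$ a non-degenerate closed triangle $T_v$ in $\mathbb{R}^2$ such that the interiors of the triangles are pairwise disjoint and, for all $u\neq v$, the vertices $u,v$ are adjacent if and only if $T_u$ and $T_v$ touch non-trivially, i.e. some side of $T_u$ and some side of $T_v$ have more than one point in common (so that contact in a single point does not count). \textbf{Theorem.} Every outerplanar graph, connected or not, has a touching triangles representation, and such a representation can be computed in linear time: there are a program $P$ for the real random access machine and a constant $C$ such that for every $n\ge 0$, every outerplanar graph $G$ on the vertex set $\{0,\dots,n-1\}$ and every system of adjacency lists of $G$ (the neighbours of each vertex listed once, in an arbitrary order), the program $P$, started on $n$ and these lists, halts after at most $C(n+1)$ operations, and the triangles whose corner coordinates it has stored then form a touching triangles representation of $G$. Here the real random access machine has variables and arrays of natural numbers and of real numbers, initially zero apart from the input; its unit-cost operations are: literals (natural number constants), reading and writing variables and array entries (indices are natural numbers), addition and truncated subtraction of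 natural numbers, the four arithmetic operations on real numbers (with $x/0=0$), comparisons within each of the two types, and Boolean connectives; programs are built from assignments by sequencing, branching and while-loops. -/

import Mathlib

/-! ### Outerplanar graphs -/

/-- `S` is a polygonal arc in the plane with end points `a` and `b`: a simple, non-closed curve
made of finitely many (and at least one) straight segments `[p i, p (i+1)]`. -/
def IsPolygonalArc (S : Set (ℝ × ℝ)) (a b : ℝ × ℝ) : Prop :=
  ∃ (k : ℕ) (p : ℕ → ℝ × ℝ), 0 < k ∧ p 0 = a ∧ p k = b ∧
    (∀ i < k, p i ≠ p (i + 1)) ∧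
    (∀ i, i + 1 < k → segment ℝ (p i) (p (i + 1)) ∩ segment ℝ (p (i + 1)) (p (i + 2)) =
      {p (i + 1)}) ∧
    (∀ i j, i + 1 < j → j < k →
      Disjoint (segment ℝ (p i) (p (i + 1))) (segment ℝ (p j) (p (j + 1)))) ∧
    S = ⋃ i < k, segment ℝ (p i) (p (i + 1))

/-- The outer face of a bounded plane drawing `D`: the unbounded connected component of the
complement of `D`. -/
def outerFace (D : Set (ℝ × ℝ)) : Set (ℝ × ℝ) :=
  {x | x ∈ Dᶜ ∧ ¬ Bornology.IsBounded (connectedComponentIn Dᶜ x)}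

/-- A planar embedding of `G` in which all vertices are on the outer face: vertices are distinct
points, edges are polygonal arcs that meet each other and the vertices only in common
end points, and every vertex lies on the boundary of the outer face. -/
structure OuterplanarEmbedding {V : Type*} (G : SimpleGraph V) where
  pos : V → ℝ × ℝ
  arc : Sym2 V → Set (ℝ × ℝ)
  pos_injective : Function.Injective pos
  isPolygonalArc : ∀ u v, G.Adj u v → IsPolygonalArc (arc s(u, v)) (pos u) (pos v)
  vertex_arc : ∀ e ∈ G.edgeSet, ∀ w, pos w ∈ arc e → w ∈ e
  arc_arc : ∀ e ∈ G.edgeSet, ∀ f ∈ G.edgeSet, e ≠ f → ∀ x, x ∈ arc e → x ∈ arc f →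
    ∃ v, v ∈ e ∧ v ∈ f ∧ x = pos v
  outer : ∀ v, pos v ∈ frontier (outerFace (Set.range pos ∪ ⋃ e ∈ G.edgeSet, arc e))

/-- A (finite) graph is outerplanar if it has an embedding in the plane in which all the vertices
are on the outer face. -/
def IsOuterplanar {V : Type*} (G : SimpleGraph V) : Prop :=
  Nonempty (OuterplanarEmbedding G)

/-! ### Touching triangles representations -/

/-- The `i`-th side of the triangle with corners `t 0`, `t 1`, `t 2`. -/
def triangleSide (t : Fin 3 → ℝ × ℝ) (i : Fin 3) : Set (ℝ × ℝ) :=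
  segment ℝ (t i) (t (i + 1))

/-- Two triangles touch non-trivially if a side of one and a side of the other have more than
one point in common (the intersection is then a non-degenerate segment). -/
def TouchNontrivially (t t' : Fin 3 → ℝ × ℝ) : Prop :=
  ∃ i j : Fin 3, (triangleSide t i ∩ triangleSide t' j).Nontrivial

/-- `T` assigns to the vertices of `G` non-degenerate triangles without common interior points,
such that two of them touch non-trivially if and only if the vertices are adjacent. -/
structure IsTouchingTriangles {V : Type*} (G : SimpleGraph V) (T : V → Fin 3 → ℝ × ℝ) :
    Prop where
  nondegenerate : ∀ v, AffineIndependent ℝ (T v)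
  interior_disjoint : ∀ u v, u ≠ v →
    Disjoint (interior (convexHull ℝ (Set.range (T u))))
      (interior (convexHull ℝ (Set.range (T v))))
  adj_iff : ∀ u v, u ≠ v → (G.Adj u v ↔ TouchNontrivially (T u) (T v))

/-! ### The real random access machine, with structured programs and unit cost per operation -/

namespace RealRAM

/-- The memory: variables and arrays that hold natural numbers, and variables and arrays that
hold real numbers. Every program refers to finitely many variables and arrays. -/
structure State where
  nvar : ℕ → ℕ
  narr : ℕ → ℕ → ℕ
  rvar : ℕ → ℝ
  rarr : ℕ → ℕ → ℝ

/-- Expressions with a natural number as value; `get a i` is the entry of the array `a` at the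
index `i`, and `sub` is truncated subtraction. -/
inductive NExp where
  | const (k : ℕ)
  | var (x : ℕ)
  | get (a : ℕ) (i : NExp)
  | add (e f : NExp)
  | sub (e f : NExp)

/-- Expressions with a real number as value. -/
inductive RExp where
  | const (k : ℕ)
  | var (x : ℕ)
  | get (a : ℕ) (i : NExp)
  | add (e f : RExp)
  | sub (e f : RExp)
  | mul (e f : RExp)
  | div (e f : RExp)

/-- Tests. -/
inductive BExp where
  | nlt (e f : NExp)
  | rlt (e f : RExp)
  | not (b : BExp)
  | and (b c : BExp)

/-- Programs. -/
inductive Cmd where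
  | skip
  | nset (x : ℕ) (e : NExp)
  | nput (a : ℕ) (i e : NExp)
  | rset (x : ℕ) (e : RExp)
  | rput (a : ℕ) (i : NExp) (e : RExp)
  | seq (c d : Cmd)
  | ite (b : BExp) (c d : Cmd)
  | loop (b : BExp) (c : Cmd)

/-- The value of an expression. -/
def NExp.eval (σ : State) : NExp → ℕ
  | .const k => k
  | .var x => σ.nvar x
  | .get a i => σ.narr a (i.eval σ)
  | .add e f => e.eval σ + f.eval σ
  | .sub e f => e.eval σ - f.eval σ

/-- The number of operations needed to evaluate an expression. -/
def NExp.cost : NExp → ℕ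
  | .const _ => 1
  | .var _ => 1
  | .get _ i => i.cost + 1
  | .add e f => e.cost + f.cost + 1
  | .sub e f => e.cost + f.cost + 1

/-- The value of an expression. -/
noncomputable def RExp.eval (σ : State) : RExp → ℝ
  | .const k => (k : ℝ)
  | .var x => σ.rvar x
  | .get a i => σ.rarr a (i.eval σ)
  | .add e f => e.eval σ + f.eval σ
  | .sub e f => e.eval σ - f.eval σ
  | .mul e f => e.eval σ * f.eval σ
  | .div e f => e.eval σ / f.eval σ

/-- The number of operations needed to evaluate an expression. -/
def RExp.cost : RExp → ℕ
  | .const _ => 1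
  | .var _ => 1
  | .get _ i => i.cost + 1
  | .add e f => e.cost + f.cost + 1
  | .sub e f => e.cost + f.cost + 1
  | .mul e f => e.cost + f.cost + 1
  | .div e f => e.cost + f.cost + 1

/-- The truth of a test. -/
def BExp.Holds (σ : State) : BExp → Prop
  | .nlt e f => e.eval σ < f.eval σ
  | .rlt e f => e.eval σ < f.eval σ
  | .not b => ¬ b.Holds σ
  | .and b c => b.Holds σ ∧ c.Holds σ

/-- The number of operations needed to evaluate a test. -/
def BExp.cost : BExp → ℕ
  | .nlt e f => e.cost + f.cost + 1
  | .rlt e f => e.cost + f.cost + 1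
  | .not b => b.cost + 1
  | .and b c => b.cost + c.cost + 1

/-- Store `k` in the variable `x`. -/
def State.nset (σ : State) (x k : ℕ) : State :=
  { σ with nvar := Function.update σ.nvar x k }

/-- Store `k` in the array `a` at the index `i`. -/
def State.nput (σ : State) (a i k : ℕ) : State :=
  { σ with narr := Function.update σ.narr a (Function.update (σ.narr a) i k) }

/-- Store `r` in the variable `x`. -/
noncomputable def State.rset (σ : State) (x : ℕ) (r : ℝ) : State :=
  { σ with rvar := Function.update σ.rvar x r }

/-- Store `r` in the array `a` at the index `i`. -/
noncomputable def State.rput (σ : State) (a i : ℕ) (r : ℝ) : State :=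
  { σ with rarr := Function.update σ.rarr a (Function.update (σ.rarr a) i r) }

/-- `Run c σ t σ'`: the program `c`, started in the state `σ`, halts after exactly `t` operations
in the state `σ'`. -/
inductive Run : Cmd → State → ℕ → State → Prop
  | skip (σ) : Run .skip σ 1 σ
  | nset (σ x e) : Run (.nset x e) σ (e.cost + 1) (σ.nset x (e.eval σ))
  | nput (σ a i e) : Run (.nput a i e) σ (i.cost + e.cost + 1) (σ.nput a (i.eval σ) (e.eval σ))
  | rset (σ x e) : Run (.rset x e) σ (e.cost + 1) (σ.rset x (e.eval σ))
  | rput (σ a i e) : Run (.rput a i e) σ (i.cost + e.cost + 1) (σ.rput a (i.eval σ) (e.eval σ))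
  | seq {c d σ₀ σ₁ σ₂ s t} : Run c σ₀ s σ₁ → Run d σ₁ t σ₂ → Run (.seq c d) σ₀ (s + t) σ₂
  | ite_true {b c d σ σ' t} : b.Holds σ → Run c σ t σ' → Run (.ite b c d) σ (b.cost + t) σ'
  | ite_false {b c d σ σ' t} : ¬ b.Holds σ → Run d σ t σ' → Run (.ite b c d) σ (b.cost + t) σ'
  | loop_true {b c σ₀ σ₁ σ₂ s t} : b.Holds σ₀ → Run c σ₀ s σ₁ → Run (.loop b c) σ₁ t σ₂ →
      Run (.loop b c) σ₀ (b.cost + s + t) σ₂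
  | loop_false {b c σ} : ¬ b.Holds σ → Run (.loop b c) σ b.cost σ

/-- `L` is a system of adjacency lists of `G`: `L v` lists the neighbours of `v` in some order,
each once. -/
def IsAdjLists {n : ℕ} (G : SimpleGraph (Fin n)) (L : Fin n → List (Fin n)) : Prop :=
  ∀ v, (L v).Nodup ∧ ∀ w, w ∈ L v ↔ G.Adj v w

/-- The initial state on adjacency lists `L 0, …, L (n-1)`. Variable `0` holds `n`; array `1` holds
the concatenation of the lists; for `v ≤ n`, entry `v` of array `0` is the total length of the
lists before `L v`, so that `L v` occupies the entries of array `1` from this position up to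
(excluding) the one given by entry `v + 1`. Everything else is zero. -/
def inputState {n : ℕ} (L : Fin n → List (Fin n)) : State where
  nvar x := if x = 0 then n else 0
  narr a i :=
    if a = 0 then (if i ≤ n then (((List.ofFn L).take i).flatten).length else 0)
    else if a = 1 then (((List.ofFn L).flatten.map Fin.val).getD i 0)
    else 0
  rvar _ := 0
  rarr _ _ := 0

/-- The triangles that a state holds as output: corner `i` of the triangle of the vertex `v` has
its two coordinates in entry `v` of the arrays `2 * i` and `2 * i + 1` of real numbers. -/
def outputTriangles (n : ℕ) (σ : State) (v : Fin n) (i : Fin 3) : ℝ × ℝ :=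
  (σ.rarr (2 * (i : ℕ)) v, σ.rarr (2 * (i : ℕ) + 1) v)

end RealRAM

/-! Outerplanarity enters only through one combinatorial consequence, `Tripodless`: no vertex `u`
has three neighbours any two of which are joined by a walk avoiding `u` and the third. Suppose that
a drawing with all vertices on the outer face had such a `u`. For each pair of arms at `u`, close
them up by the walk between their ends. The third arm without `u` is connected, misses this curve
and ends on the boundary of the outer face, so the curve has winding number zero along it. Letting
the viewpoint tend to `u` along that arm gives a relation between angles at `u`. The three relations
together say that three arguments sum to zero, although the numbers with these arguments have
product `-1` (`tripod_false`, `OuterplanarEmbedding.tripodless`).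

A tripodless graph can be dismantled. A longest-path argument with rotations (`exists_removable`)
finds a vertex of degree at most one, or one of degree two that is on no heavy edge; heavy means
that two removed vertices already sit on the edge as ears. A vertex of degree two is removed as an
ear: its neighbours are joined by an edge, possibly an additional one, and the ears on that edge are
counted. The property that survives is tripodlessness of `Kernel`, the remaining graph together with
the ears on its edges (`Tripodless.add_edge`). Since two vertices have at most two common neighbours
there (`Tripodless.common`), no edge ever carries three ears. A vertex of degree at most one is
attached to its neighbour or, if it has none, to an artificial root `n` that is never removed; this
takes care of disconnected graphs.

The triangles are drawn by undoing the removals. A `Layout` keeps, next to the triangles, empty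
triangular regions: one for each ear still to be inserted on an edge, with arms along sides of the
two triangles, and one on each triangle for vertices attached to it alone. A new triangle in such a
region meets an owner in a segment if the edge to it is an original one, and in a single point
otherwise; thus additional edges leave no trace. Around an inserted ear there is space for one
further ear on each of its two edges, which is why ears must avoid heavy edges; around a vertex
attached to a single triangle there is space for two (`Layout.ear`, `Layout.pendant`).

For linear time, tripodless graphs have linearly many edges (`Tripodless.sum_degree_le`). The
machine keeps for every vertex its degree, the sum of its neighbours and the sum of their squares;
from these, one or two neighbours are found in constant time without any lists. Adjacency is tested
in a matrix of which only linearly many entries are ever written. A stack holds the candidates for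
removal; only the neighbours of a removed vertex can become removable, so they are the only ones to
be pushed. -/

section

open Filter Topology

/-! ### Winding angles of polygonal lines -/

/-- The plane `ℝ × ℝ` as the complex plane. -/
noncomputable abbrev toC : (ℝ × ℝ) ≃L[ℝ] ℂ := Complex.equivRealProdCLM.symm

/-- The signed angle under which the segment from `p` to `q` is seen from `x`. -/
noncomputable def viewAngle (p q x : ℝ × ℝ) : ℝ := (toC (q - x) / toC (p - x)).arg

theorem toC_ne_zero {x : ℝ × ℝ} (h : x ≠ 0) : toC x ≠ 0 := by
  simpa using h

/-- If the quotient were a real number `-r ≤ 0`, then `x` would be the convex combination of `p` and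
`q` with weights `r / (1 + r)` and `1 / (1 + r)`. So the argument in `viewAngle` stays away from its
branch cut off the segment. -/
theorem div_mem_slitPlane {p q x : ℝ × ℝ} (hx : x ∉ segment ℝ p q) :
    toC (q - x) / toC (p - x) ∈ Complex.slitPlane := by
  have hp : p - x ≠ 0 := fun h => hx (by rw [← sub_eq_zero.1 h]; exact left_mem_segment ℝ p q)
  have hp' : toC (p - x) ≠ 0 := toC_ne_zero hp
  rw [Complex.mem_slitPlane_iff]
  by_contra! hcon
  obtain ⟨hre, him⟩ := hcon
  set z := toC (q - x) / toC (p - x) with hz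
  obtain ⟨r, hr⟩ : ∃ r : ℝ, r = -z.re := ⟨_, rfl⟩
  have hzr : z = ((-r : ℝ) : ℂ) := by
    apply Complex.ext <;> simp [hr, him]
  have h1 : toC (q - x) = toC ((-r) • (p - x)) := by
    rw [map_smul, Complex.real_smul, ← hzr, hz, div_mul_cancel₀ _ hp']
  have h2 := toC.injective h1
  have hr0 : 0 ≤ r := by rw [hr]; linarith
  apply hx
  refine ⟨r / (1 + r), 1 / (1 + r), by positivity, by positivity, by field_simp; ring, ?_⟩
  have h3 : q = x - r • (p - x) := by
    rw [sub_eq_iff_eq_add] at h2; rw [h2]; simp; abel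
  have h4 : (1 + r) ≠ 0 := by positivity
  rw [h3]
  ext <;> simp <;> field_simp <;> ring

theorem continuousAt_viewAngle {p q x : ℝ × ℝ} (hx : x ∉ segment ℝ p q) :
    ContinuousAt (viewAngle p q) x := by
  have hp : p - x ≠ 0 := fun h => hx (by rw [← sub_eq_zero.1 h]; exact left_mem_segment ℝ p q)
  refine ContinuousAt.comp (g := Complex.arg) (f := fun x => toC (q - x) / toC (p - x))
    (Complex.continuousAt_arg (div_mem_slitPlane hx)) ?_
  refine ContinuousAt.div ?_ ?_ (toC_ne_zero hp)
  · exact toC.continuous.continuousAt.comp (by fun_prop)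
  · exact toC.continuous.continuousAt.comp (by fun_prop)

theorem viewAngle_swap {p q x : ℝ × ℝ} (hx : x ∉ segment ℝ p q) :
    viewAngle q p x = - viewAngle p q x := by
  have h := div_mem_slitPlane hx
  unfold viewAngle
  rw [← inv_div, Complex.arg_inv, if_neg]
  exact Complex.slitPlane_arg_ne_pi h

theorem coe_viewAngle {p q x : ℝ × ℝ} (hp : x ≠ p) (hq : x ≠ q) :
    (viewAngle p q x : Real.Angle) = (toC (q - x)).arg - (toC (p - x)).arg :=
  Complex.arg_div_coe_angle (toC_ne_zero (sub_ne_zero.2 hq.symm))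
    (toC_ne_zero (sub_ne_zero.2 hp.symm))

/-- The end point of the polygonal line that starts at `p` and runs through the points of `l`. -/
def lineEnd : ℝ × ℝ → List (ℝ × ℝ) → ℝ × ℝ
  | p, [] => p
  | _, q :: l => lineEnd q l

/-- The point set of the polygonal line that starts at `p` and runs through the points of `l`. -/
def lineSet : ℝ × ℝ → List (ℝ × ℝ) → Set (ℝ × ℝ)
  | p, [] => {p}
  | p, q :: l => segment ℝ p q ∪ lineSet q l

/-- The angle swept by a polygonal line, as seen from `x`. -/
noncomputable def lineAngle : ℝ × ℝ → List (ℝ × ℝ) → ℝ × ℝ → ℝ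
  | _, [], _ => 0
  | p, q :: l, x => viewAngle p q x + lineAngle q l x

theorem start_mem_lineSet (p : ℝ × ℝ) (l : List (ℝ × ℝ)) : p ∈ lineSet p l := by
  cases l with
  | nil => simp [lineSet]
  | cons q l => exact Or.inl (left_mem_segment ℝ p q)

theorem lineEnd_mem_lineSet (p : ℝ × ℝ) (l : List (ℝ × ℝ)) : lineEnd p l ∈ lineSet p l := by
  induction l generalizing p with
  | nil => simp [lineSet, lineEnd]
  | cons q l ih => exact Or.inr (ih q)

theorem lineEnd_append (p : ℝ × ℝ) (l m : List (ℝ × ℝ)) :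
    lineEnd p (l ++ m) = lineEnd (lineEnd p l) m := by
  induction l generalizing p with
  | nil => rfl
  | cons q l ih => exact ih q

theorem lineSet_append (p : ℝ × ℝ) (l m : List (ℝ × ℝ)) :
    lineSet p (l ++ m) = lineSet p l ∪ lineSet (lineEnd p l) m := by
  induction l generalizing p with
  | nil =>
    simp only [List.nil_append, lineSet, lineEnd]
    rw [Set.union_eq_self_of_subset_left]
    simpa using start_mem_lineSet p m
  | cons q l ih => simp only [List.cons_append, lineSet, ih, lineEnd, Set.union_assoc]

theorem lineAngle_append (p : ℝ × ℝ) (l m : List (ℝ × ℝ)) (x : ℝ × ℝ) :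
    lineAngle p (l ++ m) x = lineAngle p l x + lineAngle (lineEnd p l) m x := by
  induction l generalizing p with
  | nil => simp [lineAngle, lineEnd]
  | cons q l ih => simp only [List.cons_append, lineAngle, ih, lineEnd, add_assoc]

/-- Closed curves will run out along one arm and back along another. The angle changes sign because
off the line no segment is seen under the angle `π`, the only value at which the principal argument
fails to be odd. -/
theorem exists_reverse_line (p : ℝ × ℝ) (l : List (ℝ × ℝ)) :
    ∃ m, lineEnd (lineEnd p l) m = p ∧ lineSet (lineEnd p l) m = lineSet p l ∧
      ∀ x ∉ lineSet p l, lineAngle (lineEnd p l) m x = - lineAngle p l x := by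
  induction l generalizing p with
  | nil => exact ⟨[], rfl, rfl, by simp [lineAngle]⟩
  | cons q l ih =>
    obtain ⟨m, h1, h2, h3⟩ := ih q
    refine ⟨m ++ [p], ?_, ?_, ?_⟩
    · simp [lineEnd, lineEnd_append]
    · have : segment ℝ q p ∪ {p} = segment ℝ q p :=
        Set.union_eq_self_of_subset_right (by simpa using right_mem_segment ℝ q p)
      simp only [lineSet, lineSet_append, lineEnd, h1, h2, this]
      rw [segment_symm, Set.union_comm]
    · intro x hx
      simp only [lineSet, Set.mem_union, not_or] at hx
      simp only [lineEnd, lineAngle_append, lineAngle, h1, h3 x hx.2, viewAngle_swap hx.1]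
      ring

theorem isPreconnected_lineSet (p : ℝ × ℝ) (l : List (ℝ × ℝ)) : IsPreconnected (lineSet p l) := by
  induction l generalizing p with
  | nil => exact isPreconnected_singleton
  | cons q l ih =>
    exact IsPreconnected.union q (right_mem_segment ℝ p q) (start_mem_lineSet q l)
      (convex_segment p q).isPreconnected (ih q)

theorem continuousAt_lineAngle {p : ℝ × ℝ} {l : List (ℝ × ℝ)} {x : ℝ × ℝ} (hx : x ∉ lineSet p l) :
    ContinuousAt (lineAngle p l) x := by
  induction l generalizing p with
  | nil => exact continuousAt_const
  | cons q l ih =>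
    simp only [lineSet, Set.mem_union, not_or] at hx
    exact (continuousAt_viewAngle hx.1).add (ih hx.2)

/-- Modulo `2π` every view angle is a difference of two arguments, and the sum telescopes. For a
closed line this makes the angle `2π` times an integer, the winding number. -/
theorem coe_lineAngle {p : ℝ × ℝ} {l : List (ℝ × ℝ)} {x : ℝ × ℝ} (hx : x ∉ lineSet p l) :
    (lineAngle p l x : Real.Angle) = (toC (lineEnd p l - x)).arg - (toC (p - x)).arg := by
  induction l generalizing p with
  | nil => simp [lineAngle, lineEnd]
  | cons q l ih =>
    simp only [lineSet, Set.mem_union, not_or] at hx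
    have hq : x ≠ q := fun h => hx.1 (h ▸ right_mem_segment ℝ p q)
    have hp : x ≠ p := fun h => hx.1 (h ▸ left_mem_segment ℝ p q)
    simp only [lineAngle, Real.Angle.coe_add, ih hx.2, coe_viewAngle hp hq, lineEnd]
    abel

theorem lineAngle_mem_zmultiples {p : ℝ × ℝ} {l : List (ℝ × ℝ)} {x : ℝ × ℝ}
    (hc : lineEnd p l = p) (hx : x ∉ lineSet p l) :
    lineAngle p l x ∈ (AddSubgroup.zmultiples (2 * Real.pi) : AddSubgroup ℝ) := by
  have h := coe_lineAngle hx
  rw [hc, sub_self, Real.Angle.coe_eq_zero_iff] at h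
  obtain ⟨n, hn⟩ := h
  exact ⟨n, by simpa using hn⟩

/-- Off the closed curve the angle is continuous with values in the discrete group of multiples of
`2π`. -/
theorem lineAngle_eq_of_isPreconnected {p : ℝ × ℝ} {l : List (ℝ × ℝ)} {S : Set (ℝ × ℝ)}
    (hc : lineEnd p l = p) (hS : IsPreconnected S) (hd : Disjoint S (lineSet p l))
    {x y : ℝ × ℝ} (hx : x ∈ S) (hy : y ∈ S) : lineAngle p l x = lineAngle p l y := by
  have hcont : ContinuousOn (lineAngle p l) S := fun z hz =>
    (continuousAt_lineAngle (Set.disjoint_left.1 hd hz)).continuousWithinAt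
  exact hS.constant_of_mapsTo (T := (AddSubgroup.zmultiples (2 * Real.pi) : Set ℝ))
    ⟨inferInstanceAs (DiscreteTopology (AddSubgroup.zmultiples (2 * Real.pi)))⟩ hcont
    (fun z hz => lineAngle_mem_zmultiples hc (Set.disjoint_left.1 hd hz)) hx hy

/-- The quotient `(q - x) / (p - x) = 1 + (q - p) / (p - x)` tends to `1`, where the argument is
continuous and zero. -/
theorem tendsto_viewAngle_cobounded (p q : ℝ × ℝ) :
    Tendsto (viewAngle p q) (Bornology.cobounded (ℝ × ℝ)) (𝓝 0) := by
  have h0 : Tendsto (fun x => toC (p - x)) (Bornology.cobounded (ℝ × ℝ))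
      (Bornology.cobounded ℂ) := by
    have h1 : Tendsto (fun x : ℝ × ℝ => p - x) (Bornology.cobounded (ℝ × ℝ))
        (Bornology.cobounded (ℝ × ℝ)) := by
      exact tendsto_const_sub_cobounded p
    exact (toC.antilipschitz.tendsto_cobounded).comp h1
  have h2 : Tendsto (fun x => toC (q - x) / toC (p - x)) (Bornology.cobounded (ℝ × ℝ)) (𝓝 1) := by
    have h3 : Tendsto (fun x => 1 + toC (q - p) * (toC (p - x))⁻¹)
        (Bornology.cobounded (ℝ × ℝ)) (𝓝 (1 + toC (q - p) * 0)) :=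
      (((tendsto_inv₀_cobounded).comp h0).const_mul _).const_add _
    rw [mul_zero, add_zero] at h3
    refine h3.congr' ?_
    have h4 : ∀ᶠ x in Bornology.cobounded (ℝ × ℝ), x ≠ p := by
      exact Bornology.eventually_ne_cobounded p
    filter_upwards [h4] with x hx
    have hp : toC (p - x) ≠ 0 := toC_ne_zero (sub_ne_zero.2 hx.symm)
    have e : q - x = (q - p) + (p - x) := by abel
    rw [e, map_add]
    field_simp
    ring
  have h5 := (Complex.continuousAt_arg Complex.one_mem_slitPlane).tendsto.comp h2
  rw [Complex.arg_one] at h5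
  exact h5

theorem tendsto_lineAngle_cobounded (p : ℝ × ℝ) (l : List (ℝ × ℝ)) :
    Tendsto (lineAngle p l) (Bornology.cobounded (ℝ × ℝ)) (𝓝 0) := by
  induction l generalizing p with
  | nil => exact tendsto_const_nhds
  | cons q l ih =>
    have := (tendsto_viewAngle_cobounded p q).add (ih q)
    rw [add_zero] at this
    exact this

/-- An unbounded component contains points so far away that the angle is below `2π` in absolute
value; being a multiple of `2π`, it is zero there, and it is constant on the component. -/
theorem lineAngle_eq_zero_of_mem_outerFace {p : ℝ × ℝ} {l : List (ℝ × ℝ)} {D : Set (ℝ × ℝ)}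
    (hc : lineEnd p l = p) (hl : lineSet p l ⊆ D) {x : ℝ × ℝ} (hx : x ∈ outerFace D) :
    lineAngle p l x = 0 := by
  obtain ⟨hxD, hub⟩ := hx
  have hdis : Disjoint (connectedComponentIn Dᶜ x) (lineSet p l) := by
    rw [Set.disjoint_left]
    intro z hz hz'
    exact connectedComponentIn_subset _ _ hz (hl hz')
  have hev : ∀ᶠ y in Bornology.cobounded (ℝ × ℝ), |lineAngle p l y| < 2 * Real.pi := by
    have := (tendsto_lineAngle_cobounded p l).abs
    rw [abs_zero] at this
    exact this.eventually (gt_mem_nhds (by positivity))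
  obtain ⟨y, hy, hyl⟩ : ∃ y ∈ connectedComponentIn Dᶜ x, |lineAngle p l y| < 2 * Real.pi := by
    by_contra! hcon
    apply hub
    rw [← Bornology.isCobounded_compl_iff]
    have : {y | |lineAngle p l y| < 2 * Real.pi} ∈ Bornology.cobounded (ℝ × ℝ) := hev
    refine Bornology.isCobounded_def.2 (Filter.mem_of_superset this ?_)
    intro y hy hy'
    exact absurd (hcon y hy') (not_le.2 hy)
  have hxx := mem_connectedComponentIn (F := Dᶜ) hxD
  rw [lineAngle_eq_of_isPreconnected hc isPreconnected_connectedComponentIn hdis hxx hy]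
  obtain ⟨n, hn⟩ := lineAngle_mem_zmultiples hc (Set.disjoint_left.1 hdis hy)
  simp only [zsmul_eq_mul] at hn
  rw [← hn] at hyl ⊢
  have hpi : (0:ℝ) < 2 * Real.pi := by positivity
  rw [abs_mul, abs_of_pos hpi] at hyl
  have : |(n:ℝ)| < 1 := by
    by_contra hge
    push Not at hge
    nlinarith
  have hn0 : n = 0 := by
    have : |n| < 1 := by exact_mod_cast this
    exact Int.abs_lt_one_iff.1 this
  simp [hn0]

/-- Vertices lie on the boundary of the outer face and not in it; continuity off the curve extends
the vanishing to them. -/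
theorem lineAngle_eq_zero_of_mem_closure {p : ℝ × ℝ} {l : List (ℝ × ℝ)} {D : Set (ℝ × ℝ)}
    (hc : lineEnd p l = p) (hl : lineSet p l ⊆ D) {x : ℝ × ℝ} (hx : x ∈ closure (outerFace D))
    (hxl : x ∉ lineSet p l) : lineAngle p l x = 0 := by
  have hcont := continuousAt_lineAngle hxl
  have hmem := hcont.continuousWithinAt (s := outerFace D) |>.mem_closure_image hx
  have hsub : lineAngle p l '' outerFace D ⊆ {0} := by
    rintro _ ⟨y, hy, rfl⟩
    exact lineAngle_eq_zero_of_mem_outerFace hc hl hy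
  have := closure_mono hsub hmem
  simpa using this

end

/-! ### Three arms that leave a common point -/

section

open Filter Topology

/-- The viewpoint tends to an end point of the segment, where the angle has no continuous extension.
Along the ray towards `c` the vector to `u` is `-t (c - u)`, and the positive factor `t` does not
affect the argument; so a limit exists that depends on the direction of the ray. -/
theorem tendsto_viewAngle_ray {u b c : ℝ × ℝ}
    (h : -(toC (b - u) / toC (c - u)) ∈ Complex.slitPlane) :
    Tendsto (fun t : ℝ => viewAngle u b (u + t • (c - u))) (𝓝[>] 0)
      (𝓝 (-(toC (b - u) / toC (c - u))).arg) := by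
  have h1 : Tendsto (fun t : ℝ => ((toC (b - u) - t * toC (c - u)) / (-toC (c - u))).arg) (𝓝[>] 0)
      (𝓝 (-(toC (b - u) / toC (c - u))).arg) := by
    refine (Complex.continuousAt_arg h).tendsto.comp ?_
    have : Tendsto (fun t : ℝ => (toC (b - u) - t * toC (c - u)) / (-toC (c - u))) (𝓝 0)
        (𝓝 ((toC (b - u) - (0 : ℝ) * toC (c - u)) / (-toC (c - u)))) := by
      apply ContinuousAt.tendsto
        (f := fun t : ℝ => (toC (b - u) - t * toC (c - u)) / (-toC (c - u)))
      fun_prop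
    simp only [Complex.ofReal_zero, zero_mul, sub_zero, div_neg] at this
    simp only [div_neg]
    exact this.mono_left nhdsWithin_le_nhds
  refine h1.congr' ?_
  filter_upwards [self_mem_nhdsWithin] with t ht
  have ht : 0 < t := ht
  unfold viewAngle
  have e1 : b - (u + t • (c - u)) = (b - u) - t • (c - u) := by abel
  have e2 : u - (u + t • (c - u)) = - (t • (c - u)) := by abel
  rw [e1, e2]
  generalize b - u = B
  generalize c - u = C
  rw [map_sub, map_neg, map_smul, Complex.real_smul]
  rw [← Complex.arg_real_mul _ (inv_pos.2 ht)]
  congr 1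
  rw [Complex.ofReal_inv]
  have ht' : (t : ℂ) ≠ 0 := by exact_mod_cast ht.ne'
  by_cases hz : toC C = 0
  · simp [hz]
  · field_simp

/-- Segments that share only `u` leave it in different directions. Hence `0` is not on the segment
from `c - u` to `-(b - u)`, and `div_mem_slitPlane` applies to it. -/
theorem neg_div_mem_slitPlane {u b c : ℝ × ℝ} (hb : b ≠ u) (hc : c ≠ u)
    (h : ∀ x ∈ segment ℝ u c, x ≠ u → x ∉ segment ℝ u b) :
    -(toC (b - u) / toC (c - u)) ∈ Complex.slitPlane := by
  have h0 : (0 : ℝ × ℝ) ∉ segment ℝ (c - u) (-(b - u)) := by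
    rintro ⟨α, β, hα, hβ, hαβ, he⟩
    have he' : α • (c - u) = β • (b - u) := by
      rw [smul_neg, ← sub_eq_add_neg, sub_eq_zero] at he; exact he
    have hα0 : α ≠ 0 := by
      rintro rfl
      have : β = 1 := by linarith
      subst this
      simp only [zero_smul, one_smul] at he'
      exact hb (sub_eq_zero.1 he'.symm)
    refine h (u + α • (c - u)) ⟨1 - α, α, by linarith, hα, by ring, by
      rw [smul_sub, sub_smul, one_smul]; abel⟩ ?_ ?_
    · intro hu
      rw [add_eq_left, smul_eq_zero] at hu
      exact hu.elim hα0 (fun h => hc (sub_eq_zero.1 h))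
    · rw [he']
      exact ⟨1 - β, β, by linarith, hβ, by ring, by rw [smul_sub, sub_smul, one_smul]; abel⟩
  have := div_mem_slitPlane h0
  rwa [sub_zero, sub_zero, map_neg, neg_div] at this

/-- All terms of `hz` are continuous at `u` except for the first segments of the two arms;
`tendsto_viewAngle_ray` gives their limits along the third arm. -/
theorem tripod_limit {u b₁ b₂ b₃ : ℝ × ℝ} {r₁ r₂ q : List (ℝ × ℝ)}
    (h₁ : -(toC (b₁ - u) / toC (b₃ - u)) ∈ Complex.slitPlane)
    (h₂ : -(toC (b₂ - u) / toC (b₃ - u)) ∈ Complex.slitPlane) (hb : b₃ ≠ u)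
    (hr₁ : u ∉ lineSet b₁ r₁) (hr₂ : u ∉ lineSet b₂ r₂) (hq : u ∉ lineSet (lineEnd b₁ r₁) q)
    (hz : ∀ x ∈ segment ℝ u b₃, x ≠ u → lineAngle u (b₁ :: r₁) x +
      lineAngle (lineEnd b₁ r₁) q x - lineAngle u (b₂ :: r₂) x = 0) :
    (-(toC (b₁ - u) / toC (b₃ - u))).arg + lineAngle b₁ r₁ u + lineAngle (lineEnd b₁ r₁) q u
      - ((-(toC (b₂ - u) / toC (b₃ - u))).arg + lineAngle b₂ r₂ u) = 0 := by
  have hx : Tendsto (fun t : ℝ => u + t • (b₃ - u)) (𝓝[>] 0) (𝓝 u) := by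
    have : Tendsto (fun t : ℝ => u + t • (b₃ - u)) (𝓝 0) (𝓝 (u + (0 : ℝ) • (b₃ - u))) := by
      apply ContinuousAt.tendsto (f := fun t : ℝ => u + t • (b₃ - u))
      fun_prop
    rw [zero_smul, add_zero] at this
    exact this.mono_left nhdsWithin_le_nhds
  have l1 := (tendsto_viewAngle_ray h₁).add ((continuousAt_lineAngle hr₁).tendsto.comp hx)
  have l2 := (tendsto_viewAngle_ray h₂).add ((continuousAt_lineAngle hr₂).tendsto.comp hx)
  have l3 := (continuousAt_lineAngle hq).tendsto.comp hx
  have l4 := (l1.add l3).sub l2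
  refine tendsto_nhds_unique l4 (tendsto_const_nhds.congr' ?_)
  have hlt : ∀ᶠ t : ℝ in 𝓝[>] 0, t < 1 :=
    (gt_mem_nhds (one_pos : (0:ℝ) < 1)).filter_mono nhdsWithin_le_nhds
  filter_upwards [self_mem_nhdsWithin, hlt] with t ht ht1
  have ht : 0 < t := ht
  have := hz (u + t • (b₃ - u)) ⟨1 - t, t, by linarith, ht.le, by ring, by
      rw [smul_sub, sub_smul, one_smul]; abel⟩ (by
    intro hu
    rw [add_eq_left, smul_eq_zero] at hu
    exact hu.elim ht.ne' (fun h => hb (sub_eq_zero.1 h)))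
  simp only [lineAngle] at this
  simp only [Function.comp]
  linarith

/-- Three arms that leave `u` cannot each have winding number zero with respect to the closed curve
through the other two. -/
theorem tripod_false {u b₁ b₂ b₃ : ℝ × ℝ} {r₁ r₂ r₃ q₁₂ q₂₃ q₃₁ : List (ℝ × ℝ)}
    (hb₁ : b₁ ≠ u) (hb₂ : b₂ ≠ u) (hb₃ : b₃ ≠ u)
    (d₁₂ : ∀ x ∈ segment ℝ u b₁, x ≠ u → x ∉ segment ℝ u b₂)
    (d₂₃ : ∀ x ∈ segment ℝ u b₂, x ≠ u → x ∉ segment ℝ u b₃)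
    (d₃₁ : ∀ x ∈ segment ℝ u b₃, x ≠ u → x ∉ segment ℝ u b₁)
    (hr₁ : u ∉ lineSet b₁ r₁) (hr₂ : u ∉ lineSet b₂ r₂) (hr₃ : u ∉ lineSet b₃ r₃)
    (hq₁₂ : u ∉ lineSet (lineEnd b₁ r₁) q₁₂) (hq₂₃ : u ∉ lineSet (lineEnd b₂ r₂) q₂₃)
    (hq₃₁ : u ∉ lineSet (lineEnd b₃ r₃) q₃₁)
    (z₃ : ∀ x ∈ segment ℝ u b₃, x ≠ u → lineAngle u (b₁ :: r₁) x +
      lineAngle (lineEnd b₁ r₁) q₁₂ x - lineAngle u (b₂ :: r₂) x = 0)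
    (z₁ : ∀ x ∈ segment ℝ u b₁, x ≠ u → lineAngle u (b₂ :: r₂) x +
      lineAngle (lineEnd b₂ r₂) q₂₃ x - lineAngle u (b₃ :: r₃) x = 0)
    (z₂ : ∀ x ∈ segment ℝ u b₂, x ≠ u → lineAngle u (b₃ :: r₃) x +
      lineAngle (lineEnd b₃ r₃) q₃₁ x - lineAngle u (b₁ :: r₁) x = 0)
    (zu : lineAngle (lineEnd b₁ r₁) q₁₂ u + lineAngle (lineEnd b₂ r₂) q₂₃ u +
      lineAngle (lineEnd b₃ r₃) q₃₁ u = 0) : False := by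
  have s₁₃ := neg_div_mem_slitPlane hb₁ hb₃ d₃₁
  have s₃₂ := neg_div_mem_slitPlane hb₃ hb₂ d₂₃
  have s₂₁ := neg_div_mem_slitPlane hb₂ hb₁ d₁₂
  have inv : ∀ {a b : ℝ × ℝ}, -(toC (a - u) / toC (b - u)) ∈ Complex.slitPlane →
      (-(toC (b - u) / toC (a - u))).arg = - (-(toC (a - u) / toC (b - u))).arg ∧
      -(toC (b - u) / toC (a - u)) ∈ Complex.slitPlane := by
    intro a b h
    have e : -(toC (b - u) / toC (a - u)) = (-(toC (a - u) / toC (b - u)))⁻¹ := by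
      rw [inv_neg, inv_div]
    rw [e]
    exact ⟨by rw [Complex.arg_inv, if_neg (Complex.slitPlane_arg_ne_pi h)], by
      rw [Complex.mem_slitPlane_iff_arg, Complex.arg_inv,
        if_neg (Complex.slitPlane_arg_ne_pi h)]
      exact ⟨fun h' => absurd (by linarith) (Complex.neg_pi_lt_arg
        (-(toC (a - u) / toC (b - u)))).ne', inv_ne_zero (Complex.slitPlane_ne_zero h)⟩⟩
  have e₃ := tripod_limit s₁₃ (inv s₃₂).2 hb₃ hr₁ hr₂ hq₁₂ z₃
  have e₁ := tripod_limit s₂₁ (inv s₁₃).2 hb₁ hr₂ hr₃ hq₂₃ z₁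
  have e₂ := tripod_limit s₃₂ (inv s₂₁).2 hb₂ hr₃ hr₁ hq₃₁ z₂
  rw [(inv s₃₂).1] at e₃
  rw [(inv s₁₃).1] at e₁
  rw [(inv s₂₁).1] at e₂
  -- In the sum of the three limits the angles of the tails `r₁`, `r₂`, `r₃` cancel, those of the
  -- walks vanish by `zu`, and each of the three arguments occurs twice.
  have hsum : (-(toC (b₁ - u) / toC (b₃ - u))).arg + (-(toC (b₃ - u) / toC (b₂ - u))).arg +
      (-(toC (b₂ - u) / toC (b₁ - u))).arg = 0 := by linarith
  have n₁ : toC (b₁ - u) ≠ 0 := toC_ne_zero (sub_ne_zero.2 hb₁)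
  have n₂ : toC (b₂ - u) ≠ 0 := toC_ne_zero (sub_ne_zero.2 hb₂)
  have n₃ : toC (b₃ - u) ≠ 0 := toC_ne_zero (sub_ne_zero.2 hb₃)
  have hA : ((-(toC (b₁ - u) / toC (b₃ - u)) * -(toC (b₃ - u) / toC (b₂ - u)) *
      -(toC (b₂ - u) / toC (b₁ - u))).arg : Real.Angle) = 0 := by
    rw [Complex.arg_mul_coe_angle, Complex.arg_mul_coe_angle, ← Real.Angle.coe_add,
      ← Real.Angle.coe_add, hsum, Real.Angle.coe_zero]
    all_goals simp [n₁, n₂, n₃, -map_sub]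
  -- The quotients cancel cyclically and three signs are left; the argument of `-1` is `π` and not
  -- `0`.
  have hm : -(toC (b₁ - u) / toC (b₃ - u)) * -(toC (b₃ - u) / toC (b₂ - u)) *
      -(toC (b₂ - u) / toC (b₁ - u)) = -1 := by
    field_simp
  rw [hm, Complex.arg_neg_one] at hA
  exact Real.Angle.pi_ne_zero hA

end

/-! ### Drawings with all vertices on the outer face contain no tripods -/

section

open Filter Topology

/-- `b` can be reached from `a` by edges of `E` that avoid `c` and `d`. -/
def Avoiding {V : Type*} (E : V → V → Prop) (c d : V) : V → V → Prop :=
  Relation.ReflTransGen (fun x y => E x y ∧ x ≠ c ∧ x ≠ d ∧ y ≠ c ∧ y ≠ d)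

/-- No vertex has three neighbours, any two of which are joined by a walk that avoids the vertex
and the third neighbour. -/
def Tripodless {V : Type*} (E : V → V → Prop) : Prop :=
  ∀ u a b c, E u a → E u b → E u c → a ≠ b → b ≠ c → c ≠ a →
    Avoiding E u c a b → Avoiding E u a b c → Avoiding E u b c a → False

theorem lineEnd_map_range (p : ℕ → ℝ × ℝ) (k : ℕ) :
    lineEnd (p 0) ((List.range k).map fun i => p (i + 1)) = p k := by
  induction k with
  | zero => rfl
  | succ k ih => rw [List.range_succ, List.map_append, lineEnd_append, ih]; rfl

theorem lineSet_map_range (p : ℕ → ℝ × ℝ) (k : ℕ) :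
    lineSet (p 0) ((List.range k).map fun i => p (i + 1)) =
      {p 0} ∪ ⋃ i < k, segment ℝ (p i) (p (i + 1)) := by
  induction k with
  | zero => simp [lineSet]
  | succ k ih =>
    rw [List.range_succ, List.map_append, lineSet_append, ih, lineEnd_map_range,
      Set.biUnion_lt_succ, Set.union_assoc]
    have : segment ℝ (p k) (p (k + 1)) ∪ {p (k + 1)} = segment ℝ (p k) (p (k + 1)) :=
      Set.union_eq_self_of_subset_right (by simpa using right_mem_segment ℝ (p k) (p (k + 1)))
    simp [lineSet, this]

/-- Splitting off the first segment makes the arc straight near its start and keeps the rest away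
from the start, as the limits along rays require. -/
theorem IsPolygonalArc.exists_line {S : Set (ℝ × ℝ)} {a b : ℝ × ℝ} (h : IsPolygonalArc S a b) :
    ∃ b₁ r, lineEnd b₁ r = b ∧ S = lineSet a (b₁ :: r) ∧ a ∉ lineSet b₁ r := by
  obtain ⟨k, p, hk, rfl, rfl, hne, hadj, hdis, rfl⟩ := h
  obtain ⟨k, rfl⟩ : ∃ m, k = m + 1 := ⟨k - 1, by omega⟩
  refine ⟨p 1, (List.range k).map fun i => p (i + 1 + 1),
    lineEnd_map_range (fun i => p (i + 1)) k, ?_, ?_⟩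
  · have h1 := lineSet_map_range p (k + 1)
    rw [List.range_succ_eq_map, List.map_cons, List.map_map] at h1
    have h2 : {p 0} ∪ ⋃ i < k + 1, segment ℝ (p i) (p (i + 1)) =
        ⋃ i < k + 1, segment ℝ (p i) (p (i + 1)) := by
      apply Set.union_eq_self_of_subset_left
      simp only [Set.singleton_subset_iff, Set.mem_iUnion]
      exact ⟨0, by omega, left_mem_segment ℝ _ _⟩
    rw [← h2, ← h1]
    rfl
  · rw [lineSet_map_range (fun i => p (i + 1)) k]
    simp only [Set.mem_union, Set.mem_singleton_iff, Set.mem_iUnion, not_or, not_exists]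
    refine ⟨hne 0 (by omega), fun i hi hmem => ?_⟩
    have h0 := left_mem_segment ℝ (p 0) (p 1)
    rcases Nat.eq_zero_or_pos i with rfl | hpos
    · have : p 0 ∈ ({p 1} : Set (ℝ × ℝ)) := by
        rw [← hadj 0 (by omega)]; exact ⟨h0, hmem⟩
      exact hne 0 (by omega) this
    · exact Set.disjoint_left.1 (hdis 0 (i + 1) (by omega) (by omega)) h0 hmem

/-- This transports the vanishing of a winding number from the far end of an arm to points
arbitrarily close to `u`. -/
theorem isPreconnected_arm {u b : ℝ × ℝ} (r : List (ℝ × ℝ)) (hb : b ≠ u) :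
    IsPreconnected ({x ∈ segment ℝ u b | x ≠ u} ∪ lineSet b r) := by
  refine IsPreconnected.union b ⟨right_mem_segment ℝ u b, hb⟩ (start_mem_lineSet b r) ?_
    (isPreconnected_lineSet b r)
  have : {x ∈ segment ℝ u b | x ≠ u} = (fun t : ℝ => u + t • (b - u)) '' Set.Ioc 0 1 := by
    rw [segment_eq_image']
    ext x
    constructor
    · rintro ⟨⟨t, ⟨h0, h1⟩, rfl⟩, hx⟩
      refine ⟨t, ⟨lt_of_le_of_ne h0 ?_, h1⟩, rfl⟩
      rintro rfl
      simp at hx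
    · rintro ⟨t, ⟨h0, h1⟩, rfl⟩
      refine ⟨⟨t, ⟨h0.le, h1⟩, rfl⟩, fun hu => ?_⟩
      simp only [add_eq_left, smul_eq_zero] at hu
      exact hu.elim h0.ne' (fun h => hb (sub_eq_zero.1 h))
  rw [this]
  exact isPreconnected_Ioc.image _ (by fun_prop)

/-- The closed curve consists of the first arm, the walk, and the second arm reversed. The third arm
without `u` misses it, is connected, and ends in the closure of the outer face. -/
theorem arm_angle_eq_zero {D : Set (ℝ × ℝ)} {u b₁ b₂ b₃ : ℝ × ℝ} {r₁ r₂ r₃ q : List (ℝ × ℝ)}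
    (hb : b₃ ≠ u) (hq : lineEnd (lineEnd b₁ r₁) q = lineEnd b₂ r₂) (hu : u ∉ lineSet b₃ r₃)
    (D₁ : lineSet u (b₁ :: r₁) ⊆ D) (D₂ : lineSet u (b₂ :: r₂) ⊆ D)
    (Dq : lineSet (lineEnd b₁ r₁) q ⊆ D) (hout : lineEnd b₃ r₃ ∈ closure (outerFace D))
    (n₁ : ∀ x ∈ lineSet u (b₃ :: r₃), x ≠ u → x ∉ lineSet u (b₁ :: r₁))
    (n₂ : ∀ x ∈ lineSet u (b₃ :: r₃), x ≠ u → x ∉ lineSet u (b₂ :: r₂))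
    (nq : ∀ x ∈ lineSet u (b₃ :: r₃), x ≠ u → x ∉ lineSet (lineEnd b₁ r₁) q)
    {x : ℝ × ℝ} (hx : x ∈ segment ℝ u b₃) (hxu : x ≠ u) :
    lineAngle u (b₁ :: r₁) x + lineAngle (lineEnd b₁ r₁) q x - lineAngle u (b₂ :: r₂) x = 0 := by
  obtain ⟨m, hm₁, hm₂, hm₃⟩ := exists_reverse_line u (b₂ :: r₂)
  simp only [lineEnd] at hm₁ hm₂ hm₃
  set l := (b₁ :: r₁) ++ (q ++ m) with hl
  have hend : lineEnd u l = u := by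
    rw [hl, lineEnd_append, lineEnd_append]
    simp only [lineEnd, hq, hm₁]
  have hset : lineSet u l =
      lineSet u (b₁ :: r₁) ∪ (lineSet (lineEnd b₁ r₁) q ∪ lineSet u (b₂ :: r₂)) := by
    rw [hl, lineSet_append, lineSet_append]
    simp only [lineEnd, hq, hm₂]
  have hdisj : ∀ y ∈ lineSet u (b₃ :: r₃), y ≠ u → y ∉ lineSet u l := by
    intro y hy hyu
    rw [hset]
    simp only [Set.mem_union, not_or]
    exact ⟨n₁ y hy hyu, nq y hy hyu, n₂ y hy hyu⟩
  have hS : ∀ y ∈ {x ∈ segment ℝ u b₃ | x ≠ u} ∪ lineSet b₃ r₃,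
      y ∈ lineSet u (b₃ :: r₃) ∧ y ≠ u := by
    rintro y (⟨hy, hyu⟩ | hy)
    · exact ⟨Or.inl hy, hyu⟩
    · exact ⟨Or.inr hy, fun h => hu (h ▸ hy)⟩
  have hend₃ : lineEnd b₃ r₃ ∈ {x ∈ segment ℝ u b₃ | x ≠ u} ∪ lineSet b₃ r₃ :=
    Or.inr (lineEnd_mem_lineSet b₃ r₃)
  have h0 := lineAngle_eq_zero_of_mem_closure (D := D) hend
    (by rw [hset]; exact Set.union_subset D₁ (Set.union_subset Dq D₂)) hout
    (hdisj _ (hS _ hend₃).1 (hS _ hend₃).2)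
  have hxx := lineAngle_eq_of_isPreconnected (x := x) hend (isPreconnected_arm r₃ hb)
    (Set.disjoint_left.2 fun y hy => hdisj y (hS y hy).1 (hS y hy).2) (Or.inl ⟨hx, hxu⟩) hend₃
  rw [h0, hl, lineAngle_append, lineAngle_append] at hxx
  simp only [lineEnd, hq] at hxx
  rw [hm₃ x (n₂ x (Or.inl hx) hxu)] at hxx
  linarith

/-- The point set of the drawing of a graph. -/
def OuterplanarEmbedding.drawing {V : Type*} {G : SimpleGraph V} (φ : OuterplanarEmbedding G) :
    Set (ℝ × ℝ) := Set.range φ.pos ∪ ⋃ e ∈ G.edgeSet, φ.arc e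

theorem OuterplanarEmbedding.arc_subset_drawing {V : Type*} {G : SimpleGraph V}
    (φ : OuterplanarEmbedding G) {a b : V} (h : G.Adj a b) :
    φ.arc s(a, b) ⊆ φ.drawing := fun _ hx =>
  Or.inr (Set.mem_biUnion (show s(a, b) ∈ G.edgeSet from h) hx)

/-- The arcs of the walk are concatenated. Recording for each point a vertex or an edge that carries
it allows `vertex_arc` and `arc_arc` to separate the line from `u` and from the third arm. -/
theorem OuterplanarEmbedding.exists_line_of_avoiding {V : Type*} {G : SimpleGraph V}
    (φ : OuterplanarEmbedding G) {c d a b : V} (hac : a ≠ c) (had : a ≠ d)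
    (h : Avoiding G.Adj c d a b) :
    ∃ q, lineEnd (φ.pos a) q = φ.pos b ∧ ∀ x ∈ lineSet (φ.pos a) q,
      (∃ w, w ≠ c ∧ w ≠ d ∧ x = φ.pos w) ∨
      ∃ y z, G.Adj y z ∧ y ≠ c ∧ y ≠ d ∧ z ≠ c ∧ z ≠ d ∧ x ∈ φ.arc s(y, z) := by
  unfold Avoiding at h
  induction h with
  | refl => exact ⟨[], rfl, fun x hx => Or.inl ⟨a, hac, had, hx⟩⟩
  | @tail y z _ hyz ih =>
    obtain ⟨q, hq, hx⟩ := ih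
    obtain ⟨b₁, r, h1, h2, -⟩ := (φ.isPolygonalArc y z hyz.1).exists_line
    refine ⟨q ++ (b₁ :: r), by rw [lineEnd_append, hq]; exact h1, fun x hxm => ?_⟩
    rw [lineSet_append, hq, ← h2] at hxm
    rcases hxm with hxm | hxm
    · exact hx x hxm
    · exact Or.inr ⟨y, z, hyz.1, hyz.2.1, hyz.2.2.1, hyz.2.2.2.1, hyz.2.2.2.2, hxm⟩

/-- The three edges at `u` are the arms of `tripod_false`, the drawn walks close them up. A walk
that avoids `u` and the third neighbour can meet the third arm neither in a vertex nor in a point of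
an edge. -/
theorem OuterplanarEmbedding.tripodless {V : Type*} {G : SimpleGraph V}
    (φ : OuterplanarEmbedding G) : Tripodless G.Adj := by
  intro u a b c ua ub uc hab hbc hca wab wbc wca
  obtain ⟨b₁, r₁, e₁, s₁, n₁⟩ := (φ.isPolygonalArc u a ua).exists_line
  obtain ⟨b₂, r₂, e₂, s₂, n₂⟩ := (φ.isPolygonalArc u b ub).exists_line
  obtain ⟨b₃, r₃, e₃, s₃, n₃⟩ := (φ.isPolygonalArc u c uc).exists_line
  obtain ⟨q₁₂, f₁₂, g₁₂⟩ := φ.exists_line_of_avoiding ua.ne' hca.symm wab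
  obtain ⟨q₂₃, f₂₃, g₂₃⟩ := φ.exists_line_of_avoiding ub.ne' hab.symm wbc
  obtain ⟨q₃₁, f₃₁, g₃₁⟩ := φ.exists_line_of_avoiding uc.ne' hbc.symm wca
  have arms : ∀ {a b : V}, G.Adj u a → G.Adj u b → a ≠ b → ∀ x ∈ φ.arc s(u, a), x ≠ φ.pos u →
      x ∉ φ.arc s(u, b) := by
    intro a b ua ub hab x hx hxu hx'
    obtain ⟨v, hv, hv', rfl⟩ := φ.arc_arc s(u, a) ua s(u, b) ub (by
      simp [hab, ub.ne]) x hx hx'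
    rcases Sym2.mem_iff.1 hv with rfl | rfl
    · exact hxu rfl
    · rcases Sym2.mem_iff.1 hv' with rfl | rfl
      · exact hxu rfl
      · exact hab rfl
  have walks : ∀ {a b c : V} {q : List (ℝ × ℝ)}, G.Adj u c →
      (∀ x ∈ lineSet (φ.pos a) q, (∃ w, w ≠ u ∧ w ≠ c ∧ x = φ.pos w) ∨
        ∃ y z, G.Adj y z ∧ y ≠ u ∧ y ≠ c ∧ z ≠ u ∧ z ≠ c ∧ x ∈ φ.arc s(y, z)) →
      lineSet (φ.pos a) q ⊆ φ.drawing ∧ φ.pos u ∉ lineSet (φ.pos a) q ∧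
      ∀ x ∈ φ.arc s(u, c), x ≠ φ.pos u → x ∉ lineSet (φ.pos a) q := by
    intro a b c q uc hq
    refine ⟨fun x hx => ?_, fun hx => ?_, fun x hxc hxu hx => ?_⟩
    · rcases hq x hx with ⟨w, -, -, rfl⟩ | ⟨y, z, hyz, -, -, -, -, hx⟩
      · exact Or.inl ⟨w, rfl⟩
      · exact φ.arc_subset_drawing hyz hx
    · rcases hq _ hx with ⟨w, hw, -, h⟩ | ⟨y, z, hyz, hy, -, hz, -, hx⟩
      · exact hw (φ.pos_injective h).symm
      · rcases Sym2.mem_iff.1 (φ.vertex_arc s(y, z) hyz u hx) with rfl | rfl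
        · exact hy rfl
        · exact hz rfl
    · rcases hq x hx with ⟨w, hw, hwc, rfl⟩ | ⟨y, z, hyz, hy, hyc, hz, hzc, hx⟩
      · rcases Sym2.mem_iff.1 (φ.vertex_arc s(u, c) uc w hxc) with rfl | rfl
        · exact hw rfl
        · exact hwc rfl
      · obtain ⟨v, hv, hv', rfl⟩ := φ.arc_arc s(u, c) uc s(y, z) hyz (by
          intro h
          rcases Sym2.eq_iff.1 h with ⟨h, -⟩ | ⟨h, -⟩
          · exact hy h.symm
          · exact hz h.symm) x hxc hx
        rcases Sym2.mem_iff.1 hv with rfl | rfl <;> rcases Sym2.mem_iff.1 hv' with h | h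
        · exact hy h.symm
        · exact hz h.symm
        · exact hyc h.symm
        · exact hzc h.symm
  have nb : ∀ {b r}, φ.pos u ∉ lineSet b r → b ≠ φ.pos u := fun h h' =>
    h (h' ▸ start_mem_lineSet _ _)
  have hout : ∀ v, φ.pos v ∈ closure (outerFace φ.drawing) := fun v =>
    frontier_subset_closure (φ.outer v)
  obtain ⟨A₁₂, B₁₂, C₁₂⟩ := walks (a := a) (b := b) uc g₁₂
  obtain ⟨A₂₃, B₂₃, C₂₃⟩ := walks (a := b) (b := c) ua g₂₃
  obtain ⟨A₃₁, B₃₁, C₃₁⟩ := walks (a := c) (b := a) ub g₃₁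
  have D₁ := φ.arc_subset_drawing ua
  have D₂ := φ.arc_subset_drawing ub
  have D₃ := φ.arc_subset_drawing uc
  have m₁₂ := arms ua ub hab
  have m₂₃ := arms ub uc hbc
  have m₃₁ := arms uc ua hca
  have m₂₁ := arms ub ua hab.symm
  have m₃₂ := arms uc ub hbc.symm
  have m₁₃ := arms ua uc hca.symm
  rw [s₁] at D₁ m₁₂ m₃₁ m₂₁ m₁₃ C₂₃
  rw [s₂] at D₂ m₁₂ m₂₃ m₂₁ m₃₂ C₃₁
  rw [s₃] at D₃ m₂₃ m₃₁ m₁₃ m₃₂ C₁₂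
  rw [← e₁] at f₁₂ B₁₂ C₁₂ A₁₂ f₃₁
  rw [← e₂] at f₂₃ B₂₃ C₂₃ A₂₃ f₁₂
  rw [← e₃] at f₃₁ B₃₁ C₃₁ A₃₁ f₂₃
  refine tripod_false (nb n₁) (nb n₂) (nb n₃) (fun x hx hxu h => m₁₂ x (Or.inl hx) hxu (Or.inl h))
    (fun x hx hxu h => m₂₃ x (Or.inl hx) hxu (Or.inl h))
    (fun x hx hxu h => m₃₁ x (Or.inl hx) hxu (Or.inl h)) n₁ n₂ n₃ B₁₂ B₂₃ B₃₁
    (fun x => arm_angle_eq_zero (nb n₃) f₁₂ n₃ D₁ D₂ A₁₂ (e₃ ▸ hout c) m₃₁ m₃₂ C₁₂)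
    (fun x => arm_angle_eq_zero (nb n₁) f₂₃ n₁ D₂ D₃ A₂₃ (e₁ ▸ hout a) m₁₂ m₁₃ C₂₃)
    (fun x => arm_angle_eq_zero (nb n₂) f₃₁ n₂ D₃ D₁ A₃₁ (e₂ ▸ hout b) m₂₃ m₂₁ C₃₁) ?_
  -- The three walks form a closed curve that misses `u`. Since `u` is itself on the boundary of the
  -- outer face, the curve does not wind around it.
  have hcl : lineEnd (lineEnd b₁ r₁) (q₁₂ ++ (q₂₃ ++ q₃₁)) = lineEnd b₁ r₁ := by
    rw [lineEnd_append, lineEnd_append, f₁₂, f₂₃, f₃₁]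
  have hset : lineSet (lineEnd b₁ r₁) (q₁₂ ++ (q₂₃ ++ q₃₁)) = lineSet (lineEnd b₁ r₁) q₁₂ ∪
      (lineSet (lineEnd b₂ r₂) q₂₃ ∪ lineSet (lineEnd b₃ r₃) q₃₁) := by
    rw [lineSet_append, lineSet_append, f₁₂, f₂₃]
  have := lineAngle_eq_zero_of_mem_closure (D := φ.drawing) hcl
    (by rw [hset]; exact Set.union_subset A₁₂ (Set.union_subset A₂₃ A₃₁)) (hout u)
    (by rw [hset]; simp only [Set.mem_union, not_or]; exact ⟨B₁₂, B₂₃, B₃₁⟩)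
  rw [lineAngle_append, lineAngle_append, f₁₂, f₂₃] at this
  linarith

theorem IsOuterplanar.tripodless {V : Type*} {G : SimpleGraph V} (h : IsOuterplanar G) :
    Tripodless G.Adj := h.some.tripodless

end

/-! ### Graphs without tripods -/

theorem Avoiding.symm {V : Type*} {E : V → V → Prop} (hE : ∀ x y, E x y → E y x) {c d a b : V}
    (h : Avoiding E c d a b) : Avoiding E c d b a :=
  haveI : Std.Symm fun x y => E x y ∧ x ≠ c ∧ x ≠ d ∧ y ≠ c ∧ y ≠ d :=
    ⟨fun _ _ h => ⟨hE _ _ h.1, h.2.2.2.1, h.2.2.2.2, h.2.1, h.2.2.1⟩⟩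
  Relation.ReflTransGen.stdSymm.symm _ _ h

theorem Tripodless.mono {V : Type*} {E F : V → V → Prop} (hE : Tripodless E)
    (h : ∀ x y, F x y → E x y) : Tripodless F := by
  intro u a b c ua ub uc hab hbc hca h1 h2 h3
  exact hE u a b c (h _ _ ua) (h _ _ ub) (h _ _ uc) hab hbc hca
    (Relation.ReflTransGen.mono (fun _ _ k => ⟨h _ _ k.1, k.2⟩) _ _ h1)
    (Relation.ReflTransGen.mono (fun _ _ k => ⟨h _ _ k.1, k.2⟩) _ _ h2)
    (Relation.ReflTransGen.mono (fun _ _ k => ⟨h _ _ k.1, k.2⟩) _ _ h3)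

/-- Adding the edge between the neighbours of a vertex of degree two creates no tripod. -/
theorem Tripodless.add_edge {V : Type*} {E : V → V → Prop} (hE : Tripodless E)
    (hs : ∀ x y, E x y → E y x) {u v w : V} (hwu : E w u) (hwv : E w v) (hu : u ≠ w) (hv : v ≠ w)
    (huv : u ≠ v) (hw : ∀ x, E w x → x = u ∨ x = v) :
    Tripodless fun x y => E x y ∨ (x = u ∧ y = v) ∨ (x = v ∧ y = u) := by
  set H := fun x y => E x y ∨ (x = u ∧ y = v) ∨ (x = v ∧ y = u) with hH
  have hHs : ∀ x y, H x y → H y x := by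
    rintro x y (h | ⟨rfl, rfl⟩ | ⟨rfl, rfl⟩)
    · exact Or.inl (hs _ _ h)
    · exact Or.inr (Or.inr ⟨rfl, rfl⟩)
    · exact Or.inr (Or.inl ⟨rfl, rfl⟩)
  have hwH : ∀ x, H w x → x = u ∨ x = v := by
    rintro x (h | ⟨h, -⟩ | ⟨h, -⟩)
    · exact hw x h
    · exact absurd h.symm hu
    · exact absurd h.symm hv
  -- The new edge is replaced by the detour through `w`. This works if `w` is allowed, and it is not
  -- needed if an end of the new edge is forbidden.
  have conv : ∀ {c d a b : V}, ((w ≠ c ∧ w ≠ d) ∨ u = c ∨ u = d ∨ v = c ∨ v = d) →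
      Avoiding H c d a b → Avoiding E c d a b := by
    intro c d a b hcd h
    unfold Avoiding at h
    induction h with
    | refl => exact Relation.ReflTransGen.refl
    | @tail y z _ hyz ih =>
      obtain ⟨h1, h2⟩ := hyz
      rcases h1 with h1 | ⟨rfl, rfl⟩ | ⟨rfl, rfl⟩
      · exact ih.tail ⟨h1, h2⟩
      · have hw' : w ≠ c ∧ w ≠ d := by tauto
        exact (ih.tail ⟨hs _ _ hwu, h2.1, h2.2.1, hw'.1, hw'.2⟩).tail
          ⟨hwv, hw'.1, hw'.2, h2.2.2.1, h2.2.2.2⟩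
      · have hw' : w ≠ c ∧ w ≠ d := by tauto
        exact (ih.tail ⟨hs _ _ hwv, h2.1, h2.2.1, hw'.1, hw'.2⟩).tail
          ⟨hwu, hw'.1, hw'.2, h2.2.2.1, h2.2.2.2⟩
  -- With both its neighbours forbidden, no walk leaves `w`.
  have stuck : ∀ {u' v' b : V}, (∀ x, H w x → x = u' ∨ x = v') → Avoiding H u' v' w b → w = b := by
    intro u' v' b hw' h
    unfold Avoiding at h
    rcases Relation.ReflTransGen.cases_head h with h | ⟨y, h, -⟩
    · exact h
    · exact ((hw' y h.1).elim h.2.2.2.1 h.2.2.2.2).elim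
  -- If the new edge is itself an arm from `u'` to `v'`, then `w` takes the place of `v'`: the walks
  -- to `v'` are prolonged by the edge to `w`, and the third walk cannot pass through `w`.
  have aux : ∀ {u' v' : V}, (∀ x, H w x → x = u' ∨ x = v') → E w u' → E w v' →
      u' ≠ w → v' ≠ w → u' ≠ v' → (∀ x, H u' x → x = v' ∨ E u' x) →
      (∀ {c d a b : V}, ((w ≠ c ∧ w ≠ d) ∨ u' = c ∨ u' = d ∨ v' = c ∨ v' = d) →
        Avoiding H c d a b → Avoiding E c d a b) →
      ∀ b c, H u' b → H u' c → v' ≠ b → b ≠ c → c ≠ v' → Avoiding H u' c v' b →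
      Avoiding H u' v' b c → Avoiding H u' b c v' → False := by
    intro u' v' hw' hwu hwv hu hv huv hsp conv b c ub uc hab hbc hca h1 h2 h3
    have hbw : w ≠ b := by rintro rfl; exact hbc (stuck hw' h2)
    have hcw : w ≠ c := by rintro rfl; exact hbc (stuck hw' (h2.symm hHs)).symm
    refine hE u' w b c (hs _ _ hwu) ((hsp b ub).resolve_left hab.symm) ((hsp c uc).resolve_left hca)
      hbw hbc hcw.symm ?_ ?_ ?_
    · exact Relation.ReflTransGen.head ⟨hwv, hu.symm, hcw, huv.symm, hca.symm⟩
        (conv (by simp) h1)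
    · have := conv (by simp) h2
      refine Relation.ReflTransGen.mono (fun x y h => ⟨h.1, h.2.1, ?_, h.2.2.2.1, ?_⟩) _ _ this
      · rintro rfl
        exact (hw' y (Or.inl h.1)).elim h.2.2.2.1 h.2.2.2.2
      · rintro rfl
        exact (hw' x (Or.inl (hs _ _ h.1))).elim h.2.1 h.2.2.1
    · exact (conv (by simp) h3).tail ⟨hs _ _ hwv, huv.symm, hab, hu.symm, hbw⟩
  have aux' : ∀ {c a : V}, ((c = u ∧ a = v) ∨ (c = v ∧ a = u)) → ∀ b d, H c b → H c d → a ≠ b →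
      b ≠ d → d ≠ a → Avoiding H c d a b → Avoiding H c a b d → Avoiding H c b d a → False := by
    rintro c a (⟨rfl, rfl⟩ | ⟨rfl, rfl⟩)
    · refine aux hwH hwu hwv hu hv huv ?_ conv
      rintro x (h | ⟨-, h⟩ | ⟨h, -⟩)
      · exact Or.inr h
      · exact Or.inl h
      · exact absurd h huv
    · refine aux (fun x hx => (hwH x hx).symm) hwv hwu hv hu huv.symm ?_
        (fun h => conv (by tauto))
      rintro x (h | ⟨h, -⟩ | ⟨-, h⟩)
      · exact Or.inr h
      · exact absurd h.symm huv
      · exact Or.inl h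
  intro c a₁ a₂ a₃ s₁ s₂ s₃ h12 h23 h31 w12 w23 w31
  rcases s₁ with s₁ | s₁
  swap
  · exact aux' s₁ a₂ a₃ s₂ s₃ h12 h23 h31 w12 w23 w31
  rcases s₂ with s₂ | s₂
  swap
  · exact aux' s₂ a₃ a₁ s₃ (Or.inl s₁) h23 h31 h12 w23 w31 w12
  rcases s₃ with s₃ | s₃
  swap
  · exact aux' s₃ a₁ a₂ (Or.inl s₁) (Or.inl s₂) h31 h12 h23 w31 w12 w23
  -- The centre of a tripod has three distinct neighbours, and `w` has only two.
  have hwc : w ≠ c := by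
    rintro rfl
    rcases hw _ s₁ with rfl | rfl <;> rcases hw _ s₂ with rfl | rfl <;>
      rcases hw _ s₃ with rfl | rfl <;> simp_all
  have key : ∀ a, E c a → ((w ≠ c ∧ w ≠ a) ∨ u = c ∨ u = a ∨ v = c ∨ v = a) := by
    intro a ha
    by_cases h : w = a
    · subst h
      rcases hw _ (hs _ _ ha) with rfl | rfl <;> simp
    · exact Or.inl ⟨hwc, h⟩
  exact hE c a₁ a₂ a₃ s₁ s₂ s₃ h12 h23 h31 (conv (key _ s₃) w12) (conv (key _ s₁) w23)
    (conv (key _ s₂) w31)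

/-- The vertices `v 0, …, v k` form a path of `E` inside `A`. -/
structure IsPathIn (E : ℕ → ℕ → Prop) (A : Finset ℕ) (k : ℕ) (v : ℕ → ℕ) : Prop where
  mem : ∀ i ≤ k, v i ∈ A
  inj : ∀ i ≤ k, ∀ j ≤ k, v i = v j → i = j
  adj : ∀ i < k, E (v i) (v (i + 1))

theorem IsPathIn.lt_card {E : ℕ → ℕ → Prop} {A : Finset ℕ} {k : ℕ} {v : ℕ → ℕ}
    (h : IsPathIn E A k v) : k < A.card := by
  have := Finset.card_le_card_of_injOn (s := Finset.range (k + 1)) (t := A) v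
    (fun i hi => h.mem i (by simp at hi; omega))
    (fun i hi j hj e => h.inj i (by simp at hi; omega) j (by simp at hj; omega) e)
  simpa using this

theorem IsPathIn.avoiding {E K : ℕ → ℕ → Prop} {A : Finset ℕ} {k : ℕ} {v : ℕ → ℕ}
    (h : IsPathIn E A k v) (hEK : ∀ x ∈ A, ∀ y ∈ A, E x y → K x y) {c d i j : ℕ} (hij : i ≤ j)
    (hj : j ≤ k) (hcd : ∀ t, i ≤ t → t ≤ j → v t ≠ c ∧ v t ≠ d) : Avoiding K c d (v i) (v j) := by
  induction j with
  | zero =>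
    obtain rfl : i = 0 := by omega
    exact Relation.ReflTransGen.refl
  | succ j ih =>
    rcases Nat.lt_or_ge j i with hlt | hge
    · obtain rfl : i = j + 1 := by omega
      exact Relation.ReflTransGen.refl
    · exact (ih hge (by omega) fun t h1 h2 => hcd t h1 (by omega)).tail
        ⟨hEK _ (h.mem _ (by omega)) _ (h.mem _ (by omega)) (h.adj j (by omega)),
          (hcd j hge (by omega)).1, (hcd j hge (by omega)).2, (hcd (j + 1) (by omega) le_rfl).1,
          (hcd (j + 1) (by omega) le_rfl).2⟩

theorem IsPathIn.extend {E : ℕ → ℕ → Prop} {A : Finset ℕ} {k : ℕ} {v : ℕ → ℕ} {y : ℕ}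
    (h : IsPathIn E A k v) (hs : ∀ x y, E x y → E y x) (hy : y ∈ A) (hvy : E (v 0) y)
    (hn : ∀ i ≤ k, v i ≠ y) :
    IsPathIn E A (k + 1) fun i => if i = 0 then y else v (i - 1) := by
  refine ⟨fun i hi => ?_, fun i hi j hj e => ?_, fun i hi => ?_⟩
  · split_ifs
    · exact hy
    · exact h.mem _ (by omega)
  · beta_reduce at e
    split_ifs at e with h1 h2 h2
    · omega
    · exact absurd e.symm (hn _ (by omega))
    · exact absurd e (hn _ (by omega))
    · have := h.inj _ (by omega) _ (by omega) e; omega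
  · rcases Nat.eq_zero_or_pos i with rfl | hpos
    · simpa using hs _ _ hvy
    · have := h.adj (i - 1) (by omega)
      simpa [show i ≠ 0 by omega, show i - 1 + 1 = i by omega] using this

/-- Pósa's rotation: the part in front of `v i` is reversed, which gives the path `v (i-1), …, v 0,
v i, …, v k`. It has the same length and starts at `v (i-1)`. -/
theorem IsPathIn.rotate {E : ℕ → ℕ → Prop} {A : Finset ℕ} {k i : ℕ} {v : ℕ → ℕ}
    (h : IsPathIn E A k v) (hs : ∀ x y, E x y → E y x) (hi : 1 ≤ i) (hik : i ≤ k)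
    (hv : E (v 0) (v i)) :
    IsPathIn E A k fun t => if t < i then v (i - 1 - t) else v t := by
  refine ⟨fun t ht => ?_, fun s hs' t ht e => ?_, fun t ht => ?_⟩
  · split_ifs <;> exact h.mem _ (by omega)
  · beta_reduce at e
    split_ifs at e <;> have := h.inj _ (by omega) _ (by omega) e <;> omega
  · split_ifs with h1 h2 h2
    · have := hs _ _ (h.adj (i - 1 - (t + 1)) (by omega))
      rwa [show i - 1 - (t + 1) + 1 = i - 1 - t by omega] at this
    · obtain rfl : i = t + 1 := by omega
      simpa using hv
    · omega
    · exact h.adj t ht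

/-- A vertex that can be removed: of degree at most one, or of degree two and not on a heavy
edge. -/
theorem exists_removable {E K H : ℕ → ℕ → Prop} [DecidableRel E] {A : Finset ℕ} (hA : A.Nonempty)
    (hs : ∀ x y, E x y → E y x) (hirr : ∀ x, ¬ E x x) (hK : Tripodless K)
    (hKs : ∀ x y, K x y → K y x) (hEK : ∀ x ∈ A, ∀ y ∈ A, E x y → K x y)
    (hH : ∀ x ∈ A, ∀ y ∈ A, H x y → ∃ e₀ e₁, e₀ ≠ e₁ ∧ e₀ ∉ A ∧ e₁ ∉ A ∧
      K x e₀ ∧ K y e₀ ∧ K x e₁ ∧ K y e₁) :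
    ∃ w ∈ A, (A.filter (E w)).card ≤ 1 ∨
      ((A.filter (E w)).card = 2 ∧ ∀ y ∈ A, E w y → ¬ H w y) := by
  by_contra! hcon
  obtain ⟨k, ⟨v₀, hv₀⟩, hmax⟩ : ∃ k, (∃ v, IsPathIn E A k v) ∧ ∀ m v, IsPathIn E A m v → m ≤ k := by
    obtain ⟨a, ha⟩ := hA
    have hex : ∃ v, IsPathIn E A 0 v :=
      ⟨fun _ => a, fun _ _ => ha, fun i hi j hj _ => by omega, fun i hi => by omega⟩
    classical
    refine ⟨Nat.findGreatest (fun k => ∃ v, IsPathIn E A k v) A.card,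
      Nat.findGreatest_spec (P := fun k => ∃ v, IsPathIn E A k v) (Nat.zero_le _) hex,
      fun m v hv => Nat.le_findGreatest hv.lt_card.le ⟨v, hv⟩⟩
  -- As the path is longest, a neighbour of its first vertex cannot be put in front of it.
  have onpath : ∀ v, IsPathIn E A k v → ∀ y ∈ A, E (v 0) y → ∃ j, 1 ≤ j ∧ j ≤ k ∧ v j = y := by
    intro v hv y hy hvy
    by_contra! hno
    have := hmax _ _ (hv.extend hs hy hvy fun i hi => by
      rcases Nat.eq_zero_or_pos i with rfl | hpos
      · intro h; rw [← h] at hvy; exact hirr _ hvy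
      · exact hno i hpos hi)
    omega
  -- Otherwise the two vertices `e₀`, `e₁` on the heavy edge together with `z` form a tripod at `v
  -- 0`: they are all joined through `y`, and `z` is reached from `y` along the path.
  have light : ∀ v, IsPathIn E A k v → ∀ y ∈ A, ∀ z ∈ A, E (v 0) y → E (v 0) z → z ≠ y →
      ¬ H (v 0) y := by
    intro v hv y hy z hz vy vz hzy hheavy
    obtain ⟨e₀, e₁, he, h₀, h₁, k1, k2, k3, k4⟩ := hH _ (hv.mem 0 (by omega)) y hy hheavy
    obtain ⟨i, hi1, hik, rfl⟩ := onpath v hv y hy vy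
    obtain ⟨j, hj1, hjk, rfl⟩ := onpath v hv z hz vz
    have hne : ∀ e, e ∉ A → ∀ t ≤ k, v t ≠ e := fun e he t ht h => he (h ▸ hv.mem t ht)
    have h0 : ∀ t, 1 ≤ t → t ≤ k → v t ≠ v 0 := fun t h1 h2 h => by
      have := hv.inj t h2 0 (by omega) h; omega
    have walk : ∀ e, e ∉ A → Avoiding K (v 0) e (v i) (v j) := by
      intro e he
      rcases le_total i j with hij | hij
      · exact hv.avoiding hEK hij hjk fun t h1 h2 => ⟨h0 t (by omega) (by omega),
          hne e he t (by omega)⟩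
      · exact (hv.avoiding hEK hij hik fun t h1 h2 => ⟨h0 t (by omega) (by omega),
          hne e he t (by omega)⟩).symm hKs
    have hv0A := hv.mem 0 (by omega)
    have n₀ : e₀ ≠ v 0 := fun h => h₀ (h ▸ hv0A)
    have n₁ : e₁ ≠ v 0 := fun h => h₁ (h ▸ hv0A)
    refine hK (v 0) e₀ e₁ (v j) k1 k3 (hEK _ hv0A _ hz vz) he (hne _ h₁ _ hjk).symm
      (hne _ h₀ _ hjk) ?_ ?_ ?_
    · exact (Relation.ReflTransGen.single ⟨hKs _ _ k2, n₀, (hne _ h₀ _ hjk).symm, h0 _ hi1 hik,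
        hzy.symm⟩).tail ⟨k4, h0 _ hi1 hik, hzy.symm, n₁, (hne _ h₁ _ hjk).symm⟩
    · exact Relation.ReflTransGen.head ⟨hKs _ _ k4, n₁, he.symm, h0 _ hi1 hik, hne _ h₀ _ hik⟩
        (walk e₀ h₀)
    · exact ((walk e₁ h₁).symm hKs).tail ⟨k2, h0 _ hi1 hik, hne _ h₁ _ hik, n₀, he⟩
  -- No vertex being removable, the first vertex of a longest path has at least two neighbours, so
  -- by `light` none of its edges is heavy, and then it has at least three neighbours.
  have third : ∀ v, IsPathIn E A k v → ∀ a b, ∃ y ∈ A, E (v 0) y ∧ y ≠ a ∧ y ≠ b := by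
    intro v hv a b
    obtain ⟨h1, h2⟩ := hcon (v 0) (hv.mem 0 (by omega))
    have h3 : 2 < (A.filter (E (v 0))).card := by
      by_contra hle
      have h2' := h2 (by omega)
      obtain ⟨y, hy, hvy, hheavy⟩ := h2'
      obtain ⟨z, hz, hzy⟩ := Finset.exists_mem_ne h1 y
      rw [Finset.mem_filter] at hz
      exact light v hv y hy z hz.1 hvy hz.2 hzy hheavy
    obtain ⟨y, hy, hyn⟩ := Finset.exists_mem_notMem_of_card_lt_card
      (lt_of_le_of_lt (Finset.card_le_two (a := a) (b := b)) h3)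
    rw [Finset.mem_filter] at hy
    simp only [Finset.mem_insert, Finset.mem_singleton, not_or] at hyn
    exact ⟨y, hy.1, hy.2, hyn⟩
  have further : ∀ v, IsPathIn E A k v → ∀ i, ∃ j, 2 ≤ j ∧ j ≤ k ∧ j ≠ i ∧ E (v 0) (v j) := by
    intro v hv i
    obtain ⟨y, hy, hvy, h1, hi⟩ := third v hv (v 1) (v i)
    obtain ⟨j, hj1, hjk, rfl⟩ := onpath v hv y hy hvy
    refine ⟨j, ?_, hjk, fun h => hi (h ▸ rfl), hvy⟩
    rcases Nat.lt_or_ge j 2 with h | h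
    · obtain rfl : j = 1 := by omega
      exact absurd rfl h1
    · exact h
  -- The index of a chord from the first vertex is minimised over all longest paths at once, so that
  -- minimality may also be applied to a rotated path.
  have hex : ∃ i, ∃ v, IsPathIn E A k v ∧ 2 ≤ i ∧ i ≤ k ∧ E (v 0) (v i) := by
    obtain ⟨j, h1, h2, -, h3⟩ := further v₀ hv₀ 0
    exact ⟨j, v₀, hv₀, h1, h2, h3⟩
  classical
  obtain ⟨v, hv, hi2, hik, hvi⟩ := Nat.find_spec hex
  have hmin : ∀ j v, IsPathIn E A k v → 2 ≤ j → j ≤ k → E (v 0) (v j) → Nat.find hex ≤ j :=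
    fun j v h1 h2 h3 h4 => Nat.find_min' hex ⟨v, h1, h2, h3, h4⟩
  generalize Nat.find hex = i at *
  obtain ⟨j, hj2, hjk, hji, hvj⟩ := further v hv i
  have hij := hmin j v hv hj2 hjk hvj
  -- By minimality the second chord at `v 0` ends in some `v j` with `j > i`. In the rotated path
  -- the first vertex is `v (i-1)`, and a chord other than the one to position `i` ends behind `i`,
  -- where both paths agree; so `v (i-1)` is adjacent to some `v l` with `l > i`.
  have hrot := hv.rotate hs (by omega) hik hvi
  obtain ⟨l, hl2, hlk, hli, hvl⟩ := further _ hrot i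
  have hil := hmin l _ hrot hl2 hlk hvl
  simp only [show 0 < i by omega, show ¬ l < i by omega, if_true, if_false, Nat.sub_zero] at hvl
  have ne : ∀ s t, s ≤ k → t ≤ k → s ≠ t → v s ≠ v t := fun s t h1 h2 h3 h4 =>
    h3 (hv.inj s h1 t h2 h4)
  have KE : ∀ s t, s ≤ k → t ≤ k → E (v s) (v t) → K (v s) (v t) := fun s t h1 h2 =>
    hEK _ (hv.mem s h1) _ (hv.mem t h2)
  have e1 := hv.adj (i - 1) (by omega)
  rw [show i - 1 + 1 = i by omega] at e1
  -- A tripod at `v i`: from `v 0` along the path to `v (i-1)`; from `v (i-1)` by its chord to `v l`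
  -- and back to `v (i+1)`; from `v (i+1)` along the path to `v j` and by the chord to `v 0`.
  refine hK (v i) (v 0) (v (i - 1)) (v (i + 1)) (KE _ _ hik (by omega) (hs _ _ hvi))
    (KE _ _ hik (by omega) (hs _ _ e1)) (KE _ _ hik (by omega) (hv.adj i (by omega)))
    (ne _ _ (by omega) (by omega) (by omega)) (ne _ _ (by omega) (by omega) (by omega))
    (ne _ _ (by omega) (by omega) (by omega)) ?_ ?_ ?_
  · exact hv.avoiding hEK (by omega) (by omega) fun t h1 h2 =>
      ⟨ne _ _ (by omega) (by omega) (by omega), ne _ _ (by omega) (by omega) (by omega)⟩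
  · refine Relation.ReflTransGen.head ⟨KE _ _ (by omega) (by omega) hvl,
      ne _ _ (by omega) (by omega) (by omega), ne _ _ (by omega) (by omega) (by omega),
      ne _ _ (by omega) (by omega) (by omega), ne _ _ (by omega) (by omega) (by omega)⟩
      (Avoiding.symm hKs (hv.avoiding hEK (by omega) (by omega) fun t h1 h2 =>
        ⟨ne _ _ (by omega) (by omega) (by omega), ne _ _ (by omega) (by omega) (by omega)⟩))
  · exact (hv.avoiding hEK (i := i + 1) (j := j) (by omega) (by omega) fun t h1 h2 =>
      ⟨ne _ _ (by omega) (by omega) (by omega), ne _ _ (by omega) (by omega) (by omega)⟩).tail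
      ⟨KE _ _ (by omega) (by omega) (hs _ _ hvj), ne _ _ (by omega) (by omega) (by omega),
      ne _ _ (by omega) (by omega) (by omega), ne _ _ (by omega) (by omega) (by omega),
      ne _ _ (by omega) (by omega) (by omega)⟩

/-- With no edge declared heavy, `exists_removable` gives a vertex of degree at most two. Deleting
it lowers the degree sum by at most four: its own degree, and one for each neighbour. -/
theorem Tripodless.sum_degree_le {E : ℕ → ℕ → Prop} [DecidableRel E] (hE : Tripodless E)
    (hs : ∀ x y, E x y → E y x) (hirr : ∀ x, ¬ E x x) (A : Finset ℕ) :
    ∑ x ∈ A, (A.filter (E x)).card ≤ 4 * A.card := by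
  induction hc : A.card generalizing A with
  | zero => simp [Finset.card_eq_zero.1 hc]
  | succ m ih =>
    obtain ⟨w, hw, hdeg⟩ := exists_removable (H := fun _ _ => False)
      (Finset.card_pos.1 (by omega : 0 < A.card)) hs hirr hE hs (fun _ _ _ _ h => h) (by simp)
    have hdeg : (A.filter (E w)).card ≤ 2 := by omega
    have h1 := ih (A.erase w) (by rw [Finset.card_erase_of_mem hw]; omega)
    rw [← Finset.add_sum_erase A _ hw]
    have h2 : ∀ x ∈ A.erase w, (A.filter (E x)).card =
        ((A.erase w).filter (E x)).card + if E w x then 1 else 0 := by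
      intro x hx
      rw [Finset.filter_erase, Finset.card_erase_eq_ite]
      simp only [Finset.mem_filter, hw, true_and]
      by_cases h : E w x
      · have h' := hs _ _ h
        have : 0 < (A.filter (E x)).card := Finset.card_pos.2 ⟨w, by simp [hw, h']⟩
        simp only [h, h', if_true]; omega
      · have h' : ¬ E x w := fun k => h (hs _ _ k)
        simp [h, h']
    rw [Finset.sum_congr rfl h2, Finset.sum_add_distrib]
    have h3 : ∑ x ∈ A.erase w, (if E w x then 1 else 0) ≤ (A.filter (E w)).card := by
      rw [← Finset.card_filter]
      exact Finset.card_le_card (Finset.filter_subset_filter _ (Finset.erase_subset _ _))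
    omega

/-! ### Triangles in an affine frame -/

/-- The closed triangle with corners `a`, `b`, `c`. -/
def tri (a b c : ℝ × ℝ) : Set (ℝ × ℝ) := convexHull ℝ {a, b, c}

/-- Twice the signed area of a triangle. -/
def area (a b c : ℝ × ℝ) : ℝ := (b.1 - a.1) * (c.2 - a.2) - (b.2 - a.2) * (c.1 - a.1)

theorem mem_tri {a b c z : ℝ × ℝ} : z ∈ tri a b c ↔ ∃ α β γ : ℝ, 0 ≤ α ∧ 0 ≤ β ∧ 0 ≤ γ ∧
    α + β + γ = 1 ∧ z.1 = α * a.1 + β * b.1 + γ * c.1 ∧ z.2 = α * a.2 + β * b.2 + γ * c.2 := by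
  unfold tri
  rw [convexHull_insert ⟨b, by simp⟩, convexHull_pair, mem_convexJoin]
  constructor
  · rintro ⟨a', rfl, y, ⟨p, q, hp, hq, hpq, rfl⟩, r, s, hr, hs, hrs, rfl⟩
    refine ⟨r, s * p, s * q, hr, by positivity, by positivity, ?_, ?_, ?_⟩
    · rw [add_assoc, ← mul_add, hpq, mul_one, hrs]
    · simp; ring
    · simp; ring
  · rintro ⟨α, β, γ, hα, hβ, hγ, h, h1, h2⟩
    refine ⟨a, rfl, ?_⟩
    rcases eq_or_lt_of_le (add_nonneg hβ hγ) with h0 | h0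
    · have hβ0 : β = 0 := by linarith
      have hγ0 : γ = 0 := by linarith
      subst hβ0 hγ0
      have hα1 : α = 1 := by linarith
      subst hα1
      refine ⟨b, left_mem_segment ℝ b c, ?_⟩
      have : z = a := by ext <;> simp [h1, h2]
      rw [this]; exact left_mem_segment ℝ a b
    · refine ⟨(β / (β + γ)) • b + (γ / (β + γ)) • c, ⟨β / (β + γ), γ / (β + γ), by positivity,
        by positivity, by field_simp, rfl⟩, α, β + γ, hα, h0.le, by linarith, ?_⟩
      ext
      · simp [h1]; field_simp; ring
      · simp [h2]; field_simp; ring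

theorem mem_segment_coord {a b z : ℝ × ℝ} : z ∈ segment ℝ a b ↔ ∃ r : ℝ, 0 ≤ r ∧ r ≤ 1 ∧
    z.1 = (1 - r) * a.1 + r * b.1 ∧ z.2 = (1 - r) * a.2 + r * b.2 := by
  constructor
  · rintro ⟨p, q, hp, hq, hpq, rfl⟩
    obtain rfl : p = 1 - q := by linarith
    exact ⟨q, hq, by linarith, by simp, by simp⟩
  · rintro ⟨r, h0, h1, e1, e2⟩
    exact ⟨1 - r, r, by linarith, h0, by ring, by ext <;> simp [e1, e2]⟩

theorem range_eq_triple (t : Fin 3 → ℝ × ℝ) : Set.range t = {t 0, t 1, t 2} := by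
  ext z
  simp [Fin.exists_fin_succ, eq_comm]

theorem convexHull_range_eq_tri (t : Fin 3 → ℝ × ℝ) :
    convexHull ℝ (Set.range t) = tri (t 0) (t 1) (t 2) := by
  rw [range_eq_triple]; rfl

theorem tri_swap (a b c : ℝ × ℝ) : tri a b c = tri a c b := by
  unfold tri; rw [Set.pair_comm]

theorem affineIndependent_of_area_ne_zero {t : Fin 3 → ℝ × ℝ} (h : area (t 0) (t 1) (t 2) ≠ 0) :
    AffineIndependent ℝ t := by
  rw [affineIndependent_iff_of_fintype]
  intro w hw hsum
  rw [Finset.weightedVSub_eq_linear_combination (hw := hw)] at hsum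
  simp only [Fin.sum_univ_three] at hw hsum
  have e1 := congrArg Prod.fst hsum
  have e2 := congrArg Prod.snd hsum
  simp only [Prod.fst_add, Prod.snd_add, Prod.smul_fst, Prod.smul_snd, smul_eq_mul, Prod.fst_zero,
    Prod.snd_zero] at e1 e2
  unfold area at h
  have w0 : w 0 = - w 1 - w 2 := by linarith
  rw [w0] at e1 e2
  have h1 : w 1 * (((t 1).1 - (t 0).1) * ((t 2).2 - (t 0).2) -
      ((t 1).2 - (t 0).2) * ((t 2).1 - (t 0).1)) = 0 := by
    linear_combination ((t 2).2 - (t 0).2) * e1 - ((t 2).1 - (t 0).1) * e2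
  have h2 : w 2 * (((t 1).1 - (t 0).1) * ((t 2).2 - (t 0).2) -
      ((t 1).2 - (t 0).2) * ((t 2).1 - (t 0).1)) = 0 := by
    linear_combination ((t 1).1 - (t 0).1) * e2 - ((t 1).2 - (t 0).2) * e1
  have h1 := (mul_eq_zero.1 h1).resolve_right h
  have h2 := (mul_eq_zero.1 h2).resolve_right h
  intro i
  fin_cases i <;> simp [w0, h1, h2]

theorem interior_eq_empty_of_subset_segment {S : Set (ℝ × ℝ)} {a b : ℝ × ℝ}
    (h : S ⊆ segment ℝ a b) : interior S = ∅ := by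
  refine Set.eq_empty_of_subset_empty (fun z hz => ?_)
  obtain ⟨ε, hε, hball⟩ := Metric.mem_nhds_iff.1 (mem_interior_iff_mem_nhds.1 hz)
  have hin : ∀ x y : ℝ, |x| < ε → |y| < ε → ((z.1 + x, z.2 + y) : ℝ × ℝ) ∈ segment ℝ a b := by
    intro x y hx hy
    refine h (hball ?_)
    rw [Metric.mem_ball, Prod.dist_eq]
    simp [hx, hy]
  have col : ∀ x y : ℝ, |x| < ε → |y| < ε →
      (z.1 + x - a.1) * (b.2 - a.2) = (z.2 + y - a.2) * (b.1 - a.1) := by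
    intro x y hx hy
    obtain ⟨r, -, -, e1, e2⟩ := mem_segment_coord.1 (hin x y hx hy)
    simp only at e1 e2
    rw [e1, e2]; ring
  have hh : |ε / 2| < ε := by rw [abs_of_pos (by positivity)]; linarith
  have h00 : |(0 : ℝ)| < ε := by simpa using hε
  have c0 := col 0 0 h00 h00
  have c1 := col (ε / 2) 0 hh h00
  have c2 := col 0 (ε / 2) h00 hh
  have d2 : b.2 - a.2 = 0 := by
    have : ε / 2 * (b.2 - a.2) = 0 := by linarith
    exact (mul_eq_zero.1 this).resolve_left (by positivity)
  have d1 : b.1 - a.1 = 0 := by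
    have : ε / 2 * (b.1 - a.1) = 0 := by linarith
    exact (mul_eq_zero.1 this).resolve_left (by positivity)
  obtain ⟨r, -, -, e1, -⟩ := mem_segment_coord.1 (hin 0 0 h00 h00)
  obtain ⟨r', -, -, e1', -⟩ := mem_segment_coord.1 (hin (ε / 2) 0 hh h00)
  simp only at e1 e1'
  have f1 : z.1 + 0 = a.1 := by rw [e1]; linear_combination r * d1
  have f2 : z.1 + ε / 2 = a.1 := by rw [e1']; linear_combination r' * d1
  linarith

/-- The affine coordinates with origin `p` in which `a` is `(16, 0)` and `b` is `(0, 16)`. -/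
noncomputable def frame (p a b z : ℝ × ℝ) : ℝ × ℝ :=
  p + (z.1 / 16) • (a - p) + (z.2 / 16) • (b - p)

theorem frame_fst (p a b z : ℝ × ℝ) :
    (frame p a b z).1 = p.1 + z.1 / 16 * (a.1 - p.1) + z.2 / 16 * (b.1 - p.1) := by
  simp [frame]

theorem frame_snd (p a b z : ℝ × ℝ) :
    (frame p a b z).2 = p.2 + z.1 / 16 * (a.2 - p.2) + z.2 / 16 * (b.2 - p.2) := by
  simp [frame]

theorem frame_zero (p a b : ℝ × ℝ) : frame p a b (0, 0) = p := by simp [frame]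

theorem frame_left (p a b : ℝ × ℝ) : frame p a b (16, 0) = a := by simp [frame]

theorem frame_right (p a b : ℝ × ℝ) : frame p a b (0, 16) = b := by simp [frame]

theorem frame_swap (p a b : ℝ × ℝ) (s t : ℝ) : frame p a b (s, t) = frame p b a (t, s) := by
  simp only [frame]; abel

/-- The frame is affine, and `256 = 16 * 16` accounts for the scale on both axes; the scale `16`
lets the corners of all subdivisions below be integral. -/
theorem area_frame (p a b x y z : ℝ × ℝ) :
    area (frame p a b x) (frame p a b y) (frame p a b z) = area x y z / 256 * area p a b := by
  simp only [area, frame_fst, frame_snd]; ring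

theorem frame_injective {p a b : ℝ × ℝ} (h : area p a b ≠ 0) :
    Function.Injective (frame p a b) := by
  intro x y hxy
  have e1 := congrArg Prod.fst hxy
  have e2 := congrArg Prod.snd hxy
  rw [frame_fst, frame_fst] at e1
  rw [frame_snd, frame_snd] at e2
  unfold area at h
  have h1 : (x.1 - y.1) * ((a.1 - p.1) * (b.2 - p.2) - (a.2 - p.2) * (b.1 - p.1)) = 0 := by
    linear_combination 16 * (b.2 - p.2) * e1 - 16 * (b.1 - p.1) * e2
  have h2 : (x.2 - y.2) * ((a.1 - p.1) * (b.2 - p.2) - (a.2 - p.2) * (b.1 - p.1)) = 0 := by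
    linear_combination 16 * (a.1 - p.1) * e2 - 16 * (a.2 - p.2) * e1
  ext
  · exact sub_eq_zero.1 ((mul_eq_zero.1 h1).resolve_right h)
  · exact sub_eq_zero.1 ((mul_eq_zero.1 h2).resolve_right h)

theorem tri_frame (p a b x y z : ℝ × ℝ) :
    tri (frame p a b x) (frame p a b y) (frame p a b z) = frame p a b '' tri x y z := by
  ext w
  constructor
  · intro h
    obtain ⟨α, β, γ, hα, hβ, hγ, hs, e1, e2⟩ := mem_tri.1 h
    refine ⟨(α * x.1 + β * y.1 + γ * z.1, α * x.2 + β * y.2 + γ * z.2),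
      mem_tri.2 ⟨α, β, γ, hα, hβ, hγ, hs, rfl, rfl⟩, ?_⟩
    have hs' : α = 1 - β - γ := by linarith
    ext
    · rw [e1]; simp only [frame_fst, hs']; ring
    · rw [e2]; simp only [frame_snd, hs']; ring
  · rintro ⟨v, h, rfl⟩
    obtain ⟨α, β, γ, hα, hβ, hγ, hs, e1, e2⟩ := mem_tri.1 h
    refine mem_tri.2 ⟨α, β, γ, hα, hβ, hγ, hs, ?_, ?_⟩
    · have hs' : α = 1 - β - γ := by linarith
      simp only [frame_fst, hs', e1, e2]; ring
    · have hs' : α = 1 - β - γ := by linarith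
      simp only [frame_snd, hs', e1, e2]; ring

theorem segment_frame (p a b x y : ℝ × ℝ) :
    segment ℝ (frame p a b x) (frame p a b y) = frame p a b '' segment ℝ x y := by
  ext w
  constructor
  · intro h
    obtain ⟨r, h0, h1, e1, e2⟩ := mem_segment_coord.1 h
    refine ⟨((1 - r) * x.1 + r * y.1, (1 - r) * x.2 + r * y.2),
      mem_segment_coord.2 ⟨r, h0, h1, rfl, rfl⟩, ?_⟩
    ext
    · rw [e1]; simp only [frame_fst]; ring
    · rw [e2]; simp only [frame_snd]; ring
  · rintro ⟨v, h, rfl⟩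
    obtain ⟨r, h0, h1, e1, e2⟩ := mem_segment_coord.1 h
    refine mem_segment_coord.2 ⟨r, h0, h1, ?_, ?_⟩
    · simp only [frame_fst, e1, e2]; ring
    · simp only [frame_snd, e1, e2]; ring
section

/-! ### Subdivisions of the standard triangle -/

theorem subsingleton_of_coords {S : Set (ℝ × ℝ)} (c d : ℝ) (h : ∀ z ∈ S, z.1 = c ∧ z.2 = d) :
    S.Subsingleton := fun x hx y hy => by
  ext
  · rw [(h x hx).1, (h y hy).1]
  · rw [(h x hx).2, (h y hy).2]

theorem tri_subset_tri {a b c a' b' c' : ℝ × ℝ} (ha : a' ∈ tri a b c) (hb : b' ∈ tri a b c)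
    (hc : c' ∈ tri a b c) : tri a' b' c' ⊆ tri a b c :=
  convexHull_min (by rintro x (rfl | rfl | rfl) <;> assumption) (convex_convexHull ℝ _)

theorem mem_standard {s t : ℝ} (hs : 0 ≤ s) (ht : 0 ≤ t) (hst : s + t ≤ 16) :
    (s, t) ∈ tri (0, 0) (16, 0) (0, 16) :=
  mem_tri.2 ⟨1 - s / 16 - t / 16, s / 16, t / 16, by linarith, by linarith, by linarith, by ring,
    by simp, by simp⟩

theorem segment_subset_segment {a b c d : ℝ × ℝ} (ha : a ∈ segment ℝ c d) (hb : b ∈ segment ℝ c d) :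
    segment ℝ a b ⊆ segment ℝ c d := (convex_segment c d).segment_subset ha hb

/-- Unfold the membership of the point `z` in triangles and segments to linear arithmetic. -/
theorem tri_inter_tri_eq {a b c a' b' c' z : ℝ × ℝ} (hz : z ∈ tri a b c ∩ tri a' b' c') :
    ∃ α β γ α' β' γ' : ℝ, 0 ≤ α ∧ 0 ≤ β ∧ 0 ≤ γ ∧ 0 ≤ α' ∧ 0 ≤ β' ∧ 0 ≤ γ' ∧
    α + β + γ = 1 ∧ α' + β' + γ' = 1 ∧ z.1 = α * a.1 + β * b.1 + γ * c.1 ∧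
    z.2 = α * a.2 + β * b.2 + γ * c.2 ∧ z.1 = α' * a'.1 + β' * b'.1 + γ' * c'.1 ∧
    z.2 = α' * a'.2 + β' * b'.2 + γ' * c'.2 := by
  obtain ⟨α, β, γ, h1, h2, h3, h4, h5, h6⟩ := mem_tri.1 hz.1
  obtain ⟨α', β', γ', h1', h2', h3', h4', h5', h6'⟩ := mem_tri.1 hz.2
  exact ⟨α, β, γ, α', β', γ', h1, h2, h3, h1', h2', h3', h4, h4', h5, h6, h5', h6'⟩

theorem segment_inter_tri_eq {a b a' b' c' z : ℝ × ℝ} (hz : z ∈ segment ℝ a b ∩ tri a' b' c') :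
    ∃ r α' β' γ' : ℝ, 0 ≤ r ∧ r ≤ 1 ∧ 0 ≤ α' ∧ 0 ≤ β' ∧ 0 ≤ γ' ∧
    α' + β' + γ' = 1 ∧ z.1 = (1 - r) * a.1 + r * b.1 ∧
    z.2 = (1 - r) * a.2 + r * b.2 ∧ z.1 = α' * a'.1 + β' * b'.1 + γ' * c'.1 ∧
    z.2 = α' * a'.2 + β' * b'.2 + γ' * c'.2 := by
  obtain ⟨r, h1, h2, h3, h4⟩ := mem_segment_coord.1 hz.1
  obtain ⟨α', β', γ', h1', h2', h3', h4', h5', h6'⟩ := mem_tri.1 hz.2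
  exact ⟨r, α', β', γ', h1, h2, h1', h2', h3', h4', h3, h4, h5', h6'⟩

/-! ### Ears and pendant triangles inside the standard triangle -/

section Ear

variable {l m : ℝ}

/-- The ear: its triangle meets the region along the left side. -/
theorem ear_meets_side (hl : l = 0 ∨ l = 1) (hm : m = 0 ∨ m = 1) :
    tri (0, 0) (6 + 2 * l, 2 - 2 * l) (2 - 2 * m, 6 + 2 * m) ∩
      tri (8 * l, 0) (12, 0) (6, 2) ⊆ segment ℝ (8 * l, 0) (6, 2) := by
  intro z hz
  obtain ⟨α, β, γ, α', β', γ', h1, h2, h3, h4, h5, h6, h7, h8, h9, h10, h11, h12⟩ :=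
    tri_inter_tri_eq hz
  simp only at h9 h10 h11 h12
  refine mem_segment_coord.2 ⟨z.2 / 2, ?_, ?_, ?_, ?_⟩ <;>
    rcases hl with rfl | rfl <;> rcases hm with rfl | rfl <;> (try simp only) <;> linarith

/-- The owners lie along the two axes. The ear has its corner at the origin and its far side on the
line `x + y = 8`. For `l = 1` its second corner is `(8, 0)`, so that it has a side on the first
axis; for `l = 0` it is `(6, 2)`, and only the origin is shared; likewise for `m` and the second
axis. The middle region sits on the far side and belongs to the ear alone. -/
theorem ear_meets_middle (hl : l = 0 ∨ l = 1) (hm : m = 0 ∨ m = 1) :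
    tri (0, 0) (6 + 2 * l, 2 - 2 * l) (2 - 2 * m, 6 + 2 * m) ∩
      tri (5, 3) (3, 5) (6, 6) ⊆ segment ℝ (5, 3) (3, 5) := by
  intro z hz
  obtain ⟨α, β, γ, α', β', γ', h1, h2, h3, h4, h5, h6, h7, h8, h9, h10, h11, h12⟩ :=
    tri_inter_tri_eq hz
  simp only at h9 h10 h11 h12
  refine mem_segment_coord.2 ⟨(z.2 - 3) / 2, ?_, ?_, ?_, ?_⟩ <;>
    rcases hl with rfl | rfl <;> rcases hm with rfl | rfl <;> (try simp only) <;> linarith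

theorem ear_base_side (hl : l = 0 ∨ l = 1) :
    segment ℝ (0, 0) (16, 0) ∩ tri (8 * l, 0) (12, 0) (6, 2) ⊆ segment ℝ (8 * l, 0) (12, 0) := by
  intro z hz
  obtain ⟨r, α', β', γ', h1, h2, h4, h5, h6, h8, h9, h10, h11, h12⟩ := segment_inter_tri_eq hz
  simp only at h9 h10 h11 h12
  refine mem_segment_coord.2 ⟨(z.1 - 8 * l) / (12 - 8 * l), ?_, ?_, ?_, ?_⟩ <;>
    rcases hl with rfl | rfl <;> norm_num <;> linarith

theorem ear_base_opposite (hl : l = 0 ∨ l = 1) :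
    (segment ℝ (0, 0) (0, 16) ∩ tri (8 * l, 0) (12, 0) (6, 2)).Subsingleton := by
  refine subsingleton_of_coords 0 0 fun z hz => ?_
  obtain ⟨r, α', β', γ', h1, h2, h4, h5, h6, h8, h9, h10, h11, h12⟩ := segment_inter_tri_eq hz
  simp only at h9 h10 h11 h12
  rcases hl with rfl | rfl <;> constructor <;> linarith

theorem ear_base_middle :
    (segment ℝ (0, 0) (16, 0) ∩ tri (5, 3) (3, 5) (6, 6)).Subsingleton := by
  refine subsingleton_of_coords 0 0 fun z hz => ?_
  obtain ⟨r, α', β', γ', h1, h2, h4, h5, h6, h8, h9, h10, h11, h12⟩ := segment_inter_tri_eq hz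
  simp only at h9 h10 h11 h12
  constructor <;> linarith

theorem ear_base_free (hm : m = 0 ∨ m = 1) :
    (segment ℝ (0, 0) (16, 0) ∩ tri (0, 0) (6, 2) (2 - 2 * m, 6 + 2 * m)).Subsingleton := by
  refine subsingleton_of_coords 0 0 fun z hz => ?_
  obtain ⟨r, α', β', γ', h1, h2, h4, h5, h6, h8, h9, h10, h11, h12⟩ := segment_inter_tri_eq hz
  simp only at h9 h10 h11 h12
  rcases hm with rfl | rfl <;> constructor <;> linarith

theorem ear_sides (hl : l = 0 ∨ l = 1) (hm : m = 0 ∨ m = 1) :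
    (tri (8 * l, 0) (12, 0) (6, 2) ∩ tri (0, 8 * m) (0, 12) (2, 6)).Subsingleton := by
  refine subsingleton_of_coords 0 0 fun z hz => ?_
  obtain ⟨α, β, γ, α', β', γ', h1, h2, h3, h4, h5, h6, h7, h8, h9, h10, h11, h12⟩ :=
    tri_inter_tri_eq hz
  simp only at h9 h10 h11 h12
  rcases hl with rfl | rfl <;> rcases hm with rfl | rfl <;> constructor <;> linarith

theorem ear_side_middle (hl : l = 0 ∨ l = 1) :
    (tri (8 * l, 0) (12, 0) (6, 2) ∩ tri (5, 3) (3, 5) (6, 6)).Subsingleton := by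
  refine subsingleton_of_coords 0 0 fun z hz => ?_
  obtain ⟨α, β, γ, α', β', γ', h1, h2, h3, h4, h5, h6, h7, h8, h9, h10, h11, h12⟩ :=
    tri_inter_tri_eq hz
  simp only at h9 h10 h11 h12
  rcases hl with rfl | rfl <;> constructor <;> linarith

/-- Here the only owner lies along the first axis. The triangle stands on `(4, 0)`, with the side up
to `(8, 0)` on the axis if `l = 1`. One region on each side of its foot serves an ear on the new
edge, the middle region belongs to the new triangle alone, and the last one, at the end of the arm,
replaces the region that is used up. -/
theorem pendant_meets_first (hl : l = 0 ∨ l = 1) :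
    tri (4, 0) (6 + 2 * l, 2 - 2 * l) (4, 4) ∩ tri (4, 0) (2, 0) (4, 2) ⊆
      segment ℝ (4, 0) (4, 2) := by
  intro z hz
  obtain ⟨α, β, γ, α', β', γ', h1, h2, h3, h4, h5, h6, h7, h8, h9, h10, h11, h12⟩ :=
    tri_inter_tri_eq hz
  simp only at h9 h10 h11 h12
  refine mem_segment_coord.2 ⟨z.2 / 2, ?_, ?_, ?_, ?_⟩ <;>
    rcases hl with rfl | rfl <;> (try simp only) <;> linarith

theorem pendant_meets_second (hl : l = 0 ∨ l = 1) :
    tri (4, 0) (6 + 2 * l, 2 - 2 * l) (4, 4) ∩ tri (4 + 4 * l, 0) (10, 0) (6, 2) ⊆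
      segment ℝ (4 + 4 * l, 0) (6, 2) := by
  intro z hz
  obtain ⟨α, β, γ, α', β', γ', h1, h2, h3, h4, h5, h6, h7, h8, h9, h10, h11, h12⟩ :=
    tri_inter_tri_eq hz
  simp only at h9 h10 h11 h12
  refine mem_segment_coord.2 ⟨z.2 / 2, ?_, ?_, ?_, ?_⟩ <;>
    rcases hl with rfl | rfl <;> (try simp only) <;> linarith

theorem pendant_meets_middle (hl : l = 0 ∨ l = 1) :
    tri (4, 0) (6 + 2 * l, 2 - 2 * l) (4, 4) ∩ tri (5, 3) (4, 4) (6, 4) ⊆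
      segment ℝ (5, 3) (4, 4) := by
  intro z hz
  obtain ⟨α, β, γ, α', β', γ', h1, h2, h3, h4, h5, h6, h7, h8, h9, h10, h11, h12⟩ :=
    tri_inter_tri_eq hz
  simp only at h9 h10 h11 h12
  refine mem_segment_coord.2 ⟨z.2 - 3, ?_, ?_, ?_, ?_⟩ <;>
    rcases hl with rfl | rfl <;> (try simp only) <;> linarith

theorem pendant_meets_last (hl : l = 0 ∨ l = 1) :
    (tri (4, 0) (6 + 2 * l, 2 - 2 * l) (4, 4) ∩ tri (12, 0) (16, 0) (12, 2)).Subsingleton := by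
  refine subsingleton_of_coords 0 0 fun z hz => ?_
  obtain ⟨α, β, γ, α', β', γ', h1, h2, h3, h4, h5, h6, h7, h8, h9, h10, h11, h12⟩ :=
    tri_inter_tri_eq hz
  simp only at h9 h10 h11 h12
  rcases hl with rfl | rfl <;> constructor <;> linarith

theorem pendant_base_free :
    (segment ℝ (0, 0) (16, 0) ∩ tri (4, 0) (6, 2) (4, 4)).Subsingleton := by
  refine subsingleton_of_coords 4 0 fun z hz => ?_
  obtain ⟨r, α', β', γ', h1, h2, h4, h5, h6, h8, h9, h10, h11, h12⟩ := segment_inter_tri_eq hz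
  simp only at h9 h10 h11 h12
  constructor <;> linarith

theorem pendant_base_first :
    segment ℝ (0, 0) (16, 0) ∩ tri (4, 0) (2, 0) (4, 2) ⊆ segment ℝ (4, 0) (2, 0) := by
  intro z hz
  obtain ⟨r, α', β', γ', h1, h2, h4, h5, h6, h8, h9, h10, h11, h12⟩ := segment_inter_tri_eq hz
  simp only at h9 h10 h11 h12
  refine mem_segment_coord.2 ⟨(4 - z.1) / 2, ?_, ?_, ?_, ?_⟩ <;> (try simp only) <;> linarith

theorem pendant_base_second (hl : l = 0 ∨ l = 1) :
    segment ℝ (0, 0) (16, 0) ∩ tri (4 + 4 * l, 0) (10, 0) (6, 2) ⊆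
      segment ℝ (4 + 4 * l, 0) (10, 0) := by
  intro z hz
  obtain ⟨r, α', β', γ', h1, h2, h4, h5, h6, h8, h9, h10, h11, h12⟩ := segment_inter_tri_eq hz
  simp only at h9 h10 h11 h12
  refine mem_segment_coord.2 ⟨(z.1 - (4 + 4 * l)) / (6 - 4 * l), ?_, ?_, ?_, ?_⟩ <;>
    rcases hl with rfl | rfl <;> norm_num <;> linarith

theorem pendant_base_middle :
    (segment ℝ (0, 0) (16, 0) ∩ tri (5, 3) (4, 4) (6, 4)).Subsingleton := by
  refine subsingleton_of_coords 0 0 fun z hz => ?_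
  obtain ⟨r, α', β', γ', h1, h2, h4, h5, h6, h8, h9, h10, h11, h12⟩ := segment_inter_tri_eq hz
  simp only at h9 h10 h11 h12
  constructor <;> linarith

theorem pendant_base_last :
    segment ℝ (0, 0) (16, 0) ∩ tri (12, 0) (16, 0) (12, 2) ⊆ segment ℝ (12, 0) (16, 0) := by
  intro z hz
  obtain ⟨r, α', β', γ', h1, h2, h4, h5, h6, h8, h9, h10, h11, h12⟩ := segment_inter_tri_eq hz
  simp only at h9 h10 h11 h12
  refine mem_segment_coord.2 ⟨(z.1 - 12) / 4, ?_, ?_, ?_, ?_⟩ <;> (try simp only) <;> linarith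

theorem pendant_first_second (hl : l = 0 ∨ l = 1) :
    (tri (4, 0) (2, 0) (4, 2) ∩ tri (4 + 4 * l, 0) (10, 0) (6, 2)).Subsingleton := by
  refine subsingleton_of_coords 4 0 fun z hz => ?_
  obtain ⟨α, β, γ, α', β', γ', h1, h2, h3, h4, h5, h6, h7, h8, h9, h10, h11, h12⟩ :=
    tri_inter_tri_eq hz
  simp only at h9 h10 h11 h12
  rcases hl with rfl | rfl <;> constructor <;> linarith

theorem pendant_first_middle :
    (tri (4, 0) (2, 0) (4, 2) ∩ tri (5, 3) (4, 4) (6, 4)).Subsingleton := by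
  refine subsingleton_of_coords 4 0 fun z hz => ?_
  obtain ⟨α, β, γ, α', β', γ', h1, h2, h3, h4, h5, h6, h7, h8, h9, h10, h11, h12⟩ :=
    tri_inter_tri_eq hz
  simp only at h9 h10 h11 h12
  constructor <;> linarith

theorem pendant_first_last :
    (tri (4, 0) (2, 0) (4, 2) ∩ tri (12, 0) (16, 0) (12, 2)).Subsingleton := by
  refine subsingleton_of_coords 4 0 fun z hz => ?_
  obtain ⟨α, β, γ, α', β', γ', h1, h2, h3, h4, h5, h6, h7, h8, h9, h10, h11, h12⟩ :=
    tri_inter_tri_eq hz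
  simp only at h9 h10 h11 h12
  constructor <;> linarith

theorem pendant_second_middle (hl : l = 0 ∨ l = 1) :
    (tri (4 + 4 * l, 0) (10, 0) (6, 2) ∩ tri (5, 3) (4, 4) (6, 4)).Subsingleton := by
  refine subsingleton_of_coords 4 0 fun z hz => ?_
  obtain ⟨α, β, γ, α', β', γ', h1, h2, h3, h4, h5, h6, h7, h8, h9, h10, h11, h12⟩ :=
    tri_inter_tri_eq hz
  simp only at h9 h10 h11 h12
  rcases hl with rfl | rfl <;> constructor <;> linarith

theorem pendant_second_last (hl : l = 0 ∨ l = 1) :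
    (tri (4 + 4 * l, 0) (10, 0) (6, 2) ∩ tri (12, 0) (16, 0) (12, 2)).Subsingleton := by
  refine subsingleton_of_coords 4 0 fun z hz => ?_
  obtain ⟨α, β, γ, α', β', γ', h1, h2, h3, h4, h5, h6, h7, h8, h9, h10, h11, h12⟩ :=
    tri_inter_tri_eq hz
  simp only at h9 h10 h11 h12
  rcases hl with rfl | rfl <;> constructor <;> linarith

theorem pendant_middle_last :
    (tri (5, 3) (4, 4) (6, 4) ∩ tri (12, 0) (16, 0) (12, 2)).Subsingleton := by
  refine subsingleton_of_coords 4 0 fun z hz => ?_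
  obtain ⟨α, β, γ, α', β', γ', h1, h2, h3, h4, h5, h6, h7, h8, h9, h10, h11, h12⟩ :=
    tri_inter_tri_eq hz
  simp only at h9 h10 h11 h12
  constructor <;> linarith

end Ear

end

section

/-! ### Layouts: triangles together with empty regions for further triangles -/

/-- The closed triangle with the given corners. -/
def body (t : Fin 3 → ℝ × ℝ) : Set (ℝ × ℝ) := tri (t 0) (t 1) (t 2)

/-- The third corner of a region: the end of the arm on the second owner, or a free corner if there
is only one owner. -/
def thirdCorner (AR : ℕ → ℕ → ℕ → ℝ × ℝ) (u v k : ℕ) : ℝ × ℝ := AR v u (if u = v then 1 else k)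

/-- The region with the key `(u, v, k)`: its apex is `AP u v k`, and its arms on the triangles of
`u` and `v` end in `AR u v k` and `AR v u k`. -/
def region (AP AR : ℕ → ℕ → ℕ → ℝ × ℝ) (u v k : ℕ) : Set (ℝ × ℝ) :=
  tri (AP u v k) (AR u v k) (thirdCorner AR u v k)

/-- Two keys of the same region. -/
def SameKey (u v k u' v' k' : ℕ) : Prop := k = k' ∧ ((u = u' ∧ v = v') ∨ (u = v' ∧ v = u'))

theorem SameKey.swap {u v k u' v' k' : ℕ} (h : SameKey u v k u' v' k') :
    SameKey v u k u' v' k' := by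
  unfold SameKey at *; tauto

/-- Triangles `T x` for the vertices `x` in `A` that represent the relation `R` on `A`, and pairwise
disjoint regions, with the keys in `K`, that are empty and meet no triangles but those of their
owners in more than a point. -/
structure Layout (R : ℕ → ℕ → Prop) (A : ℕ → Prop) (K : ℕ → ℕ → ℕ → Prop)
    (T : ℕ → Fin 3 → ℝ × ℝ) (AP AR : ℕ → ℕ → ℕ → ℝ × ℝ) : Prop where
  area_ne : ∀ x, A x → area (T x 0) (T x 1) (T x 2) ≠ 0
  touch : ∀ x y, A x → A y → x ≠ y → R x y → TouchNontrivially (T x) (T y)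
  thin : ∀ x y, A x → A y → x ≠ y → ∃ a b, body (T x) ∩ body (T y) ⊆ segment ℝ a b
  apart : ∀ x y, A x → A y → x ≠ y → ¬ R x y → (body (T x) ∩ body (T y)).Subsingleton
  key_symm : ∀ u v k, K u v k → K v u k
  key_mem : ∀ u v k, K u v k → A u
  apex_symm : ∀ u v k, K u v k → AP u v k = AP v u k
  region_area : ∀ u v k, K u v k → area (AP u v k) (AR u v k) (thirdCorner AR u v k) ≠ 0
  owner : ∀ u v k, K u v k →
    body (T u) ∩ region AP AR u v k ⊆ segment ℝ (AP u v k) (AR u v k)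
  side : ∀ u v k, K u v k → ∃ i, segment ℝ (AP u v k) (AR u v k) ⊆ triangleSide (T u) i
  foreign : ∀ u v k x, K u v k → A x → x ≠ u → x ≠ v →
    (body (T x) ∩ region AP AR u v k).Subsingleton
  disj : ∀ u v k u' v' k', K u v k → K u' v' k' → ¬ SameKey u v k u' v' k' →
    (region AP AR u v k ∩ region AP AR u' v' k').Subsingleton

theorem TouchNontrivially.symm {t t' : Fin 3 → ℝ × ℝ} (h : TouchNontrivially t t') :
    TouchNontrivially t' t := by
  obtain ⟨i, j, h⟩ := h
  exact ⟨j, i, by rwa [Set.inter_comm]⟩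

variable {R : ℕ → ℕ → Prop} {A : ℕ → Prop} {K K' : ℕ → ℕ → ℕ → Prop}
  {T T' : ℕ → Fin 3 → ℝ × ℝ} {AP AR AP' AR' : ℕ → ℕ → ℕ → ℝ × ℝ}

theorem Layout.region_symm (L : Layout R A K T AP AR) {u v k : ℕ} (h : K u v k) :
    region AP AR u v k = region AP AR v u k := by
  unfold region thirdCorner
  by_cases huv : u = v
  · subst huv; rfl
  · rw [if_neg huv, if_neg (Ne.symm huv), L.apex_symm u v k h, tri_swap]

theorem Layout.mono (L : Layout R A K T AP AR) (h : ∀ u v k, K' u v k → K u v k)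
    (hs : ∀ u v k, K' u v k → K' v u k) : Layout R A K' T AP AR where
  area_ne := L.area_ne
  touch := L.touch
  thin := L.thin
  apart := L.apart
  key_symm := hs
  key_mem u v k hk := L.key_mem u v k (h u v k hk)
  apex_symm u v k hk := L.apex_symm u v k (h u v k hk)
  region_area u v k hk := L.region_area u v k (h u v k hk)
  owner u v k hk := L.owner u v k (h u v k hk)
  side u v k hk := L.side u v k (h u v k hk)
  foreign u v k x hk := L.foreign u v k x (h u v k hk)
  disj u v k u' v' k' hk hk' := L.disj u v k u' v' k' (h u v k hk) (h u' v' k' hk')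

/-- A new triangle and new regions inside a region. -/
theorem Layout.insert (L : Layout R A K T AP AR) (hR : ∀ x y, R x y → R y x)
    {u v k w : ℕ} (hk : K u v k) (hw : ¬ A w) {N : ℕ → ℕ → ℕ → Prop}
    (hT : ∀ x, A x → T' x = T x) (harea : area (T' w 0) (T' w 1) (T' w 2) ≠ 0)
    (hsub : body (T' w) ⊆ region AP AR u v k)
    (htouch : ∀ x, x = u ∨ x = v → R x w → TouchNontrivially (T x) (T' w))
    (hapart : ∀ x, x = u ∨ x = v → ¬ R x w → (body (T x) ∩ body (T' w)).Subsingleton)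
    (hRw : ∀ x, A x → x ≠ u → x ≠ v → ¬ R x w)
    (hold : ∀ a b c, K a b c → ¬ SameKey a b c u v k → AP' a b c = AP a b c ∧
      AR' a b c = AR a b c ∧ thirdCorner AR' a b c = thirdCorner AR a b c)
    (hN : ∀ a b c, N a b c → N b a c) (hNA : ∀ a b c, N a b c → A a ∨ a = w)
    (Napex : ∀ a b c, N a b c → AP' a b c = AP' b a c)
    (Nsub : ∀ a b c, N a b c → region AP' AR' a b c ⊆ region AP AR u v k)
    (Narea : ∀ a b c, N a b c → area (AP' a b c) (AR' a b c) (thirdCorner AR' a b c) ≠ 0)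
    (Nowner : ∀ a b c, N a b c →
      body (T' a) ∩ region AP' AR' a b c ⊆ segment ℝ (AP' a b c) (AR' a b c))
    (Nside : ∀ a b c, N a b c →
      ∃ i, segment ℝ (AP' a b c) (AR' a b c) ⊆ triangleSide (T' a) i)
    (Nforeign : ∀ a b c x, N a b c → x = u ∨ x = v ∨ x = w → x ≠ a → x ≠ b →
      (body (T' x) ∩ region AP' AR' a b c).Subsingleton)
    (Ndisj : ∀ a b c a' b' c', N a b c → N a' b' c' → ¬ SameKey a b c a' b' c' →
      (region AP' AR' a b c ∩ region AP' AR' a' b' c').Subsingleton) :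
    Layout R (fun x => A x ∨ x = w)
      (fun a b c => (K a b c ∧ ¬ SameKey a b c u v k) ∨ N a b c) T' AP' AR' := by
  have huA := L.key_mem _ _ _ hk
  have hk' := L.key_symm _ _ _ hk
  have hvA := L.key_mem _ _ _ hk'
  have hreg : ∀ a b c, K a b c → ¬ SameKey a b c u v k →
      region AP' AR' a b c = region AP AR a b c := by
    intro a b c h1 h2
    obtain ⟨e1, e2, e3⟩ := hold a b c h1 h2
    unfold region
    rw [e1, e2, e3]
  have hwx : ∀ x, A x → x ≠ w := fun x hx h => hw (h ▸ hx)
  -- An owner can meet the new triangle only in its arm of the region, which is a segment; any other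
  -- triangle meets the whole region in at most a point, by `foreign`.
  have pairs : ∀ x, A x → (R x w → TouchNontrivially (T' x) (T' w)) ∧
      (∃ a b, body (T' x) ∩ body (T' w) ⊆ segment ℝ a b) ∧
      (¬ R x w → (body (T' x) ∩ body (T' w)).Subsingleton) := by
    intro x hx
    rw [hT x hx]
    by_cases hxu : x = u
    · subst hxu
      exact ⟨htouch x (Or.inl rfl), ⟨_, _, (Set.inter_subset_inter_right _ hsub).trans
        (L.owner _ _ _ hk)⟩, hapart x (Or.inl rfl)⟩
    by_cases hxv : x = v
    · subst hxv
      refine ⟨htouch x (Or.inr rfl),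
        ⟨AP x u k, AR x u k, (Set.inter_subset_inter_right _ hsub).trans ?_⟩,
        hapart x (Or.inr rfl)⟩
      rw [L.region_symm hk]
      exact L.owner _ _ _ hk'
    · have hs : (body (T x) ∩ body (T' w)).Subsingleton :=
        (L.foreign _ _ _ x hk hx hxu hxv).anti (Set.inter_subset_inter_right _ hsub)
      refine ⟨fun h => absurd h (hRw x hx hxu hxv), ?_, fun _ => hs⟩
      rcases hs.eq_empty_or_singleton with h | ⟨z, h⟩
      · exact ⟨0, 0, by rw [h]; exact Set.empty_subset _⟩
      · exact ⟨z, z, by rw [h, segment_same]⟩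
  constructor
  · rintro x (hx | rfl)
    · rw [hT x hx]; exact L.area_ne x hx
    · exact harea
  · rintro x y (hx | rfl) (hy | rfl) hxy hRxy
    · rw [hT x hx, hT y hy]; exact L.touch x y hx hy hxy hRxy
    · exact (pairs x hx).1 hRxy
    · exact ((pairs y hy).1 (hR _ _ hRxy)).symm
    · exact absurd rfl hxy
  · rintro x y (hx | rfl) (hy | rfl) hxy
    · rw [hT x hx, hT y hy]; exact L.thin x y hx hy hxy
    · exact (pairs x hx).2.1
    · rw [Set.inter_comm]; exact (pairs y hy).2.1
    · exact absurd rfl hxy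
  · rintro x y (hx | rfl) (hy | rfl) hxy hRxy
    · rw [hT x hx, hT y hy]; exact L.apart x y hx hy hxy hRxy
    · exact (pairs x hx).2.2 hRxy
    · rw [Set.inter_comm]; exact (pairs y hy).2.2 fun h => hRxy (hR _ _ h)
    · exact absurd rfl hxy
  · rintro a b c (⟨h1, h2⟩ | h)
    · exact Or.inl ⟨L.key_symm _ _ _ h1, fun h => h2 h.swap⟩
    · exact Or.inr (hN _ _ _ h)
  · rintro a b c (⟨h1, -⟩ | h)
    · exact Or.inl (L.key_mem _ _ _ h1)
    · exact hNA _ _ _ h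
  · rintro a b c (⟨h1, h2⟩ | h)
    · rw [(hold _ _ _ h1 h2).1, (hold _ _ _ (L.key_symm _ _ _ h1)
        (fun h => h2 h.swap)).1]
      exact L.apex_symm _ _ _ h1
    · exact Napex _ _ _ h
  · rintro a b c (⟨h1, h2⟩ | h)
    · obtain ⟨e1, e2, e3⟩ := hold _ _ _ h1 h2
      rw [e1, e2, e3]; exact L.region_area _ _ _ h1
    · exact Narea _ _ _ h
  · rintro a b c (⟨h1, h2⟩ | h)
    · obtain ⟨e1, e2, -⟩ := hold _ _ _ h1 h2
      rw [hreg _ _ _ h1 h2, e1, e2, hT a (L.key_mem _ _ _ h1)]; exact L.owner _ _ _ h1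
    · exact Nowner _ _ _ h
  · rintro a b c (⟨h1, h2⟩ | h)
    · obtain ⟨e1, e2, -⟩ := hold _ _ _ h1 h2
      rw [e1, e2, hT a (L.key_mem _ _ _ h1)]; exact L.side _ _ _ h1
    · exact Nside _ _ _ h
  · rintro a b c x (⟨h1, h2⟩ | h) hx hxa hxb
    · rw [hreg _ _ _ h1 h2]
      rcases hx with hx | rfl
      · rw [hT x hx]; exact L.foreign _ _ _ x h1 hx hxa hxb
      -- The new triangle meets an old region in at most a point because it lies in a different old
      -- region.
      · refine (L.disj _ _ _ _ _ _ h1 hk h2).anti ?_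
        rw [Set.inter_comm]
        exact Set.inter_subset_inter_right _ hsub
    · by_cases hxx : x = u ∨ x = v ∨ x = w
      · exact Nforeign _ _ _ x h hxx hxa hxb
      · push Not at hxx
        have hx := hx.resolve_right hxx.2.2
        rw [hT x hx]
        exact (L.foreign _ _ _ x hk hx hxx.1 hxx.2.1).anti
          (Set.inter_subset_inter_right _ (Nsub _ _ _ h))
  · rintro a b c a' b' c' (⟨h1, h2⟩ | h) (⟨h1', h2'⟩ | h') hne
    · rw [hreg _ _ _ h1 h2, hreg _ _ _ h1' h2']
      exact L.disj _ _ _ _ _ _ h1 h1' hne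
    · rw [hreg _ _ _ h1 h2]
      exact (L.disj _ _ _ _ _ _ h1 hk h2).anti
        (Set.inter_subset_inter_right _ (Nsub _ _ _ h'))
    · rw [hreg _ _ _ h1' h2', Set.inter_comm]
      exact (L.disj _ _ _ _ _ _ h1' hk h2').anti
        (Set.inter_subset_inter_right _ (Nsub _ _ _ h))
    · exact Ndisj _ _ _ _ _ _ h h' hne

theorem image_inter_subsingleton {φ : ℝ × ℝ → ℝ × ℝ} (hφ : Function.Injective φ)
    {S S' : Set (ℝ × ℝ)} (h : (S ∩ S').Subsingleton) : (φ '' S ∩ φ '' S').Subsingleton := by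
  rw [← Set.image_inter hφ]; exact h.image _

theorem image_inter_subset_image {φ : ℝ × ℝ → ℝ × ℝ} (hφ : Function.Injective φ)
    {S S' Q : Set (ℝ × ℝ)} (h : S ∩ S' ⊆ Q) : φ '' S ∩ φ '' S' ⊆ φ '' Q := by
  rw [← Set.image_inter hφ]; exact Set.image_mono h

/-- In a region with the corners `p`, `a`, `b`, the properties of an ear and of the new region on
the side of `a`. -/
theorem ear_half {p a b : ℝ × ℝ} (hp : area p a b ≠ 0) {l m : ℝ} (hl : l = 0 ∨ l = 1)
    (hm : m = 0 ∨ m = 1) {W S M Bu Bv : Set (ℝ × ℝ)}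
    (hW : W = frame p a b '' tri (0, 0) (6 + 2 * l, 2 - 2 * l) (2 - 2 * m, 6 + 2 * m))
    (hS : S = frame p a b '' tri (8 * l, 0) (12, 0) (6, 2))
    (hM : M = frame p a b '' tri (5, 3) (3, 5) (6, 6))
    (hWs : W ⊆ tri p a b) (hSs : S ⊆ tri p a b) (hMs : M ⊆ tri p a b)
    (hu : Bu ∩ tri p a b ⊆ segment ℝ p a) (hv : Bv ∩ tri p a b ⊆ segment ℝ p b) :
    (l = 0 → (Bu ∩ W).Subsingleton) ∧
    Bu ∩ S ⊆ segment ℝ (frame p a b (8 * l, 0)) (frame p a b (12, 0)) ∧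
    W ∩ S ⊆ segment ℝ (frame p a b (8 * l, 0)) (frame p a b (6, 2)) ∧
    (Bv ∩ S).Subsingleton ∧ (Bu ∩ M).Subsingleton ∧ (S ∩ M).Subsingleton := by
  have hφ := frame_injective hp
  have e0 := frame_zero p a b
  have el := frame_left p a b
  have er := frame_right p a b
  have red : ∀ {B X : Set (ℝ × ℝ)} {c d : ℝ × ℝ}, B ∩ tri p a b ⊆ segment ℝ c d → X ⊆ tri p a b →
      B ∩ X ⊆ segment ℝ c d ∩ X := fun h h' z hz => ⟨h ⟨hz.1, h' hz.2⟩, hz.2⟩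
  have hu' := fun X hX => red (X := X) hu hX
  have hv' := fun X hX => red (X := X) hv hX
  have esu : segment ℝ p a = frame p a b '' segment ℝ (0, 0) (16, 0) := by
    rw [← segment_frame, e0, el]
  have esv : segment ℝ p b = frame p a b '' segment ℝ (0, 0) (0, 16) := by
    rw [← segment_frame, e0, er]
  rw [esu] at hu'
  rw [esv] at hv'
  refine ⟨fun h0 => ?_, ?_, ?_, ?_, ?_, ?_⟩
  · refine Set.Subsingleton.anti ?_ (hu' W hWs)
    subst h0
    rw [hW]
    exact image_inter_subsingleton hφ (by simpa using ear_base_free hm)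
  · refine (hu' S hSs).trans ?_
    rw [hS, segment_frame]
    exact image_inter_subset_image hφ (ear_base_side hl)
  · rw [hW, hS, segment_frame]
    exact image_inter_subset_image hφ (ear_meets_side hl hm)
  · refine Set.Subsingleton.anti ?_ (hv' S hSs)
    rw [hS]
    exact image_inter_subsingleton hφ (ear_base_opposite hl)
  · refine Set.Subsingleton.anti ?_ (hu' M hMs)
    rw [hM]
    exact image_inter_subsingleton hφ ear_base_middle
  · rw [hS, hM]
    exact image_inter_subsingleton hφ (ear_side_middle hl)

theorem frame_mem_tri {p a b : ℝ × ℝ} {s t : ℝ} (hs : 0 ≤ s) (ht : 0 ≤ t) (hst : s + t ≤ 16) :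
    frame p a b (s, t) ∈ tri p a b := by
  have := Set.mem_image_of_mem (frame p a b) (mem_standard hs ht hst)
  rwa [← tri_frame, frame_zero, frame_left, frame_right] at this

theorem touch_of_segment {p a b : ℝ × ℝ} (hp : area p a b ≠ 0) {t t' : Fin 3 → ℝ × ℝ}
    {x y : ℝ × ℝ} (hxy : x ≠ y) {i j : Fin 3}
    (h : segment ℝ (frame p a b x) (frame p a b y) ⊆ triangleSide t i)
    (h' : segment ℝ (frame p a b x) (frame p a b y) ⊆ triangleSide t' j) :
    TouchNontrivially t t' :=
  ⟨i, j, _, ⟨h (left_mem_segment ℝ _ _), h' (left_mem_segment ℝ _ _)⟩, _,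
    ⟨h (right_mem_segment ℝ _ _), h' (right_mem_segment ℝ _ _)⟩,
    fun h => hxy (frame_injective hp h)⟩

theorem frame_segment_subset {p a b x y c d : ℝ × ℝ} (hx : x ∈ segment ℝ c d)
    (hy : y ∈ segment ℝ c d) : segment ℝ (frame p a b x) (frame p a b y) ⊆
      segment ℝ (frame p a b c) (frame p a b d) := by
  rw [segment_frame, segment_frame]
  exact Set.image_mono (segment_subset_segment hx hy)

end

/-! ### Inserting an ear into a layout -/

section

variable {R : ℕ → ℕ → Prop} {A : ℕ → Prop} {K K' : ℕ → ℕ → ℕ → Prop}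
  {T T' : ℕ → Fin 3 → ℝ × ℝ} {AP AR AP' AR' : ℕ → ℕ → ℕ → ℝ × ℝ}

theorem tri_swap_left (a b c : ℝ × ℝ) : tri a b c = tri b a c := by
  unfold tri; rw [Set.insert_comm]

theorem area_frame_ne_zero {p a b x y z : ℝ × ℝ} (hp : area p a b ≠ 0) (h : area x y z ≠ 0) :
    area (frame p a b x) (frame p a b y) (frame p a b z) ≠ 0 := by
  rw [area_frame]
  exact mul_ne_zero (div_ne_zero h (by norm_num)) hp

theorem frame_tri_subset {p a b x y z : ℝ × ℝ} (h : ∀ q ∈ ({x, y, z} : Set (ℝ × ℝ)),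
    0 ≤ q.1 ∧ 0 ≤ q.2 ∧ q.1 + q.2 ≤ 16) : frame p a b '' tri x y z ⊆ tri p a b := by
  rw [← tri_frame]
  have hx := h x (by simp)
  have hy := h y (by simp)
  have hz := h z (by simp)
  exact tri_subset_tri (frame_mem_tri hx.1 hx.2.1 hx.2.2) (frame_mem_tri hy.1 hy.2.1 hy.2.2)
    (frame_mem_tri hz.1 hz.2.1 hz.2.2)

/-- The keys of the regions that come with an ear `w` on the edge `u v`. -/
def EarKey (u v w a b c : ℕ) : Prop :=
  c = 0 ∧ ((a = u ∧ b = w) ∨ (a = w ∧ b = u) ∨ (a = v ∧ b = w) ∨ (a = w ∧ b = v) ∨ (a = w ∧ b = w))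

theorem EarKey.cases {u v w a b c : ℕ} (h : EarKey u v w a b c) {P : ℕ → ℕ → ℕ → Prop}
    (h₁ : P u w 0) (h₂ : P w u 0) (h₃ : P v w 0) (h₄ : P w v 0) (h₅ : P w w 0) : P a b c := by
  obtain ⟨rfl, ⟨rfl, rfl⟩ | ⟨rfl, rfl⟩ | ⟨rfl, rfl⟩ | ⟨rfl, rfl⟩ | ⟨rfl, rfl⟩⟩ := h <;> assumption

set_option maxHeartbeats 1000000 in
/-- Insert an ear `w` on the edge `u v`. -/
theorem Layout.ear (L : Layout R A K T AP AR) (hR : ∀ x y, R x y → R y x)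
    {u v k w : ℕ} (hk : K u v k) (huv : u ≠ v) (hw : ¬ A w) {l m : ℝ}
    (hl : (R u w ∧ l = 1) ∨ (¬ R u w ∧ l = 0)) (hm : (R v w ∧ m = 1) ∨ (¬ R v w ∧ m = 0))
    (hRw : ∀ x, A x → x ≠ u → x ≠ v → ¬ R x w) {φ : ℝ × ℝ → ℝ × ℝ}
    (hφ : φ = frame (AP u v k) (AR u v k) (AR v u k)) (hT : ∀ x, x ≠ w → T' x = T x)
    (T0 : T' w 0 = φ (0, 0)) (T1 : T' w 1 = φ (6 + 2 * l, 2 - 2 * l))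
    (T2 : T' w 2 = φ (2 - 2 * m, 6 + 2 * m))
    (hold : ∀ a b c, a ≠ w → b ≠ w → AP' a b c = AP a b c ∧ AR' a b c = AR a b c)
    (P1 : AP' u w 0 = φ (8 * l, 0)) (P2 : AP' w u 0 = φ (8 * l, 0))
    (P3 : AP' v w 0 = φ (0, 8 * m)) (P4 : AP' w v 0 = φ (0, 8 * m))
    (P5 : AP' w w 0 = φ (5, 3)) (R1 : AR' u w 0 = φ (12, 0)) (R2 : AR' w u 0 = φ (6, 2))
    (R3 : AR' v w 0 = φ (0, 12)) (R4 : AR' w v 0 = φ (2, 6)) (R5 : AR' w w 0 = φ (3, 5))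
    (R6 : AR' w w 1 = φ (6, 6)) :
    Layout R (fun x => A x ∨ x = w)
      (fun a b c => (K a b c ∧ ¬ SameKey a b c u v k) ∨ EarKey u v w a b c) T' AP' AR' := by
  have huA := L.key_mem _ _ _ hk
  have hk' := L.key_symm _ _ _ hk
  have hvA := L.key_mem _ _ _ hk'
  have huw : u ≠ w := fun h => hw (h ▸ huA)
  have hvw : v ≠ w := fun h => hw (h ▸ hvA)
  have hp := L.region_area _ _ _ hk
  have hreg : region AP AR u v k = tri (AP u v k) (AR u v k) (AR v u k) := by
    unfold region thirdCorner; rw [if_neg huv]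
  have hou := L.owner _ _ _ hk
  have hov := L.owner _ _ _ hk'
  obtain ⟨iu, hsu⟩ := L.side _ _ _ hk
  obtain ⟨iv, hsv⟩ := L.side _ _ _ hk'
  rw [← L.region_symm hk, ← L.apex_symm _ _ _ hk] at hov
  rw [← L.apex_symm _ _ _ hk] at hsv
  rw [hreg] at hou hov
  unfold thirdCorner at hp
  rw [if_neg huv] at hp
  have hl' : l = 0 ∨ l = 1 := hl.elim (fun h => Or.inr h.2) fun h => Or.inl h.2
  have hm' : m = 0 ∨ m = 1 := hm.elim (fun h => Or.inr h.2) fun h => Or.inl h.2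
  have hTu : T' u = T u := hT u huw
  have hTv : T' v = T v := hT v hvw
  set p := AP u v k
  set a := AR u v k
  set b := AR v u k
  have hp' : area p b a ≠ 0 := by
    intro h; apply hp; unfold area at *; linarith
  have sw : ∀ s t, frame p b a (s, t) = φ (t, s) := fun s t => by rw [hφ, frame_swap]
  have W : body (T' w) = φ '' tri (0, 0) (6 + 2 * l, 2 - 2 * l) (2 - 2 * m, 6 + 2 * m) := by
    unfold body; rw [T0, T1, T2, hφ, tri_frame]
  have W' : body (T' w) =
      frame p b a '' tri (0, 0) (6 + 2 * m, 2 - 2 * m) (2 - 2 * l, 6 + 2 * l) := by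
    unfold body; rw [T0, T1, T2, ← tri_frame, sw, sw, sw, tri_swap]
  have ru : region AP' AR' u w 0 = φ '' tri (8 * l, 0) (12, 0) (6, 2) := by
    unfold region thirdCorner; rw [if_neg huw, P1, R1, R2, hφ, tri_frame]
  have ru' : region AP' AR' w u 0 = φ '' tri (8 * l, 0) (12, 0) (6, 2) := by
    unfold region thirdCorner; rw [if_neg huw.symm, P2, R1, R2, tri_swap, hφ, tri_frame]
  have rv : region AP' AR' v w 0 = frame p b a '' tri (8 * m, 0) (12, 0) (6, 2) := by
    unfold region thirdCorner; rw [if_neg hvw, P3, R3, R4, ← tri_frame, sw, sw, sw]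
  have rv' : region AP' AR' w v 0 = frame p b a '' tri (8 * m, 0) (12, 0) (6, 2) := by
    unfold region thirdCorner
    rw [if_neg hvw.symm, P4, R3, R4, ← tri_frame, sw, sw, sw, tri_swap]
  have rvφ : region AP' AR' v w 0 = φ '' tri (0, 8 * m) (0, 12) (2, 6) := by
    unfold region thirdCorner; rw [if_neg hvw, P3, R3, R4, hφ, tri_frame]
  have rw₀ : region AP' AR' w w 0 = φ '' tri (5, 3) (3, 5) (6, 6) := by
    unfold region thirdCorner; rw [if_pos rfl, P5, R5, R6, hφ, tri_frame]
  have rw' : region AP' AR' w w 0 = frame p b a '' tri (5, 3) (3, 5) (6, 6) := by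
    unfold region thirdCorner
    rw [if_pos rfl, P5, R5, R6, ← tri_frame, sw, sw, sw, tri_swap_left]
  have sW : body (T' w) ⊆ tri p a b := by
    rw [W, hφ]; apply frame_tri_subset
    rcases hl' with rfl | rfl <;> rcases hm' with rfl | rfl <;> norm_num
  have sU : region AP' AR' u w 0 ⊆ tri p a b := by
    rw [ru, hφ]; apply frame_tri_subset
    rcases hl' with rfl | rfl <;> norm_num
  have sV : region AP' AR' v w 0 ⊆ tri p a b := by
    rw [rvφ, hφ]; apply frame_tri_subset
    rcases hm' with rfl | rfl <;> norm_num
  have sM : region AP' AR' w w 0 ⊆ tri p a b := by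
    rw [rw₀, hφ]; apply frame_tri_subset
    norm_num
  have hab := tri_swap p a b
  subst hφ
  -- The figure is symmetric under exchanging the owners together with `l` and `m`; `ear_half` is
  -- used once for each owner.
  obtain ⟨a1, a2, a3, a4, a5, a6⟩ := ear_half hp hl' hm' W ru rw₀ sW sU sM hou hov
  obtain ⟨b1, b2, b3, b4, b5, b6⟩ := ear_half hp' hm' hl' W' rv rw' (hab ▸ sW) (hab ▸ sV) (hab ▸ sM)
    (hab ▸ hov) (hab ▸ hou)
  rw [sw, sw] at b2 b3
  have mids := image_inter_subset_image (frame_injective hp) (ear_meets_middle hl' hm')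
  rw [← W, ← rw₀, ← segment_frame] at mids
  have sides := image_inter_subsingleton (frame_injective hp) (ear_sides hl' hm')
  rw [← ru, ← rvφ] at sides
  have pa : segment ℝ p a = segment ℝ (frame p a b (0, 0)) (frame p a b (16, 0)) := by
    rw [frame_zero, frame_left]
  have pb : segment ℝ p b = segment ℝ (frame p a b (0, 0)) (frame p a b (0, 16)) := by
    rw [frame_zero, frame_right]
  rw [pa] at hsu
  rw [pb] at hsv
  refine L.insert hR hk hw (fun x hx => hT x fun h => hw (h ▸ hx)) ?_ (hreg ▸ sW) ?_ ?_ hRw ?_ ?_ ?_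
    ?_ ?_ ?_ ?_ ?_ ?_ ?_
  · rw [T0, T1, T2]
    apply area_frame_ne_zero hp
    rcases hl' with rfl | rfl <;> rcases hm' with rfl | rfl <;> norm_num [area]
  · rintro x (rfl | rfl) hx
    · obtain rfl : l = 1 := (hl.resolve_right fun h => h.1 hx).2
      -- For `l = 1` the first side of the ear is exactly the first half of the arm on `u`.
      refine touch_of_segment (x := (0, 0)) (y := (8, 0)) (i := iu) (j := 0) hp (by norm_num) ?_ ?_
      · refine (frame_segment_subset (left_mem_segment ℝ _ _) ?_).trans hsu
        exact mem_segment_coord.2 ⟨1 / 2, by norm_num⟩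
      · unfold triangleSide; rw [T0, show (0 : Fin 3) + 1 = 1 from rfl, T1]; norm_num
    · obtain rfl : m = 1 := (hm.resolve_right fun h => h.1 hx).2
      refine touch_of_segment (x := (0, 0)) (y := (0, 8)) (i := iv) (j := 2) hp (by norm_num) ?_ ?_
      · refine (frame_segment_subset (left_mem_segment ℝ _ _) ?_).trans hsv
        exact mem_segment_coord.2 ⟨1 / 2, by norm_num⟩
      · unfold triangleSide; rw [T2, show (2 : Fin 3) + 1 = 0 from rfl, T0, segment_symm]; norm_num
  · rintro x (rfl | rfl) hx
    · exact a1 (hl.resolve_left fun h => hx h.1).2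
    · exact b1 (hm.resolve_left fun h => hx h.1).2
  · intro a b c hK _
    have ha : a ≠ w := fun h => hw (h ▸ L.key_mem _ _ _ hK)
    have hb : b ≠ w := fun h => hw (h ▸ L.key_mem _ _ _ (L.key_symm _ _ _ hK))
    exact ⟨(hold a b c ha hb).1, (hold a b c ha hb).2, (hold b a _ hb ha).2⟩
  · rintro a b c ⟨h1, h2⟩
    refine ⟨h1, ?_⟩
    clear * - h2
    tauto
  · intro a b c h
    exact h.cases (P := fun a _ _ => A a ∨ a = w) (Or.inl huA) (Or.inr rfl) (Or.inl hvA)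
      (Or.inr rfl) (Or.inr rfl)
  · intro a b c h
    exact h.cases (P := fun a b c => AP' a b c = AP' b a c) (by rw [P1, P2]) (by rw [P1, P2])
      (by rw [P3, P4]) (by rw [P3, P4]) rfl
  · intro a' b' c' h
    rw [hreg]
    exact h.cases (P := fun a' b' c' => region AP' AR' a' b' c' ⊆ tri p a b) sU (ru' ▸ ru ▸ sU) sV
      (rv' ▸ rv ▸ sV) sM
  · intro a b c h
    refine h.cases (P := fun a b c => area (AP' a b c) (AR' a b c) (thirdCorner AR' a b c) ≠ 0)
      ?_ ?_ ?_ ?_ ?_ <;> unfold thirdCorner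
    · rw [if_neg huw, P1, R1, R2]; apply area_frame_ne_zero hp
      rcases hl' with rfl | rfl <;> norm_num [area]
    · rw [if_neg huw.symm, P2, R1, R2]; apply area_frame_ne_zero hp
      rcases hl' with rfl | rfl <;> norm_num [area]
    · rw [if_neg hvw, P3, R3, R4]; apply area_frame_ne_zero hp
      rcases hm' with rfl | rfl <;> norm_num [area]
    · rw [if_neg hvw.symm, P4, R3, R4]; apply area_frame_ne_zero hp
      rcases hm' with rfl | rfl <;> norm_num [area]
    · rw [if_pos rfl, P5, R5, R6]; apply area_frame_ne_zero hp
      norm_num [area]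
  · intro a b c h
    refine h.cases (P := fun a b c => body (T' a) ∩ region AP' AR' a b c ⊆
      segment ℝ (AP' a b c) (AR' a b c)) ?_ ?_ ?_ ?_ ?_
    · rw [hTu, P1, R1]; exact a2
    · rw [ru', ← ru, P2, R2]; exact a3
    · rw [hTv, P3, R3]; exact b2
    · rw [rv', ← rv, P4, R4]; exact b3
    · rw [P5, R5]; exact mids
  · intro a b c h
    refine h.cases (P := fun a b c => ∃ i, segment ℝ (AP' a b c) (AR' a b c) ⊆
      triangleSide (T' a) i) ?_ ?_ ?_ ?_ ?_
    · rw [hTu, P1, R1]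
      refine ⟨iu, (frame_segment_subset ?_ ?_).trans hsu⟩
      · exact mem_segment_coord.2 ⟨l / 2, by rcases hl' with rfl | rfl <;> norm_num⟩
      · exact mem_segment_coord.2 ⟨3 / 4, by norm_num⟩
    · rw [P2, R2]
      unfold triangleSide
      -- For `l = 0` the arm on the ear is its whole side from the origin to `(6, 2)`. For `l = 1`
      -- the apex has moved to `(8, 0)`, and the arm is an initial piece of the far side, a third or
      -- a quarter of it according to `m`.
      rcases hl' with rfl | rfl
      · refine ⟨0, ?_⟩
        rw [show (0 : Fin 3) + 1 = 1 from rfl, T0, T1]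
        norm_num
      · refine ⟨1, ?_⟩
        rw [show (1 : Fin 3) + 1 = 2 from rfl, T1, T2]
        refine frame_segment_subset ?_ ?_
        · norm_num [left_mem_segment]
        · rcases hm' with rfl | rfl
          · exact mem_segment_coord.2 ⟨1 / 3, by norm_num⟩
          · exact mem_segment_coord.2 ⟨1 / 4, by norm_num⟩
    · rw [hTv, P3, R3]
      refine ⟨iv, (frame_segment_subset ?_ ?_).trans hsv⟩
      · exact mem_segment_coord.2 ⟨m / 2, by rcases hm' with rfl | rfl <;> norm_num⟩
      · exact mem_segment_coord.2 ⟨3 / 4, by norm_num⟩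
    · rw [P4, R4]
      unfold triangleSide
      rcases hm' with rfl | rfl
      · refine ⟨2, ?_⟩
        rw [show (2 : Fin 3) + 1 = 0 from rfl, T0, T2, segment_symm]
        norm_num
      · refine ⟨1, ?_⟩
        rw [show (1 : Fin 3) + 1 = 2 from rfl, T1, T2]
        refine frame_segment_subset ?_ ?_
        · norm_num [right_mem_segment]
        · rcases hl' with rfl | rfl
          · exact mem_segment_coord.2 ⟨2 / 3, by norm_num⟩
          · exact mem_segment_coord.2 ⟨3 / 4, by norm_num⟩
    · rw [P5, R5]
      refine ⟨1, ?_⟩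
      unfold triangleSide
      rw [show (1 : Fin 3) + 1 = 2 from rfl, T1, T2]
      refine frame_segment_subset ?_ ?_ <;> rw [mem_segment_coord]
      · refine ⟨(1 + 2 * l) / (4 + 2 * l + 2 * m), ?_⟩
        rcases hl' with rfl | rfl <;> rcases hm' with rfl | rfl <;> norm_num
      · refine ⟨(3 + 2 * l) / (4 + 2 * l + 2 * m), ?_⟩
        rcases hl' with rfl | rfl <;> rcases hm' with rfl | rfl <;> norm_num
  · intro a b c x h
    refine h.cases (P := fun a b c => x = u ∨ x = v ∨ x = w → x ≠ a → x ≠ b →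
      (body (T' x) ∩ region AP' AR' a b c).Subsingleton) ?_ ?_ ?_ ?_ ?_
    · rintro (rfl | rfl | rfl) h1 h2
      · exact absurd rfl h1
      · rw [hTv]; exact a4
      · exact absurd rfl h2
    · rintro (rfl | rfl | rfl) h1 h2
      · exact absurd rfl h2
      · rw [hTv, ru', ← ru]; exact a4
      · exact absurd rfl h1
    · rintro (rfl | rfl | rfl) h1 h2
      · rw [hTu]; exact b4
      · exact absurd rfl h1
      · exact absurd rfl h2
    · rintro (rfl | rfl | rfl) h1 h2
      · rw [hTu, rv', ← rv]; exact b4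
      · exact absurd rfl h2
      · exact absurd rfl h1
    · rintro (rfl | rfl | rfl) h1 h2
      · rw [hTu]; exact a5
      · rw [hTv]; exact b5
      · exact absurd rfl h1
  · have red : ∀ a b c, EarKey u v w a b c →
        (region AP' AR' a b c = region AP' AR' u w 0 ∧ SameKey a b c u w 0) ∨
        (region AP' AR' a b c = region AP' AR' v w 0 ∧ SameKey a b c v w 0) ∨
        (region AP' AR' a b c = region AP' AR' w w 0 ∧ SameKey a b c w w 0) := by
      intro a b c h
      refine h.cases (P := fun a b c =>
        (region AP' AR' a b c = region AP' AR' u w 0 ∧ SameKey a b c u w 0) ∨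
        (region AP' AR' a b c = region AP' AR' v w 0 ∧ SameKey a b c v w 0) ∨
        (region AP' AR' a b c = region AP' AR' w w 0 ∧ SameKey a b c w w 0)) ?_ ?_ ?_ ?_ ?_
      · simp [SameKey]
      · simp [SameKey, ru, ru']
      · simp [SameKey]
      · simp [SameKey, rv, rv']
      · simp [SameKey]
    intro a b c a' b' c' h h' hne
    rcases red a b c h with ⟨e, s⟩ | ⟨e, s⟩ | ⟨e, s⟩ <;>
      rcases red a' b' c' h' with ⟨e', s'⟩ | ⟨e', s'⟩ | ⟨e', s'⟩ <;> rw [e, e']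
    · exact absurd (by unfold SameKey at *; omega) hne
    · exact sides
    · exact a6
    · rw [Set.inter_comm]; exact sides
    · exact absurd (by unfold SameKey at *; omega) hne
    · exact b6
    · rw [Set.inter_comm]; exact a6
    · rw [Set.inter_comm]; exact b6
    · exact absurd (by unfold SameKey at *; omega) hne

end

/-! ### Attaching a triangle to a single triangle -/

section

variable {R : ℕ → ℕ → Prop} {A : ℕ → Prop} {K K' : ℕ → ℕ → ℕ → Prop}
  {T T' : ℕ → Fin 3 → ℝ × ℝ} {AP AR AP' AR' : ℕ → ℕ → ℕ → ℝ × ℝ}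

/-- The keys of the regions that come with a vertex `w` that is attached to `u` only. -/
def PendantKey (u w a b c : ℕ) : Prop :=
  (c = 0 ∧ ((a = u ∧ b = w) ∨ (a = w ∧ b = u) ∨ (a = w ∧ b = w) ∨ (a = u ∧ b = u))) ∨
    (c = 1 ∧ ((a = u ∧ b = w) ∨ (a = w ∧ b = u)))

theorem PendantKey.cases {u w a b c : ℕ} (h : PendantKey u w a b c) {P : ℕ → ℕ → ℕ → Prop}
    (h₁ : P u w 0) (h₂ : P w u 0) (h₃ : P u w 1) (h₄ : P w u 1) (h₅ : P w w 0) (h₆ : P u u 0) :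
    P a b c := by
  obtain ⟨rfl, ⟨rfl, rfl⟩ | ⟨rfl, rfl⟩ | ⟨rfl, rfl⟩ | ⟨rfl, rfl⟩⟩ |
    ⟨rfl, ⟨rfl, rfl⟩ | ⟨rfl, rfl⟩⟩ := h <;> assumption

set_option maxHeartbeats 1000000 in
/-- Attach a vertex `w` to the vertex `u` only. -/
theorem Layout.pendant (L : Layout R A K T AP AR) (hR : ∀ x y, R x y → R y x)
    {u w : ℕ} (hk : K u u 0) (hdiag : ∀ k, K u u k → k = 0) (hw : ¬ A w) {l : ℝ}
    (hl : (R u w ∧ l = 1) ∨ (¬ R u w ∧ l = 0))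
    (hRw : ∀ x, A x → x ≠ u → ¬ R x w) {φ : ℝ × ℝ → ℝ × ℝ}
    (hφ : φ = frame (AP u u 0) (AR u u 0) (AR u u 1)) (hT : ∀ x, x ≠ w → T' x = T x)
    (T0 : T' w 0 = φ (4, 0)) (T1 : T' w 1 = φ (6 + 2 * l, 2 - 2 * l)) (T2 : T' w 2 = φ (4, 4))
    (hold : ∀ a b c, a ≠ w → b ≠ w → ¬ (a = u ∧ b = u) →
      AP' a b c = AP a b c ∧ AR' a b c = AR a b c)
    (P1 : AP' u w 0 = φ (4, 0)) (P2 : AP' w u 0 = φ (4, 0))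
    (P3 : AP' u w 1 = φ (4 + 4 * l, 0)) (P4 : AP' w u 1 = φ (4 + 4 * l, 0))
    (P5 : AP' w w 0 = φ (5, 3)) (P6 : AP' u u 0 = φ (12, 0))
    (R1 : AR' u w 0 = φ (2, 0)) (R2 : AR' w u 0 = φ (4, 2))
    (R3 : AR' u w 1 = φ (10, 0)) (R4 : AR' w u 1 = φ (6, 2)) (R5 : AR' w w 0 = φ (4, 4))
    (R6 : AR' w w 1 = φ (6, 4)) (R7 : AR' u u 0 = φ (16, 0)) (R8 : AR' u u 1 = φ (12, 2)) :
    Layout R (fun x => A x ∨ x = w)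
      (fun a b c => (K a b c ∧ ¬ SameKey a b c u u 0) ∨ PendantKey u w a b c) T' AP' AR' := by
  have huA := L.key_mem _ _ _ hk
  have huw : u ≠ w := fun h => hw (h ▸ huA)
  have hp := L.region_area _ _ _ hk
  have hreg : region AP AR u u 0 = tri (AP u u 0) (AR u u 0) (AR u u 1) := by
    unfold region thirdCorner; rw [if_pos rfl]
  have hou := L.owner _ _ _ hk
  obtain ⟨iu, hsu⟩ := L.side _ _ _ hk
  rw [hreg] at hou
  unfold thirdCorner at hp
  rw [if_pos rfl] at hp
  have hl' : l = 0 ∨ l = 1 := hl.elim (fun h => Or.inr h.2) fun h => Or.inl h.2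
  have hTu : T' u = T u := hT u huw
  set p := AP u u 0
  set a := AR u u 0
  set b := AR u u 1
  have W : body (T' w) = φ '' tri (4, 0) (6 + 2 * l, 2 - 2 * l) (4, 4) := by
    unfold body; rw [T0, T1, T2, hφ, tri_frame]
  have r0 : region AP' AR' u w 0 = φ '' tri (4, 0) (2, 0) (4, 2) := by
    unfold region thirdCorner; rw [if_neg huw, P1, R1, R2, hφ, tri_frame]
  have r0' : region AP' AR' w u 0 = φ '' tri (4, 0) (2, 0) (4, 2) := by
    unfold region thirdCorner; rw [if_neg huw.symm, P2, R1, R2, tri_swap, hφ, tri_frame]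
  have r1 : region AP' AR' u w 1 = φ '' tri (4 + 4 * l, 0) (10, 0) (6, 2) := by
    unfold region thirdCorner; rw [if_neg huw, P3, R3, R4, hφ, tri_frame]
  have r1' : region AP' AR' w u 1 = φ '' tri (4 + 4 * l, 0) (10, 0) (6, 2) := by
    unfold region thirdCorner; rw [if_neg huw.symm, P4, R3, R4, tri_swap, hφ, tri_frame]
  have rm : region AP' AR' w w 0 = φ '' tri (5, 3) (4, 4) (6, 4) := by
    unfold region thirdCorner; rw [if_pos rfl, P5, R5, R6, hφ, tri_frame]
  have rz : region AP' AR' u u 0 = φ '' tri (12, 0) (16, 0) (12, 2) := by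
    unfold region thirdCorner; rw [if_pos rfl, P6, R7, R8, hφ, tri_frame]
  have sW : body (T' w) ⊆ tri p a b := by
    rw [W, hφ]; apply frame_tri_subset
    rcases hl' with rfl | rfl <;> norm_num
  have s0 : region AP' AR' u w 0 ⊆ tri p a b := by
    rw [r0, hφ]; apply frame_tri_subset; norm_num
  have s1 : region AP' AR' u w 1 ⊆ tri p a b := by
    rw [r1, hφ]; apply frame_tri_subset
    rcases hl' with rfl | rfl <;> norm_num
  have sm : region AP' AR' w w 0 ⊆ tri p a b := by
    rw [rm, hφ]; apply frame_tri_subset; norm_num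
  have sz : region AP' AR' u u 0 ⊆ tri p a b := by
    rw [rz, hφ]; apply frame_tri_subset; norm_num
  subst hφ
  have inj := frame_injective hp
  have pa : segment ℝ p a = segment ℝ (frame p a b (0, 0)) (frame p a b (16, 0)) := by
    rw [frame_zero, frame_left]
  rw [pa] at hsu
  have red : ∀ {X : Set (ℝ × ℝ)}, X ⊆ tri p a b → body (T u) ∩ X ⊆
      frame p a b '' segment ℝ (0, 0) (16, 0) ∩ X := fun h z hz => by
    rw [← segment_frame, ← pa]
    exact ⟨hou ⟨hz.1, h hz.2⟩, hz.2⟩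
  have u0 := red s0
  have u1 := red s1
  have um := red sm
  have uz := red sz
  rw [r0] at u0
  rw [r1] at u1
  rw [rm] at um
  rw [rz] at uz
  have u0 := u0.trans (image_inter_subset_image inj pendant_base_first)
  have u1 := u1.trans (image_inter_subset_image inj (pendant_base_second hl'))
  have um := (image_inter_subsingleton inj pendant_base_middle).anti um
  have uz := uz.trans (image_inter_subset_image inj pendant_base_last)
  rw [← segment_frame] at u0 u1 uz
  have w0 := image_inter_subset_image inj (pendant_meets_first hl')
  have w1 := image_inter_subset_image inj (pendant_meets_second hl')
  have wm := image_inter_subset_image inj (pendant_meets_middle hl')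
  have wz := image_inter_subsingleton inj (pendant_meets_last hl')
  rw [← W, ← segment_frame] at w0 w1 wm
  rw [← W] at wz
  refine L.insert hR hk hw (fun x hx => hT x fun h => hw (h ▸ hx)) ?_ (hreg ▸ sW) ?_ ?_
    (fun x h1 h2 _ => hRw x h1 h2) ?_ ?_ ?_ ?_ ?_ ?_ ?_ ?_ ?_ ?_
  · rw [T0, T1, T2]
    apply area_frame_ne_zero hp
    rcases hl' with rfl | rfl <;> norm_num [area]
  · rintro x hx hRx
    obtain rfl : x = u := hx.elim id id
    obtain rfl : l = 1 := (hl.resolve_right fun h => h.1 hRx).2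
    refine touch_of_segment (x := (4, 0)) (y := (8, 0)) (i := iu) (j := 0) hp (by norm_num) ?_ ?_
    · refine (frame_segment_subset ?_ ?_).trans hsu
      · exact mem_segment_coord.2 ⟨1 / 4, by norm_num⟩
      · exact mem_segment_coord.2 ⟨1 / 2, by norm_num⟩
    · unfold triangleSide; rw [T0, show (0 : Fin 3) + 1 = 1 from rfl, T1]; norm_num
  · rintro x hx hRx
    obtain rfl : x = u := hx.elim id id
    obtain rfl : l = 0 := (hl.resolve_left fun h => hRx h.1).2
    refine Set.Subsingleton.anti ?_ (red sW)
    rw [W]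
    exact image_inter_subsingleton inj (by simpa using pendant_base_free)
  · intro a b c hK hne
    have ha : a ≠ w := fun h => hw (h ▸ L.key_mem _ _ _ hK)
    have hb : b ≠ w := fun h => hw (h ▸ L.key_mem _ _ _ (L.key_symm _ _ _ hK))
    -- The region used up is the only one with a key `(u, u, _)`, by `hdiag`; its entry is
    -- overwritten by the smaller region at the end of the arm.
    have hab : ¬ (a = u ∧ b = u) := by
      rintro ⟨rfl, rfl⟩
      exact hne ⟨hdiag c hK, Or.inl ⟨rfl, rfl⟩⟩
    exact ⟨(hold a b c ha hb hab).1, (hold a b c ha hb hab).2,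
      (hold b a _ hb ha fun h => hab h.symm).2⟩
  · intro a b c h
    clear * - h
    unfold PendantKey at *
    tauto
  · intro a b c h
    exact h.cases (P := fun a _ _ => A a ∨ a = w) (Or.inl huA) (Or.inr rfl) (Or.inl huA)
      (Or.inr rfl) (Or.inr rfl) (Or.inl huA)
  · intro a b c h
    exact h.cases (P := fun a b c => AP' a b c = AP' b a c) (by rw [P1, P2]) (by rw [P1, P2])
      (by rw [P3, P4]) (by rw [P3, P4]) rfl rfl
  · intro a' b' c' h
    rw [hreg]
    exact h.cases (P := fun a' b' c' => region AP' AR' a' b' c' ⊆ tri p a b) s0 (r0' ▸ r0 ▸ s0) s1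
      (r1' ▸ r1 ▸ s1) sm sz
  · intro a b c h
    refine h.cases (P := fun a b c => area (AP' a b c) (AR' a b c) (thirdCorner AR' a b c) ≠ 0)
      ?_ ?_ ?_ ?_ ?_ ?_ <;> unfold thirdCorner
    · rw [if_neg huw, P1, R1, R2]; apply area_frame_ne_zero hp
      norm_num [area]
    · rw [if_neg huw.symm, P2, R1, R2]; apply area_frame_ne_zero hp
      norm_num [area]
    · rw [if_neg huw, P3, R3, R4]; apply area_frame_ne_zero hp
      rcases hl' with rfl | rfl <;> norm_num [area]
    · rw [if_neg huw.symm, P4, R3, R4]; apply area_frame_ne_zero hp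
      rcases hl' with rfl | rfl <;> norm_num [area]
    · rw [if_pos rfl, P5, R5, R6]; apply area_frame_ne_zero hp
      norm_num [area]
    · rw [if_pos rfl, P6, R7, R8]; apply area_frame_ne_zero hp
      norm_num [area]
  · intro a b c h
    refine h.cases (P := fun a b c => body (T' a) ∩ region AP' AR' a b c ⊆
      segment ℝ (AP' a b c) (AR' a b c)) ?_ ?_ ?_ ?_ ?_ ?_
    · rw [hTu, r0, P1, R1]; exact u0
    · rw [r0', P2, R2]; exact w0
    · rw [hTu, r1, P3, R3]; exact u1
    · rw [r1', P4, R4]; exact w1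
    · rw [rm, P5, R5]; exact wm
    · rw [hTu, rz, P6, R7]; exact uz
  · intro a b c h
    refine h.cases (P := fun a b c => ∃ i, segment ℝ (AP' a b c) (AR' a b c) ⊆
      triangleSide (T' a) i) ?_ ?_ ?_ ?_ ?_ ?_
    · rw [hTu, P1, R1]
      refine ⟨iu, (frame_segment_subset ?_ ?_).trans hsu⟩
      · exact mem_segment_coord.2 ⟨1 / 4, by norm_num⟩
      · exact mem_segment_coord.2 ⟨1 / 8, by norm_num⟩
    · rw [P2, R2]
      refine ⟨2, ?_⟩
      unfold triangleSide
      rw [show (2 : Fin 3) + 1 = 0 from rfl, T2, T0]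
      refine frame_segment_subset (right_mem_segment ℝ _ _) ?_
      exact mem_segment_coord.2 ⟨1 / 2, by norm_num⟩
    · rw [hTu, P3, R3]
      refine ⟨iu, (frame_segment_subset ?_ ?_).trans hsu⟩
      · exact mem_segment_coord.2 ⟨1 / 4 + l / 4, by rcases hl' with rfl | rfl <;> norm_num⟩
      · exact mem_segment_coord.2 ⟨5 / 8, by norm_num⟩
    · rw [P4, R4]
      unfold triangleSide
      rcases hl' with rfl | rfl
      · refine ⟨0, ?_⟩
        rw [show (0 : Fin 3) + 1 = 1 from rfl, T0, T1]
        norm_num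
      · refine ⟨1, ?_⟩
        rw [show (1 : Fin 3) + 1 = 2 from rfl, T1, T2]
        refine frame_segment_subset ?_ ?_
        · norm_num [left_mem_segment]
        · exact mem_segment_coord.2 ⟨1 / 2, by norm_num⟩
    · rw [P5, R5]
      refine ⟨1, ?_⟩
      unfold triangleSide
      rw [show (1 : Fin 3) + 1 = 2 from rfl, T1, T2]
      refine frame_segment_subset ?_ (right_mem_segment ℝ _ _)
      rcases hl' with rfl | rfl
      · exact mem_segment_coord.2 ⟨1 / 2, by norm_num⟩
      · exact mem_segment_coord.2 ⟨3 / 4, by norm_num⟩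
    · rw [hTu, P6, R7]
      refine ⟨iu, (frame_segment_subset ?_ (right_mem_segment ℝ _ _)).trans hsu⟩
      exact mem_segment_coord.2 ⟨3 / 4, by norm_num⟩
  · intro a b c x h hx
    have hx : x = u ∨ x = w := by rcases hx with h | h | h <;> simp [h]
    revert hx
    refine h.cases (P := fun a b c => x = u ∨ x = w → x ≠ a → x ≠ b →
      (body (T' x) ∩ region AP' AR' a b c).Subsingleton) ?_ ?_ ?_ ?_ ?_ ?_
    · rintro (rfl | rfl) h1 h2
      · exact absurd rfl h1
      · exact absurd rfl h2
    · rintro (rfl | rfl) h1 h2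
      · exact absurd rfl h2
      · exact absurd rfl h1
    · rintro (rfl | rfl) h1 h2
      · exact absurd rfl h1
      · exact absurd rfl h2
    · rintro (rfl | rfl) h1 h2
      · exact absurd rfl h2
      · exact absurd rfl h1
    · rintro (rfl | rfl) h1 h2
      · rw [hTu, rm]; exact um
      · exact absurd rfl h1
    · rintro (rfl | rfl) h1 h2
      · exact absurd rfl h1
      · rw [rz]; exact wz
  · have cls : ∀ x y c, PendantKey u w x y c →
        (region AP' AR' x y c = frame p a b '' tri (4, 0) (2, 0) (4, 2) ∧ SameKey x y c u w 0) ∨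
        (region AP' AR' x y c = frame p a b '' tri (4 + 4 * l, 0) (10, 0) (6, 2) ∧
          SameKey x y c u w 1) ∨
        (region AP' AR' x y c = frame p a b '' tri (5, 3) (4, 4) (6, 4) ∧ SameKey x y c w w 0) ∨
        (region AP' AR' x y c = frame p a b '' tri (12, 0) (16, 0) (12, 2) ∧
          SameKey x y c u u 0) := by
      intro x y c h
      refine h.cases (P := fun x y c =>
        (region AP' AR' x y c = frame p a b '' tri (4, 0) (2, 0) (4, 2) ∧ SameKey x y c u w 0) ∨
        (region AP' AR' x y c = frame p a b '' tri (4 + 4 * l, 0) (10, 0) (6, 2) ∧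
          SameKey x y c u w 1) ∨
        (region AP' AR' x y c = frame p a b '' tri (5, 3) (4, 4) (6, 4) ∧ SameKey x y c w w 0) ∨
        (region AP' AR' x y c = frame p a b '' tri (12, 0) (16, 0) (12, 2) ∧
          SameKey x y c u u 0)) ?_ ?_ ?_ ?_ ?_ ?_
      · exact Or.inl ⟨r0, by simp [SameKey]⟩
      · exact Or.inl ⟨r0', by simp [SameKey]⟩
      · exact Or.inr (Or.inl ⟨r1, by simp [SameKey]⟩)
      · exact Or.inr (Or.inl ⟨r1', by simp [SameKey]⟩)
      · exact Or.inr (Or.inr (Or.inl ⟨rm, by simp [SameKey]⟩))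
      · exact Or.inr (Or.inr (Or.inr ⟨rz, by simp [SameKey]⟩))
    have d01 := image_inter_subsingleton inj (pendant_first_second hl')
    have d0m := image_inter_subsingleton inj pendant_first_middle
    have d0z := image_inter_subsingleton inj pendant_first_last
    have d1m := image_inter_subsingleton inj (pendant_second_middle hl')
    have d1z := image_inter_subsingleton inj (pendant_second_last hl')
    have dmz := image_inter_subsingleton inj pendant_middle_last
    intro a b c a' b' c' h h' hne
    rcases cls a b c h with ⟨e, s⟩ | ⟨e, s⟩ | ⟨e, s⟩ | ⟨e, s⟩ <;>
      rcases cls a' b' c' h' with ⟨e', s'⟩ | ⟨e', s'⟩ | ⟨e', s'⟩ | ⟨e', s'⟩ <;> rw [e, e'] <;>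
      first
      | assumption
      | (rw [Set.inter_comm]; assumption)
      | exact absurd (by clear * - s s'; unfold SameKey at *; omega) hne

end

/-! ### Elimination histories -/

/-- A removal step: the vertex `vertex` is removed; its neighbours `left` and `right` at this time
become adjacent, and it is the ear number `slot` on their edge. If `left = right`, it is attached
to this vertex only. -/
structure Removal where
  vertex : ℕ
  left : ℕ
  right : ℕ
  slot : ℕ

/-- The vertices `x ≤ n` that have not been removed. -/
def Present (n : ℕ) (l : List Removal) (x : ℕ) : Prop := x ≤ n ∧ ∀ r ∈ l, r.vertex ≠ x

/-- Raise the number of ears on the edge `u v` by one. -/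
def raise (c : ℕ → ℕ → ℕ) (u v a b : ℕ) : ℕ :=
  if (a = u ∧ b = v) ∨ (a = v ∧ b = u) then c a b + 1 else c a b

/-- A list of removals, the last one first, that can be undone by inserting triangles; `c u v` is
the number of ears on the edge `u v`. -/
inductive History (n : ℕ) (R : ℕ → ℕ → Prop) : List Removal → (ℕ → ℕ → ℕ) → Prop
  | nil : History n R [] fun _ _ => 0
  | pendant {l c u w} : History n R l c → w < n → Present n l w → Present n l u → u ≠ w →
      c u w ≤ 2 → (∀ x, Present n l x → x ≠ u → x ≠ w → c x w = 0 ∧ ¬ R x w) →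
      History n R (⟨w, u, u, 0⟩ :: l) c
  | ear {l c u v w} : History n R l c → w < n → Present n l w → Present n l u → Present n l v →
      u ≠ w → v ≠ w → u ≠ v → c u w ≤ 1 → c v w ≤ 1 → c u v ≤ 1 →
      (∀ x, Present n l x → x ≠ u → x ≠ v → x ≠ w → c x w = 0 ∧ ¬ R x w) →
      History n R (⟨w, u, v, c u v⟩ :: l) (raise c u v)

theorem History.symm {n : ℕ} {R : ℕ → ℕ → Prop} {l : List Removal} {c : ℕ → ℕ → ℕ}
    (h : History n R l c) : ∀ a b, c a b = c b a := by
  induction h with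
  | nil => simp
  | pendant _ _ _ _ _ _ _ ih => exact ih
  | ear _ _ _ _ _ _ _ _ _ _ _ _ ih =>
    intro a b
    unfold raise
    rw [ih a b]
    congr 1
    exact propext (by tauto)

/-- The keys of the regions that are needed in order to undo the removals `l`. -/
def NeededKey (n : ℕ) (l : List Removal) (c : ℕ → ℕ → ℕ) (a b k : ℕ) : Prop :=
  Present n l a ∧ Present n l b ∧ ((a = b ∧ k = 0) ∨ (a ≠ b ∧ k < c a b))

theorem present_cons {n : ℕ} {l : List Removal} {r : Removal} {x : ℕ} :
    Present n (r :: l) x ↔ Present n l x ∧ x ≠ r.vertex := by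
  simp only [Present, List.mem_cons, forall_eq_or_imp]
  constructor
  · rintro ⟨h1, h2, h3⟩; exact ⟨⟨h1, h3⟩, h2.symm⟩
  · rintro ⟨⟨h1, h3⟩, h2⟩; exact ⟨h1, h2.symm, h3⟩

theorem present_iff_cons {n : ℕ} {l : List Removal} {r : Removal} (hr : Present n l r.vertex) :
    (fun x => Present n (r :: l) x ∨ x = r.vertex) = Present n l := by
  funext x
  apply propext
  rw [present_cons]
  constructor
  · rintro (h | rfl)
    · exact h.1
    · exact hr
  · intro h
    by_cases hx : x = r.vertex
    · exact Or.inr hx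
    · exact Or.inl ⟨h, hx⟩

theorem NeededKey.symm {n : ℕ} {l : List Removal} {c : ℕ → ℕ → ℕ} (hc : ∀ a b, c a b = c b a)
    {a b k : ℕ} (h : NeededKey n l c a b k) : NeededKey n l c b a k := by
  obtain ⟨h1, h2, h3⟩ := h
  refine ⟨h2, h1, h3.imp (fun h => ⟨h.1.symm, h.2⟩) fun h => ⟨h.1.symm, ?_⟩⟩
  rw [hc]; exact h.2

/-- The layout of the triangles that are present when the removals `l` have not yet been undone. -/
def LayoutAt (n : ℕ) (R : ℕ → ℕ → Prop) (l : List Removal) (c : ℕ → ℕ → ℕ)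
    (T : ℕ → Fin 3 → ℝ × ℝ) (AP AR : ℕ → ℕ → ℕ → ℝ × ℝ) : Prop :=
  Layout R (Present n l) (NeededKey n l c) T AP AR

/-- `Layout.ear` provides one region on each of the edges `u w` and `v w`, which is enough since
these carry at most one ear, and it uses up the region number `c u v` on `u v`, the one that `raise`
had added. The remaining work is to find every needed key among those provided. -/
theorem LayoutAt.undo_ear {n : ℕ} {R : ℕ → ℕ → Prop} {l : List Removal} {c : ℕ → ℕ → ℕ}
    {u v w : ℕ} {T T' : ℕ → Fin 3 → ℝ × ℝ} {AP AR AP' AR' : ℕ → ℕ → ℕ → ℝ × ℝ}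
    (L : LayoutAt n R (⟨w, u, v, c u v⟩ :: l) (raise c u v) T AP AR)
    (hR : ∀ x y, R x y → R y x) (hc : ∀ a b, c a b = c b a)
    (hw : Present n l w) (hu : Present n l u) (hv : Present n l v)
    (huw : u ≠ w) (hvw : v ≠ w) (huv : u ≠ v) (cu : c u w ≤ 1) (cv : c v w ≤ 1)
    (hx : ∀ x, Present n l x → x ≠ u → x ≠ v → x ≠ w → c x w = 0 ∧ ¬ R x w) {s m : ℝ}
    (hl : (R u w ∧ s = 1) ∨ (¬ R u w ∧ s = 0)) (hm : (R v w ∧ m = 1) ∨ (¬ R v w ∧ m = 0))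
    {φ : ℝ × ℝ → ℝ × ℝ}
    (hφ : φ = frame (AP u v (c u v)) (AR u v (c u v)) (AR v u (c u v)))
    (hT : ∀ x, x ≠ w → T' x = T x)
    (T0 : T' w 0 = φ (0, 0)) (T1 : T' w 1 = φ (6 + 2 * s, 2 - 2 * s))
    (T2 : T' w 2 = φ (2 - 2 * m, 6 + 2 * m))
    (hold : ∀ a b c, a ≠ w → b ≠ w → AP' a b c = AP a b c ∧ AR' a b c = AR a b c)
    (P1 : AP' u w 0 = φ (8 * s, 0)) (P2 : AP' w u 0 = φ (8 * s, 0))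
    (P3 : AP' v w 0 = φ (0, 8 * m)) (P4 : AP' w v 0 = φ (0, 8 * m))
    (P5 : AP' w w 0 = φ (5, 3)) (R1 : AR' u w 0 = φ (12, 0)) (R2 : AR' w u 0 = φ (6, 2))
    (R3 : AR' v w 0 = φ (0, 12)) (R4 : AR' w v 0 = φ (2, 6)) (R5 : AR' w w 0 = φ (3, 5))
    (R6 : AR' w w 1 = φ (6, 6)) : LayoutAt n R l c T' AP' AR' := by
  have hk : NeededKey n (⟨w, u, v, c u v⟩ :: l) (raise c u v) u v (c u v) := by
    refine ⟨present_cons.2 ⟨hu, huw⟩, present_cons.2 ⟨hv, hvw⟩, Or.inr ⟨huv, ?_⟩⟩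
    simp [raise]
  have key := Layout.ear L hR hk huv (fun h => (present_cons.1 h).2 rfl) hl hm
    (fun x h h1 h2 => (hx x (present_cons.1 h).1 h1 h2 (present_cons.1 h).2).2)
    hφ hT T0 T1 T2 hold P1 P2 P3 P4 P5 R1 R2 R3 R4 R5 R6
  have hA := present_iff_cons (r := ⟨w, u, v, c u v⟩) hw
  simp only at hA
  rw [hA] at key
  refine key.mono ?_ fun _ _ _ h => h.symm hc
  rintro a b k ⟨ha, hb, h⟩
  by_cases haw : a = w
  · subst haw
    right
    rcases h with ⟨rfl, rfl⟩ | ⟨hab, h⟩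
    · simp [EarKey]
    · rw [hc] at h
      by_cases hbu : b = u
      · subst hbu; exact ⟨by omega, by simp⟩
      by_cases hbv : b = v
      · subst hbv; exact ⟨by omega, by simp⟩
      have := (hx b hb hbu hbv (Ne.symm hab)).1
      omega
  by_cases hbw : b = w
  · subst hbw
    right
    rcases h with ⟨rfl, rfl⟩ | ⟨hab, h⟩
    · simp [EarKey]
    · by_cases hbu : a = u
      · subst hbu; exact ⟨by omega, by simp⟩
      by_cases hbv : a = v
      · subst hbv; exact ⟨by omega, by simp⟩
      have := (hx a ha hbu hbv hab).1
      omega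
  left
  refine ⟨⟨present_cons.2 ⟨ha, haw⟩, present_cons.2 ⟨hb, hbw⟩, h.imp_right fun h => ⟨h.1, ?_⟩⟩, ?_⟩
  · refine h.2.trans_le ?_
    unfold raise; split <;> omega
  -- The keys still needed on `u v` have a number below `c u v`, so none of them is the region used
  -- up.
  · rintro ⟨rfl, ⟨rfl, rfl⟩ | ⟨rfl, rfl⟩⟩
    · rcases h with ⟨h, _⟩ | ⟨_, h⟩
      · exact huv h
      · omega
    · rcases h with ⟨h, _⟩ | ⟨_, h⟩
      · exact huv h.symm
      · rw [hc] at h; omega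

/-- Two regions on the edge `u w` suffice because it carries at most two ears; the region of `u`
alone is used up, but `Layout.pendant` puts a smaller one in its place. -/
theorem LayoutAt.undo_pendant {n : ℕ} {R : ℕ → ℕ → Prop} {l : List Removal} {c : ℕ → ℕ → ℕ}
    {u w i : ℕ} {T T' : ℕ → Fin 3 → ℝ × ℝ} {AP AR AP' AR' : ℕ → ℕ → ℕ → ℝ × ℝ}
    (L : LayoutAt n R (⟨w, u, u, i⟩ :: l) c T AP AR)
    (hR : ∀ x y, R x y → R y x) (hc : ∀ a b, c a b = c b a)
    (hw : Present n l w) (hu : Present n l u) (huw : u ≠ w) (cu : c u w ≤ 2)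
    (hx : ∀ x, Present n l x → x ≠ u → x ≠ w → c x w = 0 ∧ ¬ R x w) {s : ℝ}
    (hl : (R u w ∧ s = 1) ∨ (¬ R u w ∧ s = 0)) {φ : ℝ × ℝ → ℝ × ℝ}
    (hφ : φ = frame (AP u u 0) (AR u u 0) (AR u u 1)) (hT : ∀ x, x ≠ w → T' x = T x)
    (T0 : T' w 0 = φ (4, 0)) (T1 : T' w 1 = φ (6 + 2 * s, 2 - 2 * s)) (T2 : T' w 2 = φ (4, 4))
    (hold : ∀ a b c, a ≠ w → b ≠ w → ¬ (a = u ∧ b = u) →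
      AP' a b c = AP a b c ∧ AR' a b c = AR a b c)
    (P1 : AP' u w 0 = φ (4, 0)) (P2 : AP' w u 0 = φ (4, 0))
    (P3 : AP' u w 1 = φ (4 + 4 * s, 0)) (P4 : AP' w u 1 = φ (4 + 4 * s, 0))
    (P5 : AP' w w 0 = φ (5, 3)) (P6 : AP' u u 0 = φ (12, 0))
    (R1 : AR' u w 0 = φ (2, 0)) (R2 : AR' w u 0 = φ (4, 2))
    (R3 : AR' u w 1 = φ (10, 0)) (R4 : AR' w u 1 = φ (6, 2)) (R5 : AR' w w 0 = φ (4, 4))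
    (R6 : AR' w w 1 = φ (6, 4)) (R7 : AR' u u 0 = φ (16, 0)) (R8 : AR' u u 1 = φ (12, 2)) :
    LayoutAt n R l c T' AP' AR' := by
  have hk : NeededKey n (⟨w, u, u, i⟩ :: l) c u u 0 :=
    ⟨present_cons.2 ⟨hu, huw⟩, present_cons.2 ⟨hu, huw⟩, Or.inl ⟨rfl, rfl⟩⟩
  have key := Layout.pendant L hR hk (fun k h => by simpa using h.2.2)
    (fun h => (present_cons.1 h).2 rfl) hl
    (fun x h h1 => (hx x (present_cons.1 h).1 h1 (present_cons.1 h).2).2)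
    hφ hT T0 T1 T2 hold P1 P2 P3 P4 P5 P6 R1 R2 R3 R4 R5 R6 R7 R8
  have hA := present_iff_cons (r := ⟨w, u, u, i⟩) hw
  simp only at hA
  rw [hA] at key
  refine key.mono ?_ fun _ _ _ h => h.symm hc
  rintro a b k ⟨ha, hb, h⟩
  unfold PendantKey
  by_cases haw : a = w
  · subst haw
    right
    rcases h with ⟨rfl, rfl⟩ | ⟨hab, h⟩
    · simp
    · rw [hc] at h
      by_cases hbu : b = u
      · subst hbu
        have : k = 0 ∨ k = 1 := by omega
        simp [this]
      have := (hx b hb hbu (Ne.symm hab)).1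
      omega
  by_cases hbw : b = w
  · subst hbw
    right
    rcases h with ⟨rfl, rfl⟩ | ⟨hab, h⟩
    · simp
    · by_cases hbu : a = u
      · subst hbu
        have : k = 0 ∨ k = 1 := by omega
        simp [this]
      have := (hx a ha hbu hab).1
      omega
  by_cases hau : a = u ∧ b = u
  · obtain ⟨rfl, rfl⟩ := hau
    right; left
    exact ⟨by simpa using h, by simp⟩
  left
  refine ⟨⟨present_cons.2 ⟨ha, haw⟩, present_cons.2 ⟨hb, hbw⟩, h⟩, ?_⟩
  rintro ⟨-, ⟨rfl, rfl⟩ | ⟨rfl, rfl⟩⟩ <;> exact hau ⟨rfl, rfl⟩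

/-- If all vertices but one have been removed, a single triangle is a layout. -/
theorem LayoutAt.single {n : ℕ} {R : ℕ → ℕ → Prop} {l : List Removal} {c : ℕ → ℕ → ℕ}
    {T : ℕ → Fin 3 → ℝ × ℝ} {AP AR : ℕ → ℕ → ℕ → ℝ × ℝ}
    (hl : ∀ x, Present n l x ↔ x = n) (h0 : T n 0 = (0, 1)) (h1 : T n 1 = (1, 1))
    (h2 : T n 2 = (0, 0)) (hP : AP n n 0 = (0, 1)) (hQ : AR n n 0 = (1, 1))
    (hQ' : AR n n 1 = (0, 2)) : LayoutAt n R l c T AP AR := by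
  -- The triangle lies below the line of height `1` and the region above it; they share the segment
  -- from `(0, 1)` to `(1, 1)`.
  have hb : body (T n) ∩ region AP AR n n 0 ⊆ segment ℝ (AP n n 0) (AR n n 0) := by
    unfold body region thirdCorner
    rw [if_pos rfl, h0, h1, h2, hP, hQ, hQ']
    rintro ⟨x, y⟩ ⟨hx, hy⟩
    rw [mem_tri] at hx hy
    rw [mem_segment_coord]
    obtain ⟨a, b, c, ha, hb, hc, h, h', h''⟩ := hx
    obtain ⟨a', b', c', ha', hb', hc', h3, h4, h5⟩ := hy
    simp only at *
    refine ⟨b', hb', by linarith, by linarith, by linarith⟩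
  have hK : ∀ a b k, NeededKey n l c a b k → a = n ∧ b = n ∧ k = 0 := by
    rintro a b k ⟨ha, hb, h⟩
    rw [hl] at ha hb
    subst ha hb
    exact ⟨rfl, rfl, by simpa using h⟩
  constructor
  · intro x hx
    rw [hl] at hx
    rw [hx, h0, h1, h2]
    norm_num [area]
  · intro x y hx hy hxy; rw [hl] at hx hy; exact absurd (hx.trans hy.symm) hxy
  · intro x y hx hy hxy; rw [hl] at hx hy; exact absurd (hx.trans hy.symm) hxy
  · intro x y hx hy hxy; rw [hl] at hx hy; exact absurd (hx.trans hy.symm) hxy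
  · intro a b k h
    obtain ⟨rfl, rfl, rfl⟩ := hK _ _ _ h
    exact h
  · exact fun a b k h => h.1
  · intro a b k h
    obtain ⟨rfl, rfl, rfl⟩ := hK _ _ _ h
    rfl
  · intro a b k h
    obtain ⟨rfl, rfl, rfl⟩ := hK _ _ _ h
    unfold thirdCorner
    rw [if_pos rfl, hP, hQ, hQ']
    norm_num [area]
  · intro a b k h
    obtain ⟨rfl, rfl, rfl⟩ := hK _ _ _ h
    exact hb
  · intro a b k h
    obtain ⟨rfl, rfl, rfl⟩ := hK _ _ _ h
    refine ⟨0, ?_⟩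
    unfold triangleSide
    rw [hP, hQ, h0, show (0 : Fin 3) + 1 = 1 from rfl, h1]
  · intro a b k x h hx hxa
    obtain ⟨rfl, rfl, rfl⟩ := hK _ _ _ h
    rw [hl] at hx
    exact absurd hx hxa
  · intro a b k a' b' k' h h' hne
    obtain ⟨rfl, rfl, rfl⟩ := hK _ _ _ h
    obtain ⟨rfl, rfl, rfl⟩ := hK _ _ _ h'
    exact absurd ⟨rfl, Or.inl ⟨rfl, rfl⟩⟩ hne

theorem body_eq_convexHull (t : Fin 3 → ℝ × ℝ) : body t = convexHull ℝ (Set.range t) :=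
  (convexHull_range_eq_tri t).symm

theorem triangleSide_subset_body (t : Fin 3 → ℝ × ℝ) (i : Fin 3) : triangleSide t i ⊆ body t := by
  rw [body_eq_convexHull]
  exact (convex_convexHull ℝ _).segment_subset (subset_convexHull ℝ _ ⟨i, rfl⟩)
    (subset_convexHull ℝ _ ⟨i + 1, rfl⟩)

/-- A layout of all vertices is a touching triangles representation. -/
theorem Layout.isTouchingTriangles {n : ℕ} {G : SimpleGraph (Fin n)} {R : ℕ → ℕ → Prop}
    {A : ℕ → Prop} {K : ℕ → ℕ → ℕ → Prop} {T : ℕ → Fin 3 → ℝ × ℝ}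
    {AP AR : ℕ → ℕ → ℕ → ℝ × ℝ} (L : Layout R A K T AP AR) (hA : ∀ v : Fin n, A v)
    (hR : ∀ u v : Fin n, R u v ↔ G.Adj u v) : IsTouchingTriangles G fun v : Fin n => T v := by
  constructor
  · exact fun v => affineIndependent_of_area_ne_zero (L.area_ne v (hA v))
  · intro u v huv
    obtain ⟨a, b, h⟩ := L.thin u v (hA u) (hA v) (Fin.val_injective.ne huv)
    rw [Set.disjoint_iff_inter_eq_empty, ← interior_inter, ← body_eq_convexHull,
      ← body_eq_convexHull]
    exact interior_eq_empty_of_subset_segment h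
  · intro u v huv
    have hne := Fin.val_injective.ne huv
    rw [← hR]
    -- Triangles of non-adjacent vertices may touch, as at an additional edge, but by `apart` only
    -- in a single point.
    refine ⟨L.touch u v (hA u) (hA v) hne, ?_⟩
    rintro ⟨i, j, h⟩
    by_contra hn
    exact Set.not_subsingleton_iff.2 h ((L.apart u v (hA u) (hA v) hne hn).anti
      (Set.inter_subset_inter (triangleSide_subset_body _ i) (triangleSide_subset_body _ j)))
section

/-! ### Elimination states -/

/-- The vertices `x < n` that have not been removed. -/
def alive (n : ℕ) (l : List Removal) : Finset ℕ :=
  (Finset.range n).filter fun x => ∀ r ∈ l, r.vertex ≠ x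

theorem mem_alive {n : ℕ} {l : List Removal} {x : ℕ} :
    x ∈ alive n l ↔ x < n ∧ ∀ r ∈ l, r.vertex ≠ x := by
  simp [alive]

theorem mem_alive_cons {n : ℕ} {l : List Removal} {r : Removal} {x : ℕ} :
    x ∈ alive n (r :: l) ↔ x ∈ alive n l ∧ x ≠ r.vertex := by
  simp only [mem_alive, List.mem_cons, forall_eq_or_imp]
  tauto

/-- The neighbours of `x` that have not been removed. -/
def nbrs (n : ℕ) (l : List Removal) (edge : ℕ → ℕ → ℕ) (x : ℕ) : Finset ℕ :=
  (alive n l).filter fun y => edge x y ≠ 0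

theorem mem_nbrs {n : ℕ} {l : List Removal} {edge : ℕ → ℕ → ℕ} {x y : ℕ} :
    y ∈ nbrs n l edge x ↔ y ∈ alive n l ∧ edge x y ≠ 0 := by
  simp [nbrs]

/-- The vertex `w` has been removed as an ear of an edge that is still there and ends in `x`. -/
def EarOf (n : ℕ) (l : List Removal) (w x : ℕ) : Prop :=
  ∃ r ∈ l, r.vertex = w ∧ r.left ≠ r.right ∧ r.left ∈ alive n l ∧ r.right ∈ alive n l ∧
    (x = r.left ∨ x = r.right)

/-- The remaining graph with the ears on its edges. -/
def Kernel (n : ℕ) (l : List Removal) (edge : ℕ → ℕ → ℕ) (x y : ℕ) : Prop :=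
  (x ∈ alive n l ∧ y ∈ alive n l ∧ edge x y ≠ 0) ∨ EarOf n l x y ∨ EarOf n l y x

/-- The state of an elimination of the graph with the adjacency relation `R`: after the removals
`l`, `edge x y` is `0` if there is no edge, `1` if there is an additional edge, and `2` if there is
an edge of `R`, and `c x y` is the number of ears on the edge. -/
structure Elim (n : ℕ) (R : ℕ → ℕ → Prop) (l : List Removal) (edge c : ℕ → ℕ → ℕ) : Prop where
  history : History n R l c
  edge_symm : ∀ x y, edge x y = edge y x
  edge_self : ∀ x, edge x x = 0
  edge_lt : ∀ x y, edge x y ≠ 0 → x < n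
  real : ∀ x y, 1 < edge x y ↔ R x y
  edge_of_ear : ∀ x y, c x y ≠ 0 → edge x y ≠ 0
  ears : ∀ u ∈ alive n l, ∀ v ∈ alive n l, ∀ k < c u v, ∃ r ∈ l, r.slot = k ∧
    ((r.left = u ∧ r.right = v) ∨ (r.left = v ∧ r.right = u))
  tripodless : Tripodless (Kernel n l edge)

theorem Kernel.symm {n : ℕ} {l : List Removal} {edge : ℕ → ℕ → ℕ}
    (h : ∀ x y, edge x y = edge y x) (x y : ℕ) (hK : Kernel n l edge x y) :
    Kernel n l edge y x := by
  unfold Kernel at *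
  rw [h y x]
  tauto

/-- Two vertices of a tripodless graph have at most two common neighbours. -/
theorem Tripodless.common {E : ℕ → ℕ → Prop} (hE : Tripodless E) (hs : ∀ x y, E x y → E y x)
    {u v a b c : ℕ} (huv : u ≠ v) (hab : a ≠ b) (hbc : b ≠ c) (hca : c ≠ a)
    (ha : E u a ∧ E v a) (hb : E u b ∧ E v b) (hc : E u c ∧ E v c)
    (hua : u ≠ a ∧ v ≠ a) (hub : u ≠ b ∧ v ≠ b) (huc : u ≠ c ∧ v ≠ c) : False := by
  -- Three common neighbours form a tripod at `u`, since the other vertex `v` joins any two of them.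
  have key : ∀ x y z, E v x → E v y → u ≠ x → u ≠ y → v ≠ z → x ≠ z → y ≠ z →
      Avoiding E u z x y := by
    intro x y z hx hy h1 h2 h3 h4 h5
    refine (Relation.ReflTransGen.single ?_).tail (b := v) ?_
    · exact ⟨hs _ _ hx, h1.symm, h4, huv.symm, h3⟩
    · exact ⟨hy, huv.symm, h3, h2.symm, h5⟩
  exact hE u a b c ha.1 hb.1 hc.1 hab hbc hca
    (key a b c ha.2 hb.2 hua.1 hub.1 huc.2 hca.symm hbc)
    (key b c a hb.2 hc.2 hub.1 huc.1 hua.2 hab.symm hca)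
    (key c a b hc.2 ha.2 huc.1 hua.1 hub.2 hbc.symm hab)

theorem History.vertex_lt {n : ℕ} {R : ℕ → ℕ → Prop} {l : List Removal} {c : ℕ → ℕ → ℕ}
    (h : History n R l c) : ∀ r ∈ l, r.vertex < n := by
  induction h with
  | nil => simp
  | pendant _ hw _ _ _ _ _ ih => simpa using ⟨hw, ih⟩
  | ear _ hw _ _ _ _ _ _ _ _ _ _ ih => simpa using ⟨hw, ih⟩

/-- Only vertices below `n` are removed, so the root is always present; it is not counted by
`alive`. -/
theorem History.present_iff {n : ℕ} {R : ℕ → ℕ → Prop} {l : List Removal} {c : ℕ → ℕ → ℕ}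
    (h : History n R l c) {x : ℕ} : Present n l x ↔ x ∈ alive n l ∨ x = n := by
  rw [mem_alive]
  constructor
  · rintro ⟨h1, h2⟩
    rcases h1.lt_or_eq with h3 | h3
    · exact Or.inl ⟨h3, h2⟩
    · exact Or.inr h3
  · rintro (⟨h1, h2⟩ | rfl)
    · exact ⟨h1.le, h2⟩
    · exact ⟨le_rfl, fun r hr => (h.vertex_lt r hr).ne⟩

theorem History.nodup {n : ℕ} {R : ℕ → ℕ → Prop} {l : List Removal} {c : ℕ → ℕ → ℕ}
    (h : History n R l c) : (l.map Removal.vertex).Nodup := by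
  induction h with
  | nil => simp
  | pendant _ _ hp _ _ _ _ ih =>
    rw [List.map_cons, List.nodup_cons]
    exact ⟨fun hm => by obtain ⟨r, hr, e⟩ := List.mem_map.1 hm; exact hp.2 r hr e, ih⟩
  | ear _ _ hp _ _ _ _ _ _ _ _ _ ih =>
    rw [List.map_cons, List.nodup_cons]
    exact ⟨fun hm => by obtain ⟨r, hr, e⟩ := List.mem_map.1 hm; exact hp.2 r hr e, ih⟩

variable {n : ℕ} {R : ℕ → ℕ → Prop} {l : List Removal} {edge c : ℕ → ℕ → ℕ}

theorem Elim.initial (hs : ∀ x y, edge x y = edge y x) (h0 : ∀ x, edge x x = 0)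
    (hlt : ∀ x y, edge x y ≠ 0 → x < n) (hR : ∀ x y, edge x y ≠ 0 ↔ R x y)
    (h2 : ∀ x y, edge x y ≠ 0 → edge x y = 2) (hT : Tripodless R) :
    Elim n R [] edge fun _ _ => 0 where
  history := .nil
  edge_symm := hs
  edge_self := h0
  edge_lt := hlt
  real x y := by
    rw [← hR]
    have := h2 x y
    omega
  edge_of_ear := by simp
  ears := by simp
  tripodless := hT.mono fun x y h => by
    simp only [Kernel, EarOf, List.not_mem_nil, false_and, exists_false, or_false] at h
    exact (hR x y).1 h.2.2

/-- The ears on an edge, as vertices of the kernel. -/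
theorem Elim.ear_vertex (h : Elim n R l edge c) {u v k : ℕ} (hu : u ∈ alive n l)
    (hv : v ∈ alive n l) (hk : k < c u v) : ∃ r ∈ l, r.slot = k ∧ r.vertex ∉ alive n l ∧
      Kernel n l edge u r.vertex ∧ Kernel n l edge v r.vertex := by
  have huv : u ≠ v := by
    rintro rfl
    exact h.edge_of_ear u u (by omega) (h.edge_self u)
  obtain ⟨r, hr, hs, he⟩ := h.ears u hu v hv k hk
  refine ⟨r, hr, hs, fun hm => (mem_alive.1 hm).2 r hr rfl, Or.inr (Or.inr ⟨r, hr, rfl, ?_⟩),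
    Or.inr (Or.inr ⟨r, hr, rfl, ?_⟩)⟩ <;>
  · rcases he with ⟨h1, h2⟩ | ⟨h1, h2⟩ <;> rw [h1, h2] <;> simp [hu, hv, huv, huv.symm]

theorem History.vertex_injOn (h : History n R l c) {r s : Removal} (hr : r ∈ l) (hs : s ∈ l)
    (e : r.vertex = s.vertex) : r = s :=
  List.inj_on_of_nodup_map h.nodup hr hs e

/-- Three ears on an edge would be three common neighbours of its ends in the kernel. -/
theorem Elim.count_le_two (h : Elim n R l edge c) {u v : ℕ} (hu : u ∈ alive n l)
    (hv : v ∈ alive n l) : c u v ≤ 2 := by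
  by_contra hc
  have huv : u ≠ v := by
    rintro rfl
    exact h.edge_of_ear u u (by omega) (h.edge_self u)
  obtain ⟨r₀, _, e₀, a₀, p₀, q₀⟩ := h.ear_vertex (k := 0) hu hv (by omega)
  obtain ⟨r₁, _, e₁, a₁, p₁, q₁⟩ := h.ear_vertex (k := 1) hu hv (by omega)
  obtain ⟨r₂, _, e₂, a₂, p₂, q₂⟩ := h.ear_vertex (k := 2) hu hv (by omega)
  have ne : ∀ {r s : Removal}, r ∈ l → s ∈ l → r.slot ≠ s.slot → r.vertex ≠ s.vertex :=
    fun hr hs hne e => hne (congrArg Removal.slot (h.history.vertex_injOn hr hs e))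
  refine h.tripodless.common (Kernel.symm h.edge_symm) huv
    (ne (r := r₀) (s := r₁) ‹_› ‹_› (by omega)) (ne (r := r₁) (s := r₂) ‹_› ‹_› (by omega))
    (ne (r := r₂) (s := r₀) ‹_› ‹_› (by omega)) ⟨p₀, q₀⟩ ⟨p₁, q₁⟩ ⟨p₂, q₂⟩ ?_ ?_ ?_ <;>
  constructor <;> rintro rfl <;> contradiction

/-- Two ears and the common neighbour `w` would be three common neighbours. So a vertex about to
become an ear always finds one of the two places on its edge free. -/
theorem Elim.count_lt_two (h : Elim n R l edge c) {u v w : ℕ} (hu : u ∈ alive n l)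
    (hv : v ∈ alive n l) (hw : w ∈ alive n l) (huv : u ≠ v) (hwu : edge w u ≠ 0)
    (hwv : edge w v ≠ 0) : c u v ≤ 1 := by
  by_contra hc
  obtain ⟨r₀, _, e₀, a₀, p₀, q₀⟩ := h.ear_vertex (k := 0) hu hv (by omega)
  obtain ⟨r₁, _, e₁, a₁, p₁, q₁⟩ := h.ear_vertex (k := 1) hu hv (by omega)
  have ne : ∀ {r s : Removal}, r ∈ l → s ∈ l → r.slot ≠ s.slot → r.vertex ≠ s.vertex :=
    fun hr hs hne e => hne (congrArg Removal.slot (h.history.vertex_injOn hr hs e))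
  refine h.tripodless.common (Kernel.symm h.edge_symm) huv (c := w)
    (ne (r := r₀) (s := r₁) ‹_› ‹_› (by omega)) (fun e => a₁ (e ▸ hw)) (fun e => a₀ (e ▸ hw))
    ⟨p₀, q₀⟩ ⟨p₁, q₁⟩ ⟨Or.inl ⟨hu, hw, by rwa [h.edge_symm]⟩, Or.inl ⟨hv, hw, by rwa [h.edge_symm]⟩⟩
    ?_ ?_ ⟨?_, ?_⟩
  · constructor <;> rintro rfl <;> contradiction
  · constructor <;> rintro rfl <;> contradiction
  · rintro rfl; exact hwu (h.edge_self _)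
  · rintro rfl; exact hwv (h.edge_self _)

/-- A vertex that can be removed. -/
def Removable (n : ℕ) (l : List Removal) (edge c : ℕ → ℕ → ℕ) (w : ℕ) : Prop :=
  w ∈ alive n l ∧ ((nbrs n l edge w).card ≤ 1 ∨
    ((nbrs n l edge w).card = 2 ∧ ∀ y ∈ nbrs n l edge w, c y w ≤ 1))

/-- Heavy edges are those with two ears; these ears are the two outer vertices that the graph lemma
asks for in the kernel. -/
theorem Elim.exists_removable (h : Elim n R l edge c) (hA : (alive n l).Nonempty) :
    ∃ w, Removable n l edge c w := by
  obtain ⟨w, hw, h'⟩ := _root_.exists_removable (E := fun x y => edge x y ≠ 0)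
    (K := Kernel n l edge) (H := fun x y => 2 ≤ c x y) (A := alive n l) hA
    (fun x y hxy => by rwa [h.edge_symm]) (fun x hx => hx (h.edge_self x)) h.tripodless
    (Kernel.symm h.edge_symm) (fun x hx y hy e => Or.inl ⟨hx, hy, e⟩) (by
      intro x hx y hy hc
      obtain ⟨r₀, h₀, e₀, a₀, p₀, q₀⟩ := h.ear_vertex (k := 0) hx hy (by omega)
      obtain ⟨r₁, h₁, e₁, a₁, p₁, q₁⟩ := h.ear_vertex (k := 1) hx hy (by omega)
      refine ⟨r₀.vertex, r₁.vertex, fun e => ?_, a₀, a₁, p₀, q₀, p₁, q₁⟩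
      have := congrArg Removal.slot (h.history.vertex_injOn h₀ h₁ e)
      omega)
  refine ⟨w, hw, h'.imp (fun h1 => ?_) fun h1 => ⟨?_, fun y hy => ?_⟩⟩
  · exact h1
  · exact h1.1
  · rw [mem_nbrs] at hy
    have := h1.2 y hy.1 hy.2
    rw [h.history.symm y w]
    omega

theorem EarOf.of_pendant {w u i a b : ℕ} (h : EarOf n (⟨w, u, u, i⟩ :: l) a b) :
    EarOf n l a b := by
  obtain ⟨r, hr, h1, h2, h3, h4, h5⟩ := h
  rcases List.mem_cons.1 hr with rfl | hr
  · exact absurd rfl h2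
  · exact ⟨r, hr, h1, h2, (mem_alive_cons.1 h3).1, (mem_alive_cons.1 h4).1, h5⟩

/-- Remove a vertex with at most one neighbour. -/
theorem Elim.pendant (h : Elim n R l edge c) {w u : ℕ} (hw : w ∈ alive n l)
    (hu : u ∈ alive n l ∨ u = n) (huw : u ≠ w) (hN : nbrs n l edge w ⊆ {u}) :
    Elim n R (⟨w, u, u, 0⟩ :: l) edge c where
  history := by
    have hno : ∀ x, Present n l x → x ≠ u → edge x w = 0 := by
      intro x hx hxu
      by_contra hne
      rcases h.history.present_iff.1 hx with hx | rfl
      · exact hxu (Finset.mem_singleton.1 (hN (mem_nbrs.2 ⟨hx, by rwa [h.edge_symm]⟩)))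
      · exact (h.edge_lt _ _ hne).false
    refine .pendant h.history (mem_alive.1 hw).1 (h.history.present_iff.2 (Or.inl hw))
      (h.history.present_iff.2 hu) huw ?_ fun x hx hxu _ => ⟨?_, fun hR => ?_⟩
    · rcases hu with hu | hu
      · exact h.count_le_two hu hw
      · by_contra hc
        have := h.edge_lt u w (h.edge_of_ear u w (by omega))
        omega
    · by_contra hc
      exact h.edge_of_ear _ _ hc (hno x hx hxu)
    · have := (h.real x w).2 hR
      have := hno x hx hxu
      omega
  edge_symm := h.edge_symm
  edge_self := h.edge_self
  edge_lt := h.edge_lt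
  real := h.real
  edge_of_ear := h.edge_of_ear
  ears x hx y hy k hk := by
    obtain ⟨r, hr, h'⟩ := h.ears x (mem_alive_cons.1 hx).1 y (mem_alive_cons.1 hy).1 k hk
    exact ⟨r, List.mem_cons_of_mem _ hr, h'⟩
  tripodless := h.tripodless.mono fun x y hxy => by
    rcases hxy with ⟨h1, h2, h3⟩ | hxy | hxy
    · exact Or.inl ⟨(mem_alive_cons.1 h1).1, (mem_alive_cons.1 h2).1, h3⟩
    · exact Or.inr (Or.inl hxy.of_pendant)
    · exact Or.inr (Or.inr hxy.of_pendant)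

/-- Add the edge `u v` if there is no such edge yet. -/
def fillEdge (edge : ℕ → ℕ → ℕ) (u v a b : ℕ) : ℕ :=
  if ((a = u ∧ b = v) ∨ (a = v ∧ b = u)) ∧ edge a b = 0 then 1 else edge a b

theorem EarOf.of_ear {w u v i a b : ℕ} (h : EarOf n (⟨w, u, v, i⟩ :: l) a b) :
    (a = w ∧ (b = u ∨ b = v)) ∨ (EarOf n l a b ∧ b ≠ w) := by
  obtain ⟨r, hr, h1, h2, h3, h4, h5⟩ := h
  rcases List.mem_cons.1 hr with rfl | hr
  · exact Or.inl ⟨h1.symm, h5⟩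
  · refine Or.inr ⟨⟨r, hr, h1, h2, (mem_alive_cons.1 h3).1, (mem_alive_cons.1 h4).1, h5⟩, ?_⟩
    rcases h5 with rfl | rfl
    · exact (mem_alive_cons.1 h3).2
    · exact (mem_alive_cons.1 h4).2

theorem EarOf.notMem {a b : ℕ} (h : EarOf n l a b) : a ∉ alive n l := by
  obtain ⟨r, hr, rfl, -⟩ := h
  exact fun hm => (mem_alive.1 hm).2 r hr rfl

/-- Remove a vertex with two neighbours. -/
theorem Elim.ear (h : Elim n R l edge c) {w u v : ℕ} (hw : w ∈ alive n l)
    (huv : u ≠ v) (hN : nbrs n l edge w = {u, v}) (cu : c u w ≤ 1) (cv : c v w ≤ 1) :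
    Elim n R (⟨w, u, v, c u v⟩ :: l) (fillEdge edge u v) (raise c u v) := by
  have hu := mem_nbrs.1 (show u ∈ nbrs n l edge w by simp [hN])
  have hv := mem_nbrs.1 (show v ∈ nbrs n l edge w by simp [hN])
  have huw : u ≠ w := by rintro rfl; exact hu.2 (h.edge_self _)
  have hvw : v ≠ w := by rintro rfl; exact hv.2 (h.edge_self _)
  have hcsymm := h.history.symm
  have hfill : ∀ x y, edge x y ≠ 0 → fillEdge edge u v x y = edge x y := by
    intro x y hxy
    unfold fillEdge; rw [if_neg (fun h => hxy h.2)]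
  have hfill' : ∀ x y, fillEdge edge u v x y ≠ 0 →
      edge x y ≠ 0 ∨ (x = u ∧ y = v) ∨ (x = v ∧ y = u) := by
    intro x y hxy
    unfold fillEdge at hxy
    split_ifs at hxy with h' <;> tauto
  constructor
  · have hno : ∀ x, Present n l x → x ≠ u → x ≠ v → edge x w = 0 := by
      intro x hx hxu hxv
      by_contra hne
      rcases h.history.present_iff.1 hx with hx | rfl
      · have : x ∈ nbrs n l edge w := mem_nbrs.2 ⟨hx, by rwa [h.edge_symm]⟩
        rw [hN] at this
        simp [hxu, hxv] at this
      · exact (h.edge_lt _ _ hne).false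
    refine .ear h.history (mem_alive.1 hw).1 (h.history.present_iff.2 (Or.inl hw))
      (h.history.present_iff.2 (Or.inl hu.1)) (h.history.present_iff.2 (Or.inl hv.1)) huw hvw huv
      cu cv (h.count_lt_two hu.1 hv.1 hw huv hu.2 hv.2) fun x hx hxu hxv _ => ⟨?_, fun hR => ?_⟩
    · by_contra hc
      exact h.edge_of_ear _ _ hc (hno x hx hxu hxv)
    · have := (h.real x w).2 hR
      have := hno x hx hxu hxv
      omega
  · intro x y
    unfold fillEdge
    rw [h.edge_symm x y]
    congr 1
    exact propext (by tauto)
  · intro x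
    unfold fillEdge
    rw [if_neg, h.edge_self]
    rintro ⟨⟨rfl, rfl⟩ | ⟨rfl, rfl⟩, -⟩ <;> exact huv rfl
  · intro x y hxy
    rcases hfill' x y hxy with h' | ⟨rfl, rfl⟩ | ⟨rfl, rfl⟩
    · exact h.edge_lt x y h'
    · exact (mem_alive.1 hu.1).1
    · exact (mem_alive.1 hv.1).1
  · intro x y
    rw [← h.real]
    unfold fillEdge
    split_ifs with h'
    · omega
    · rfl
  · intro x y hxy
    unfold raise at hxy
    unfold fillEdge
    split_ifs at hxy with h1
    · split_ifs with h2
      · omega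
      · tauto
    · rw [if_neg (fun h => h1 h.1)]
      exact h.edge_of_ear x y hxy
  · intro x hx y hy k hk
    have hold : k < c x y → ∃ r ∈ ⟨w, u, v, c u v⟩ :: l, r.slot = k ∧
        ((r.left = x ∧ r.right = y) ∨ (r.left = y ∧ r.right = x)) := by
      intro hk
      obtain ⟨r, hr, h'⟩ := h.ears x (mem_alive_cons.1 hx).1 y (mem_alive_cons.1 hy).1 k hk
      exact ⟨r, List.mem_cons_of_mem _ hr, h'⟩
    unfold raise at hk
    split_ifs at hk with h1
    · rcases Nat.lt_succ_iff_lt_or_eq.1 hk with hk | hk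
      · exact hold hk
      · refine ⟨⟨w, u, v, c u v⟩, List.mem_cons_self, ?_, ?_⟩
        · rw [hk]
          rcases h1 with ⟨rfl, rfl⟩ | ⟨rfl, rfl⟩
          · rfl
          · exact hcsymm _ _
        · rcases h1 with ⟨rfl, rfl⟩ | ⟨rfl, rfl⟩
          · exact Or.inl ⟨rfl, rfl⟩
          · exact Or.inr ⟨rfl, rfl⟩
    · exact hold hk
  -- The ears on the edges at `w` are forgotten first, since those edges disappear. Then `w` has
  -- only the neighbours `u` and `v`, so `add_edge` allows the edge `u v`, and `w` itself stays in
  -- the kernel as an ear on it.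
  · have hK : Tripodless fun x y => Kernel n l edge x y ∧ (x = w → y = u ∨ y = v) ∧
        (y = w → x = u ∨ x = v) := h.tripodless.mono fun x y h => h.1
    have hwu : Kernel n l edge w u := Or.inl ⟨hw, hu.1, hu.2⟩
    have hwv : Kernel n l edge w v := Or.inl ⟨hw, hv.1, hv.2⟩
    have hsymm := Kernel.symm (n := n) (l := l) h.edge_symm
    have := hK.add_edge (w := w) (u := u) (v := v)
      (fun x y ⟨h1, h2, h3⟩ => ⟨hsymm _ _ h1, h3, h2⟩)
      ⟨hwu, fun _ => Or.inl rfl, fun e => absurd e huw⟩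
      ⟨hwv, fun _ => Or.inr rfl, fun e => absurd e hvw⟩ huw hvw huv
      (fun x hx => hx.2.1 rfl)
    refine this.mono ?_
    have hear : ∀ x y, EarOf n (⟨w, u, v, c u v⟩ :: l) x y → Kernel n l edge x y ∧
        (x = w → y = u ∨ y = v) ∧ (y = w → x = u ∨ x = v) := by
      intro x y hxy
      rcases hxy.of_ear with ⟨rfl, rfl | rfl⟩ | ⟨h1, h2⟩
      · exact ⟨hwu, fun _ => Or.inl rfl, fun e => absurd e huw⟩
      · exact ⟨hwv, fun _ => Or.inr rfl, fun e => absurd e hvw⟩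
      · refine ⟨Or.inr (Or.inl h1), ?_, fun e => absurd e h2⟩
        rintro rfl
        exact absurd hw h1.notMem
    rintro x y (⟨h1, h2, h3⟩ | hxy | hxy)
    · rw [mem_alive_cons] at h1 h2
      rcases hfill' x y h3 with h' | h' | h'
      · exact Or.inl ⟨Or.inl ⟨h1.1, h2.1, h'⟩, fun e => absurd e h1.2, fun e => absurd e h2.2⟩
      · exact Or.inr (Or.inl h')
      · exact Or.inr (Or.inr h')
    · exact Or.inl (hear x y hxy)
    · obtain ⟨h1, h2, h3⟩ := hear y x hxy
      exact Or.inl ⟨hsymm _ _ h1, h3, h2⟩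

end

namespace RealRAM

/-! ### Running programs -/

/-- Run commands one after the other. -/
def Cmd.block : List Cmd → Cmd
  | [] => .skip
  | c :: cs => .seq c (.block cs)

/-- The program contains no loops. -/
def Cmd.LoopFree : Cmd → Prop
  | .seq c d => c.LoopFree ∧ d.LoopFree
  | .ite _ c d => c.LoopFree ∧ d.LoopFree
  | .loop _ _ => False
  | _ => True

open Classical in
/-- The final state of a program without loops. -/
noncomputable def Cmd.step : Cmd → State → State
  | .skip, σ => σ
  | .nset x e, σ => σ.nset x (e.eval σ)
  | .nput a i e, σ => σ.nput a (i.eval σ) (e.eval σ)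
  | .rset x e, σ => σ.rset x (e.eval σ)
  | .rput a i e, σ => σ.rput a (i.eval σ) (e.eval σ)
  | .seq c d, σ => d.step (c.step σ)
  | .ite b c d, σ => if b.Holds σ then c.step σ else d.step σ
  | .loop _ _, σ => σ

/-- A bound on the running time of a program without loops. -/
def Cmd.bound : Cmd → ℕ
  | .skip => 1
  | .nset _ e => e.cost + 1
  | .nput _ i e => i.cost + e.cost + 1
  | .rset _ e => e.cost + 1
  | .rput _ i e => i.cost + e.cost + 1
  | .seq c d => c.bound + d.bound
  | .ite b c d => b.cost + (c.bound + d.bound)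
  | .loop _ _ => 0

/-- The program halts after at most `B` operations in a state with the property `Q`. -/
def Exec (c : Cmd) (σ : State) (B : ℕ) (Q : State → Prop) : Prop :=
  ∃ t σ', Run c σ t σ' ∧ t ≤ B ∧ Q σ'

theorem Cmd.LoopFree.run {c : Cmd} (h : c.LoopFree) (σ : State) :
    ∃ t, Run c σ t (c.step σ) ∧ t ≤ c.bound := by
  induction c generalizing σ with
  | skip => exact ⟨_, .skip σ, le_rfl⟩
  | nset x e => exact ⟨_, .nset σ x e, le_rfl⟩
  | nput a i e => exact ⟨_, .nput σ a i e, le_rfl⟩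
  | rset x e => exact ⟨_, .rset σ x e, le_rfl⟩
  | rput a i e => exact ⟨_, .rput σ a i e, le_rfl⟩
  | seq c d hc hd =>
    obtain ⟨s, h₁, h₂⟩ := hc h.1 σ
    obtain ⟨t, h₃, h₄⟩ := hd h.2 (c.step σ)
    exact ⟨_, .seq h₁ h₃, Nat.add_le_add h₂ h₄⟩
  | ite b c d hc hd =>
    by_cases hb : b.Holds σ
    · obtain ⟨s, h₁, h₂⟩ := hc h.1 σ
      refine ⟨_, .ite_true hb (by simpa only [Cmd.step, if_pos hb] using h₁), ?_⟩
      simp only [Cmd.bound]; omega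
    · obtain ⟨s, h₁, h₂⟩ := hd h.2 σ
      refine ⟨_, .ite_false hb (by simpa only [Cmd.step, if_neg hb] using h₁), ?_⟩
      simp only [Cmd.bound]; omega
  | loop b c => exact h.elim

theorem Exec.of_step {c : Cmd} (h : c.LoopFree) {σ : State} {Q : State → Prop}
    (hQ : Q (c.step σ)) : Exec c σ c.bound Q := by
  obtain ⟨t, h₁, h₂⟩ := h.run σ
  exact ⟨t, _, h₁, h₂, hQ⟩

theorem Exec.seq {c d : Cmd} {σ : State} {B B' : ℕ} {P Q : State → Prop} (hc : Exec c σ B P)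
    (hd : ∀ σ', P σ' → Exec d σ' B' Q) : Exec (.seq c d) σ (B + B') Q := by
  obtain ⟨s, σ₁, h₁, h₂, h₃⟩ := hc
  obtain ⟨t, σ₂, h₄, h₅, h₆⟩ := hd σ₁ h₃
  exact ⟨_, σ₂, .seq h₁ h₄, Nat.add_le_add h₂ h₅, h₆⟩

theorem Exec.mono {c : Cmd} {σ : State} {B B' : ℕ} {P Q : State → Prop} (h : Exec c σ B P)
    (hB : B ≤ B') (hPQ : ∀ σ', P σ' → Q σ') : Exec c σ B' Q := by
  obtain ⟨t, σ', h₁, h₂, h₃⟩ := h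
  exact ⟨t, σ', h₁, h₂.trans hB, hPQ _ h₃⟩

/-- A loop with the invariant `I` and the decreasing quantity `μ`. -/
theorem Exec.loop {b : BExp} {c : Cmd} (hc : c.LoopFree) {I : State → Prop} {μ : State → ℕ}
    (h : ∀ σ, I σ → b.Holds σ → I (c.step σ) ∧ μ (c.step σ) < μ σ) {σ : State} (hσ : I σ) :
    Exec (.loop b c) σ ((b.cost + c.bound) * (μ σ + 1)) fun σ' => I σ' ∧ ¬ b.Holds σ' := by
  induction hk : μ σ using Nat.strong_induction_on generalizing σ with
  | _ k ih =>
    by_cases hb : b.Holds σ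
    · obtain ⟨h₁, h₂⟩ := h σ hσ hb
      obtain ⟨s, r₁, hs⟩ := hc.run σ
      obtain ⟨t, σ', r₂, ht, hQ⟩ := ih _ (hk ▸ h₂) h₁ rfl
      refine ⟨_, σ', .loop_true hb r₁ r₂, ?_, hQ⟩
      calc b.cost + s + t ≤ (b.cost + c.bound) + (b.cost + c.bound) * (μ (c.step σ) + 1) := by omega
        _ = (b.cost + c.bound) * (μ (c.step σ) + 1 + 1) := by ring
        _ ≤ _ := Nat.mul_le_mul_left _ (by omega)
    · refine ⟨_, σ, .loop_false hb, ?_, hσ, hb⟩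
      nlinarith [Nat.zero_le ((b.cost + c.bound) * k)]

section simp_lemmas

variable (σ : State) (x y a b i j k : ℕ) (r : ℝ)

theorem State.nset_nvar : (σ.nset x k).nvar y = if y = x then k else σ.nvar y := by
  simp [State.nset, Function.update_apply]

theorem State.nset_narr : (σ.nset x k).narr = σ.narr := rfl
theorem State.nset_rvar : (σ.nset x k).rvar = σ.rvar := rfl
theorem State.nset_rarr : (σ.nset x k).rarr = σ.rarr := rfl

theorem State.nput_narr : (σ.nput a i k).narr b j = if b = a ∧ j = i then k else σ.narr b j := by
  by_cases h : b = a
  · subst h; simp [State.nput, Function.update_apply]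
  · simp [State.nput, h]

theorem State.nput_nvar : (σ.nput a i k).nvar = σ.nvar := rfl
theorem State.nput_rvar : (σ.nput a i k).rvar = σ.rvar := rfl
theorem State.nput_rarr : (σ.nput a i k).rarr = σ.rarr := rfl

theorem State.rset_rvar : (σ.rset x r).rvar y = if y = x then r else σ.rvar y := by
  simp [State.rset, Function.update_apply]

theorem State.rset_narr : (σ.rset x r).narr = σ.narr := rfl
theorem State.rset_nvar : (σ.rset x r).nvar = σ.nvar := rfl
theorem State.rset_rarr : (σ.rset x r).rarr = σ.rarr := rfl

theorem State.rput_rarr : (σ.rput a i r).rarr b j = if b = a ∧ j = i then r else σ.rarr b j := by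
  by_cases h : b = a
  · subst h; simp [State.rput, Function.update_apply]
  · simp [State.rput, h]

theorem State.rput_nvar : (σ.rput a i r).nvar = σ.nvar := rfl
theorem State.rput_rvar : (σ.rput a i r).rvar = σ.rvar := rfl
theorem State.rput_narr : (σ.rput a i r).narr = σ.narr := rfl

end simp_lemmas

attribute [simp] State.nset_nvar State.nset_narr State.nset_rvar State.nset_rarr State.nput_narr
  State.nput_nvar State.nput_rvar State.nput_rarr State.rset_rvar State.rset_narr State.rset_nvar
  State.rset_rarr State.rput_rarr State.rput_nvar State.rput_rvar State.rput_narr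
  Cmd.step Cmd.block Cmd.LoopFree NExp.eval RExp.eval BExp.Holds

/-! ### Tables -/

/-- Tables of multiples of `n + 1`, squares, square roots, and halves. -/
structure Tables (n : ℕ) (σ : State) : Prop where
  size : σ.nvar 0 = n
  row : ∀ x ≤ n, σ.narr 2 x = x * (n + 1)
  sq : ∀ x ≤ 2 * n, σ.narr 3 x = x * x
  rt : ∀ x ≤ 2 * n, σ.narr 4 (x * x) = x
  half : ∀ x ≤ n, σ.narr 5 (x + x) = x

/-- Compute the tables, and put all vertices on the stack. -/
def tablesStep : Cmd := .block
  [.nput 2 (.var 3) (.var 5), .nput 3 (.var 3) (.var 4), .nput 4 (.var 4) (.var 3),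
   .nput 5 (.add (.var 3) (.var 3)) (.var 3), .nput 12 (.var 3) (.var 3),
   .nset 4 (.add (.var 4) (.add (.var 3) (.add (.var 3) (.const 1)))),
   .nset 5 (.add (.var 5) (.add (.var 0) (.const 1))),
   .nset 3 (.add (.var 3) (.const 1))]

/-- The tables reach up to `2 * n` because sums of two vertices will be squared. -/
def tablesLoop : Cmd := .loop (.nlt (.var 3) (.add (.var 0) (.add (.var 0) (.const 1)))) tablesStep

/-- The root is marked as removed, so that it is skipped whenever it is taken from the stack. The
height `n` leaves exactly the vertices below `n` on the stack. -/
def tablesInit : Cmd := .block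
  [.nset 1 (.var 0), .nput 11 (.var 0) (.const 1), .nset 3 (.const 0), .nset 4 (.const 0)]

/-- The invariant while the tables are computed, starting from `σ₀`. -/
structure TablesPart (n : ℕ) (σ₀ : State) (σ : State) : Prop where
  size : σ.nvar 0 = n
  row : ∀ x < σ.nvar 3, σ.narr 2 x = x * (n + 1)
  sq : ∀ x < σ.nvar 3, σ.narr 3 x = x * x
  rt : ∀ x < σ.nvar 3, σ.narr 4 (x * x) = x
  half : ∀ x < σ.nvar 3, σ.narr 5 (x + x) = x
  stack : ∀ x < σ.nvar 3, σ.narr 12 x = x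
  var4 : σ.nvar 4 = σ.nvar 3 * σ.nvar 3
  var5 : σ.nvar 5 = σ.nvar 3 * (n + 1)
  le : σ.nvar 3 ≤ 2 * n + 1
  var2 : σ.nvar 2 = σ₀.nvar 2
  other : ∀ a, a ≠ 2 → a ≠ 3 → a ≠ 4 → a ≠ 5 → a ≠ 12 → σ.narr a = σ₀.narr a

/-- Natural numbers cannot be multiplied by the machine: squares arise by adding `2 * x + 1`,
multiples of `n + 1` by adding `n + 1`. Roots and halves are the inverse tables. -/
theorem TablesPart.step {n : ℕ} {σ₀ σ : State} (h : TablesPart n σ₀ σ)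
    (hlt : σ.nvar 3 < 2 * n + 1) :
    TablesPart n σ₀ (tablesStep.step σ) := by
  obtain ⟨h0, h1, h2, h3, h4, h5, h6, h7, h8, h9, h10⟩ := h
  constructor
  · simp [tablesStep, h0]
  · intro x hx
    simp [tablesStep] at hx ⊢
    split_ifs with e
    · rw [h7, e]
    · exact h1 x (by omega)
  · intro x hx
    simp [tablesStep] at hx ⊢
    split_ifs with e
    · rw [h6, e]
    · exact h2 x (by omega)
  · intro x hx
    simp [tablesStep] at hx ⊢
    rw [h6]
    -- Roots are stored at squares only, and distinct numbers have distinct squares, so earlier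
    -- entries survive.
    split_ifs with e
    · exact (Nat.mul_self_inj.1 e).symm
    · exact h3 x (by grind)
  · intro x hx
    simp [tablesStep] at hx ⊢
    split_ifs with e
    · omega
    · exact h4 x (by omega)
  · intro x hx
    simp [tablesStep] at hx ⊢
    split_ifs with e
    · exact e.symm
    · exact h5 x (by omega)
  · simp [tablesStep, h6]; ring
  · simp [tablesStep, h7, h0]; ring
  · simp [tablesStep]; omega
  · simp [tablesStep, h9]
  · intro a a2 a3 a4 a5 a12
    rw [← h10 a a2 a3 a4 a5 a12]
    funext i
    simp [tablesStep, a2, a3, a4, a5, a12]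

theorem exec_tables : ∃ C, ∀ (n : ℕ) (σ₀ : State), σ₀.nvar 0 = n → σ₀.nvar 3 = 0 → σ₀.nvar 4 = 0 →
    σ₀.nvar 5 = 0 → Exec (.seq tablesLoop tablesInit) σ₀ (C * (n + 1)) fun σ => Tables n σ ∧
      (∀ x ≤ n, σ.narr 12 x = x) ∧ σ.nvar 1 = n ∧ σ.nvar 2 = σ₀.nvar 2 ∧ σ.nvar 3 = 0 ∧
      σ.nvar 4 = 0 ∧ (∀ x, σ.narr 11 x = if x = n then 1 else σ₀.narr 11 x) ∧
      ∀ a, a ≠ 2 → a ≠ 3 → a ≠ 4 → a ≠ 5 → a ≠ 12 → a ≠ 11 → σ.narr a = σ₀.narr a := by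
  refine ⟨(BExp.cost (.nlt (.var 3) (.add (.var 0) (.add (.var 0) (.const 1)))) +
    tablesStep.bound) * 2 + tablesInit.bound, fun n σ₀ h0 h3 h4 h5 => ?_⟩
  have h := Exec.loop (b := .nlt (.var 3) (.add (.var 0) (.add (.var 0) (.const 1))))
    (c := tablesStep) (by simp [tablesStep]) (I := TablesPart n σ₀)
    (μ := fun σ => 2 * n + 1 - σ.nvar 3) (fun σ hI hb => by
      have hlt : σ.nvar 3 < 2 * n + 1 := by
        simp [hI.size] at hb; omega
      refine ⟨hI.step hlt, ?_⟩
      have : (tablesStep.step σ).nvar 3 = σ.nvar 3 + 1 := by simp [tablesStep]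
      omega) (σ := σ₀) (by constructor <;> simp [*])
  refine (h.seq fun σ hσ => Exec.of_step (c := tablesInit) (by simp [tablesInit]) ?_).mono
    (Q := _) (P := _) ?_ fun _ h => h
  · obtain ⟨hI, hb⟩ := hσ
    have hle := hI.le
    have h3 : σ.nvar 3 = 2 * n + 1 := by
      simp [hI.size] at hb; omega
    have hs := hI.size
    refine ⟨⟨?_, ?_, ?_, ?_, ?_⟩, ?_, ?_, ?_, ?_, ?_, ?_, ?_⟩
    · simp [tablesInit, hs]
    · intro x hx; simpa [tablesInit] using hI.row x (by omega)
    · intro x hx; simpa [tablesInit] using hI.sq x (by omega)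
    · intro x hx; simpa [tablesInit] using hI.rt x (by omega)
    · intro x hx; simpa [tablesInit] using hI.half x (by omega)
    · intro x hx; simpa [tablesInit] using hI.stack x (by omega)
    · simp [tablesInit, hs]
    · simp [tablesInit, hI.var2]
    · simp [tablesInit]
    · simp [tablesInit]
    · intro x; simp [tablesInit, hs, hI.other]
    · intro a a2 a3 a4 a5 a12 a11
      rw [← hI.other a a2 a3 a4 a5 a12]
      funext i
      simp [tablesInit, a11]
  · rw [h3]
    rw [Nat.sub_zero]
    generalize BExp.cost _ + _ = x
    nlinarith [Nat.zero_le (tablesInit.bound * n)]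

end RealRAM

namespace RealRAM

/-! ### Reading the adjacency lists -/

/-- Read an entry of the adjacency lists. -/
def readEntry : Cmd := .block
  [.nset 5 (.get 1 (.var 4)),
   .nput 6 (.add (.get 2 (.var 3)) (.var 5)) (.const 2),
   .nput 8 (.var 3) (.add (.get 8 (.var 3)) (.const 1)),
   .nput 9 (.var 3) (.add (.get 9 (.var 3)) (.var 5)),
   .nput 10 (.var 3) (.add (.get 10 (.var 3)) (.get 3 (.var 5))),
   .nset 4 (.add (.var 4) (.const 1))]

/-- The test whether the current list has further entries. -/
def moreEntries : BExp := .nlt (.var 4) (.get 0 (.add (.var 3) (.const 1)))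

/-- A single loop, whose step either reads an entry or goes on to the next vertex, keeps its body
free of loops as `Exec.loop` requires. -/
def readStep : Cmd := .ite moreEntries readEntry (.nset 3 (.add (.var 3) (.const 1)))

def readLoop : Cmd := .loop (.nlt (.var 3) (.var 0)) readStep

/-- The memory holds the lists `A v`, for `v < n`, as adjacency lists. -/
structure HoldsLists (n : ℕ) (A : ℕ → List ℕ) (σ : State) : Prop where
  zero : σ.narr 0 0 = 0
  succ : ∀ v < n, σ.narr 0 (v + 1) = σ.narr 0 v + (A v).length
  entry : ∀ v < n, ∀ (j : ℕ) (hj : j < (A v).length), σ.narr 1 (σ.narr 0 v + j) = (A v)[j]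

theorem HoldsLists.offset {n : ℕ} {A : ℕ → List ℕ} {σ : State} (h : HoldsLists n A σ) :
    ∀ v ≤ n, σ.narr 0 v = ∑ a ∈ Finset.range v, (A a).length := by
  intro v hv
  induction v with
  | zero => simpa using h.zero
  | succ v ih => rw [h.succ v (by omega), ih (by omega), Finset.sum_range_succ]

theorem HoldsLists.offset_le {n : ℕ} {A : ℕ → List ℕ} {σ : State} (h : HoldsLists n A σ) {v : ℕ}
    (hv : v ≤ n) : σ.narr 0 v ≤ σ.narr 0 n := by
  rw [h.offset v hv, h.offset n le_rfl]
  exact Finset.sum_le_sum_of_subset (Finset.range_subset_range.2 hv)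

/-- Two digits in base `n + 1`: the base leaves room for the root among the rows and columns of a
matrix. -/
theorem code_inj {n a b a' b' : ℕ} (hb : b ≤ n) (hb' : b' ≤ n) :
    a * (n + 1) + b = a' * (n + 1) + b' ↔ a = a' ∧ b = b' := by
  constructor
  · intro h
    have h1 := congrArg (· / (n + 1)) h
    have h2 := congrArg (· % (n + 1)) h
    rw [Nat.add_comm, Nat.add_comm (a' * _), Nat.add_mul_div_right _ _ (by omega),
      Nat.add_mul_div_right _ _ (by omega), Nat.div_eq_of_lt (by omega),
      Nat.div_eq_of_lt (by omega)] at h1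
    rw [Nat.add_comm, Nat.add_comm (a' * _), Nat.add_mul_mod_self_right,
      Nat.add_mul_mod_self_right, Nat.mod_eq_of_lt (by omega), Nat.mod_eq_of_lt (by omega)] at h2
    omega
  · rintro ⟨rfl, rfl⟩; rfl

/-- The adjacency matrix, the degrees, and the sums of the neighbours and of their squares, for the
lists `A`. -/
structure Recorded (n : ℕ) (A : ℕ → List ℕ) (σ : State) : Prop where
  edge : ∀ a ≤ n, ∀ b ≤ n, σ.narr 6 (a * (n + 1) + b) = if b ∈ A a then 2 else 0
  deg : ∀ a ≤ n, σ.narr 8 a = (A a).length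
  sum : ∀ a ≤ n, σ.narr 9 a = (A a).sum
  sumSq : ∀ a ≤ n, σ.narr 10 a = ((A a).map fun x => x * x).sum

/-- The part of the lists that has been read. -/
def readPart (A : ℕ → List ℕ) (σ : State) (a : ℕ) : List ℕ :=
  if a < σ.nvar 3 then A a else if a = σ.nvar 3 then (A a).take (σ.nvar 4 - σ.narr 0 a) else []

/-- The invariant while the adjacency lists are read. -/
structure Reading (n : ℕ) (A : ℕ → List ℕ) (σ₀ σ : State) : Prop where
  tables : Tables n σ
  lists : HoldsLists n A σ
  le : σ.nvar 3 ≤ n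
  pos : σ.narr 0 (σ.nvar 3) ≤ σ.nvar 4
  pos_le : σ.nvar 3 < n → σ.nvar 4 ≤ σ.narr 0 (σ.nvar 3 + 1)
  recorded : Recorded n (readPart A σ) σ
  var1 : σ.nvar 1 = σ₀.nvar 1
  var2 : σ.nvar 2 = σ₀.nvar 2
  other : ∀ a, a ≠ 6 → a ≠ 8 → a ≠ 9 → a ≠ 10 → σ.narr a = σ₀.narr a

theorem Reading.entry {n : ℕ} {A : ℕ → List ℕ} {σ₀ σ : State} (h : Reading n A σ₀ σ)
    (hA : ∀ a, ∀ b ∈ A a, b ≤ n) (hv : σ.nvar 3 < n)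
    (hi : σ.nvar 4 < σ.narr 0 (σ.nvar 3 + 1)) : Reading n A σ₀ (readEntry.step σ) := by
  obtain ⟨hT, hL, h1, h2, h3, hR, h4, h5, h6⟩ := h
  set v := σ.nvar 3 with hv'
  obtain ⟨j, hj⟩ := Nat.exists_eq_add_of_le h2
  have hjl : j < (A v).length := by
    have := hL.succ v hv; omega
  have he := hL.entry v hv j hjl
  rw [← hj] at he
  have hen : (A v)[j] ≤ n := hA v _ (List.getElem_mem _)
  have hrow := hT.row v hv.le
  have hsq := hT.sq ((A v)[j]) (by omega)
  have o3 : (readEntry.step σ).nvar 3 = v := by simp [readEntry, hv']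
  have o4 : (readEntry.step σ).nvar 4 = σ.nvar 4 + 1 := by simp [readEntry]
  have oarr : ∀ a, a ≠ 6 → a ≠ 8 → a ≠ 9 → a ≠ 10 → (readEntry.step σ).narr a = σ.narr a := by
    intro a h6 h8 h9 h10
    funext i; simp [readEntry, h6, h8, h9, h10]
  have o0 := oarr 0 (by simp) (by simp) (by simp) (by simp)
  have hp : ∀ a, readPart A (readEntry.step σ) a =
      if a = v then readPart A σ v ++ [(A v)[j]] else readPart A σ a := by
    intro a
    unfold readPart
    rw [o3, o4, o0, ← hv']
    by_cases hav : a = v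
    · subst hav
      simp only [lt_irrefl, if_false, if_true]
      rw [show σ.nvar 4 + 1 - σ.narr 0 v = j + 1 by omega,
        show σ.nvar 4 - σ.narr 0 v = j by omega, List.take_succ_eq_append_getElem hjl]
    · simp only [hav, if_false]
  constructor
  · obtain ⟨t0, t1, t2, t3, t4⟩ := hT
    constructor
    · simp [readEntry, t0]
    · rw [oarr 2 (by simp) (by simp) (by simp) (by simp)]; exact t1
    · rw [oarr 3 (by simp) (by simp) (by simp) (by simp)]; exact t2
    · rw [oarr 4 (by simp) (by simp) (by simp) (by simp)]; exact t3
    · rw [oarr 5 (by simp) (by simp) (by simp) (by simp)]; exact t4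
  · constructor
    · rw [o0]; exact hL.zero
    · rw [o0]; exact hL.succ
    · rw [o0, oarr 1 (by simp) (by simp) (by simp) (by simp)]; exact hL.entry
  · rw [o3]; exact h1
  · rw [o3, o0, o4]; omega
  · rw [o3, o0, o4]; omega
  · constructor
    · intro a ha b hb
      have := hR.edge a ha b hb
      rw [hp]
      simp only [readEntry, Cmd.step, Cmd.block, State.nset_narr, State.nput_narr, State.nset_nvar,
        NExp.eval]
      simp [← hv', he, hrow, code_inj hb hen, this]
      by_cases hav : a = v
      · subst hav; simp; by_cases hbj : b = (A v)[j] <;> simp [hbj]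
      · simp [hav]
    · intro a ha
      have := hR.deg a ha
      rw [hp]
      simp [readEntry, ← hv']
      by_cases hav : a = v
      · subst hav; simp [this]
      · simp [hav, this]
    · intro a ha
      have := hR.sum a ha
      rw [hp]
      simp [readEntry, ← hv', he]
      by_cases hav : a = v
      · subst hav; simp [this]
      · simp [hav, this]
    · intro a ha
      have := hR.sumSq a ha
      rw [hp]
      simp [readEntry, ← hv', he, hsq]
      by_cases hav : a = v
      · subst hav; simp [this]
      · simp [hav, this]
  · simp [readEntry, h4]
  · simp [readEntry, h5]
  · intro a e6 e8 e9 e10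
    rw [oarr a e6 e8 e9 e10, h6 a e6 e8 e9 e10]

theorem Reading.next {n : ℕ} {A : ℕ → List ℕ} {σ₀ σ : State} (h : Reading n A σ₀ σ)
    (hv : σ.nvar 3 < n) (hi : ¬ σ.nvar 4 < σ.narr 0 (σ.nvar 3 + 1)) :
    Reading n A σ₀ (σ.nset 3 (σ.nvar 3 + 1)) := by
  obtain ⟨hT, hL, h1, h2, h3, hR, h4, h5, h6⟩ := h
  have h3' := h3 hv
  have hs := hL.succ _ hv
  -- At this moment the list of the old vertex has been read completely and that of the next one not
  -- at all.
  have hp : readPart A (σ.nset 3 (σ.nvar 3 + 1)) = readPart A σ := by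
    funext a
    unfold readPart
    simp only [State.nset_nvar, State.nset_narr, if_true]
    rw [if_neg (by omega : ¬ (4 : ℕ) = 3)]
    rcases lt_trichotomy a (σ.nvar 3) with h' | h' | h'
    · rw [if_pos (by omega), if_pos h']
    · rw [if_pos (by omega), if_neg (by omega), if_pos h', List.take_of_length_le]
      subst h'; omega
    · rw [if_neg (by omega : ¬ a < σ.nvar 3 + 1), if_neg (by omega : ¬ a < σ.nvar 3),
        if_neg (by omega : ¬ a = σ.nvar 3)]
      split_ifs with h''
      · subst h''
        rw [show σ.nvar 4 - σ.narr 0 (σ.nvar 3 + 1) = 0 by omega, List.take_zero]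
      · rfl
  refine ⟨⟨by simpa using hT.size, hT.row, hT.sq, hT.rt, hT.half⟩, ⟨hL.zero, hL.succ, hL.entry⟩,
    by simpa using hv, by simp; omega, fun hv' => ?_, ?_, by simpa using h4, by simpa using h5, h6⟩
  · simp at hv' ⊢
    have := hL.succ _ hv'
    omega
  · rw [hp]
    exact ⟨hR.edge, hR.deg, hR.sum, hR.sumSq⟩

/-- Every step advances one of two pointers, to the vertices or to the entries; with at most `4 * n`
entries this accounts for the factor `5`. -/
theorem exec_read : ∃ C, ∀ (n : ℕ) (A : ℕ → List ℕ) (σ₀ : State), Tables n σ₀ →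
    HoldsLists n A σ₀ → (∀ a, ∀ b ∈ A a, b ≤ n) → A n = [] →
    ∑ a ∈ Finset.range n, (A a).length ≤ 4 * n → σ₀.nvar 3 = 0 → σ₀.nvar 4 = 0 →
    (∀ i, σ₀.narr 6 i = 0) → (∀ i, σ₀.narr 8 i = 0) → (∀ i, σ₀.narr 9 i = 0) →
    (∀ i, σ₀.narr 10 i = 0) → Exec readLoop σ₀ (C * (n + 1)) fun σ => Tables n σ ∧
      Recorded n A σ ∧ σ.nvar 1 = σ₀.nvar 1 ∧ σ.nvar 2 = σ₀.nvar 2 ∧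
      ∀ a, a ≠ 6 → a ≠ 8 → a ≠ 9 → a ≠ 10 → σ.narr a = σ₀.narr a := by
  refine ⟨(BExp.cost (.nlt (.var 3) (.var 0)) + readStep.bound) * 5,
    fun n A σ₀ hT hL hA hn hsum h3 h4 h6 h8 h9 h10 => ?_⟩
  have h := Exec.loop (b := .nlt (.var 3) (.var 0)) (c := readStep)
    (by simp [readStep, readEntry]) (I := Reading n A σ₀)
    (μ := fun σ => (n - σ.nvar 3) + (σ₀.narr 0 n - σ.nvar 4)) (fun σ hI hb => by
      have hv : σ.nvar 3 < n := by simpa [hI.tables.size] using hb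
      have h0 : σ.narr 0 = σ₀.narr 0 := hI.other 0 (by simp) (by simp) (by simp) (by simp)
      by_cases hi : σ.nvar 4 < σ.narr 0 (σ.nvar 3 + 1)
      · have e : readStep.step σ = readEntry.step σ := by
          rw [readStep, Cmd.step, if_pos]; simpa [moreEntries] using hi
        rw [e]
        refine ⟨hI.entry hA hv hi, ?_⟩
        have o3 : (readEntry.step σ).nvar 3 = σ.nvar 3 := by simp [readEntry]
        have o4 : (readEntry.step σ).nvar 4 = σ.nvar 4 + 1 := by simp [readEntry]
        have := hI.lists.offset_le (v := σ.nvar 3 + 1) hv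
        rw [h0] at hi this
        simp only [o3, o4]
        omega
      · have e : readStep.step σ = σ.nset 3 (σ.nvar 3 + 1) := by
          rw [readStep, Cmd.step, if_neg]
          · rfl
          · simpa [moreEntries] using hi
        rw [e]
        refine ⟨hI.next hv hi, ?_⟩
        simp
        omega) (σ := σ₀) ?_
  · refine h.mono ?_ ?_
    · rw [h3, h4, Nat.mul_assoc]
      have := hL.offset n le_rfl
      exact Nat.mul_le_mul_left _ (by omega)
    · rintro σ ⟨hI, hb⟩
      refine ⟨hI.tables, ?_, hI.var1, hI.var2, hI.other⟩
      have h3 : σ.nvar 3 = n := by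
        have := hI.le
        simp [hI.tables.size] at hb; omega
      have hp : ∀ a ≤ n, readPart A σ a = A a := by
        intro a ha
        unfold readPart
        rw [h3]
        rcases ha.lt_or_eq with h | rfl
        · rw [if_pos h]
        · simp [hn]
      obtain ⟨r1, r2, r3, r4⟩ := hI.recorded
      constructor
      · intro a ha b hb; rw [r1 a ha b hb, hp a ha]
      · intro a ha; rw [r2 a ha, hp a ha]
      · intro a ha; rw [r3 a ha, hp a ha]
      · intro a ha; rw [r4 a ha, hp a ha]
  · have hp : readPart A σ₀ = fun _ => [] := by
      funext a
      unfold readPart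
      rw [h3, h4]
      simp
    refine ⟨hT, hL, by omega, by rw [h3, h4, hL.zero], fun _ => by omega, ?_, rfl, rfl,
      fun _ _ _ _ _ => rfl⟩
    rw [hp]
    constructor <;> simp [h6, h8, h9, h10]

/-! ### The input -/

/-- The adjacency list of `v` as a list of natural numbers. -/
def listAt {n : ℕ} (L : Fin n → List (Fin n)) (v : ℕ) : List ℕ :=
  if h : v < n then (L ⟨v, h⟩).map Fin.val else []

theorem flatten_getElem? {α : Type*} (ls : List (List α)) (v : ℕ) (hv : v < ls.length) (j : ℕ)
    (hj : j < ls[v].length) : ls.flatten[(ls.take v).flatten.length + j]? = some ls[v][j] := by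
  conv_lhs => rw [← List.take_append_drop v ls, List.drop_eq_getElem_cons hv]
  simp only [List.flatten_append, List.flatten_cons]
  rw [List.getElem?_append_right (by simp)]
  simp [List.getElem?_append_left, hj]

theorem holdsLists_inputState {n : ℕ} (L : Fin n → List (Fin n)) :
    HoldsLists n (listAt L) (inputState L) := by
  constructor
  · simp [inputState]
  · intro v hv
    have : v < (List.ofFn L).length := by simpa using hv
    simp only [inputState, if_true, hv.le, Nat.succ_le_of_lt hv]
    rw [List.take_succ_eq_append_getElem this]
    simp [listAt, hv]
  · intro v hv j hj
    have hl : v < (List.ofFn L).length := by simpa using hv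
    have hj' : j < (List.ofFn L)[v].length := by simpa [listAt, hv] using hj
    have := flatten_getElem? (List.ofFn L) v hl j hj'
    simp only [inputState, if_true, hv.le, if_neg (by omega : ¬ (1 : ℕ) = 0)]
    rw [List.getD_eq_getElem?_getD, List.getElem?_map, this]
    simp [listAt, hv]

end RealRAM

/-! ### Neighbourhoods under removals -/

theorem nbrs_cons {n : ℕ} {l : List Removal} {edge : ℕ → ℕ → ℕ} {r : Removal} {x : ℕ} :
    nbrs n (r :: l) edge x = (nbrs n l edge x).erase r.vertex := by
  ext y
  simp only [mem_nbrs, mem_alive_cons, Finset.mem_erase]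
  tauto

/-- To be used with `f y` equal to `1`, `y` and `y * y`, the three sums in the memory. Truncated
subtraction is exact because the removed vertex occurs in the sum. -/
theorem sum_nbrs_remove {n : ℕ} {l : List Removal} {edge : ℕ → ℕ → ℕ} {r : Removal} {x : ℕ}
    (f : ℕ → ℕ) (h : r.vertex ∈ nbrs n l edge x) :
    ∑ y ∈ nbrs n (r :: l) edge x, f y = ∑ y ∈ nbrs n l edge x, f y - f r.vertex := by
  rw [nbrs_cons, ← Finset.sum_erase_add _ _ h, Nat.add_sub_cancel]

theorem nbrs_cons_of_notMem {n : ℕ} {l : List Removal} {edge : ℕ → ℕ → ℕ} {r : Removal} {x : ℕ}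
    (h : r.vertex ∉ nbrs n l edge x) : nbrs n (r :: l) edge x = nbrs n l edge x := by
  rw [nbrs_cons, Finset.erase_eq_of_notMem h]

theorem nbrs_fillEdge_of_ne {n : ℕ} {l : List Removal} {edge : ℕ → ℕ → ℕ} {u v x : ℕ}
    (hu : x ≠ u) (hv : x ≠ v) : nbrs n l (fillEdge edge u v) x = nbrs n l edge x := by
  ext y; simp [mem_nbrs, fillEdge, hu, hv]

theorem fillEdge_eq_self {edge : ℕ → ℕ → ℕ} {u v : ℕ} (hs : ∀ x y, edge x y = edge y x)
    (h : edge u v ≠ 0) : fillEdge edge u v = edge := by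
  funext a b
  unfold fillEdge
  rw [if_neg]
  rintro ⟨⟨rfl, rfl⟩ | ⟨rfl, rfl⟩, h0⟩
  · exact h h0
  · rw [hs] at h0; exact h h0

theorem fillEdge_comm (edge : ℕ → ℕ → ℕ) (u v : ℕ) : fillEdge edge u v = fillEdge edge v u := by
  funext a b
  unfold fillEdge
  congr 1
  exact propext (by tauto)

theorem nbrs_fillEdge {n : ℕ} {l : List Removal} {edge : ℕ → ℕ → ℕ} {u v : ℕ} (huv : u ≠ v)
    (hv : v ∈ alive n l) : nbrs n l (fillEdge edge u v) u = insert v (nbrs n l edge u) := by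
  ext y
  simp only [mem_nbrs, fillEdge, Finset.mem_insert]
  by_cases hy : y = v
  · subst hy; by_cases e : edge u y = 0 <;> simp [hv, e]
  · simp [hy, huv]

theorem sum_nbrs_swap {n : ℕ} {l : List Removal} {edge : ℕ → ℕ → ℕ} {r : Removal} {u v : ℕ}
    (f : ℕ → ℕ) (huv : u ≠ v) (hv : v ∈ alive n l) (hvr : v ≠ r.vertex) (he : edge u v = 0)
    (h : r.vertex ∈ nbrs n l edge u) :
    ∑ y ∈ nbrs n (r :: l) (fillEdge edge u v) u, f y =
      ∑ y ∈ nbrs n l edge u, f y + f v - f r.vertex := by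
  rw [nbrs_fillEdge huv (mem_alive_cons.2 ⟨hv, hvr⟩), Finset.sum_insert, sum_nbrs_remove f h]
  · have := Finset.single_le_sum (f := f) (fun _ _ => Nat.zero_le _) h
    omega
  · simp [mem_nbrs, he]

namespace RealRAM

/-! ### The elimination -/

/-- Record the removal of the vertex in variable `3`. -/
def recordCmd : Cmd := .block
  [.nput 13 (.var 2) (.var 3), .nput 14 (.var 2) (.var 4), .nput 15 (.var 2) (.var 5),
   .nput 16 (.var 2) (.var 6), .nset 2 (.add (.var 2) (.const 1)), .nput 11 (.var 3) (.const 1)]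

/-- Put the vertex in variable `y` on the stack. -/
def pushCmd (y : ℕ) : Cmd := .block
  [.nput 12 (.var 1) (.var y), .nset 1 (.add (.var 1) (.const 1))]

/-- The vertex in variable `3` is no longer a neighbour of that in variable `y`. -/
def dropCmd (y : ℕ) : Cmd := .block
  [.nput 8 (.var y) (.sub (.get 8 (.var y)) (.const 1)),
   .nput 9 (.var y) (.sub (.get 9 (.var y)) (.var 3)),
   .nput 10 (.var y) (.sub (.get 10 (.var y)) (.get 3 (.var 3)))]

/-- The vertex in variable `z` replaces that in variable `3` as a neighbour of that in variable
`y`. -/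
def swapCmd (y z : ℕ) : Cmd := .block
  [.nput 9 (.var y) (.sub (.add (.get 9 (.var y)) (.var z)) (.var 3)),
   .nput 10 (.var y) (.sub (.add (.get 10 (.var y)) (.get 3 (.var z))) (.get 3 (.var 3)))]

/-- The position of the entry for the vertices in variables `y` and `z` in a matrix. -/
def entryAt (y z : ℕ) : NExp := .add (.get 2 (.var y)) (.var z)

/-- Find the neighbour of the vertex in variable `3`, or the root if there is none. -/
def findNbr : Cmd :=
  .ite (.nlt (.get 8 (.var 3)) (.const 1)) (.nset 4 (.var 0)) (.nset 4 (.get 9 (.var 3)))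

/-- Remove the vertex in variable `3`, whose neighbour is in variable `4`. -/
def pendantCmd : Cmd := .block
  [.nset 5 (.var 4), .nset 6 (.const 0), recordCmd, dropCmd 4, pushCmd 4]

/-- Find the two neighbours of the vertex in variable `3`. -/
def findNbrs : Cmd := .block
  [.nset 7 (.get 4 (.sub (.add (.get 10 (.var 3)) (.get 10 (.var 3))) (.get 3 (.get 9 (.var 3))))),
   .nset 4 (.get 5 (.add (.get 9 (.var 3)) (.var 7))),
   .nset 5 (.sub (.get 9 (.var 3)) (.var 4))]

/-- Remove the vertex in variable `3`, whose neighbours are in variables `4` and `5`. -/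
def earCmd : Cmd := .block
  [.nset 6 (.get 7 (entryAt 4 5)), recordCmd,
   .nput 7 (entryAt 4 5) (.add (.var 6) (.const 1)),
   .nput 7 (entryAt 5 4) (.add (.var 6) (.const 1)),
   .ite (.nlt (.get 6 (entryAt 4 5)) (.const 1))
    (.block [.nput 6 (entryAt 4 5) (.const 1), .nput 6 (entryAt 5 4) (.const 1),
      swapCmd 4 5, swapCmd 5 4])
    (.block [dropCmd 4, dropCmd 5]),
   pushCmd 4, pushCmd 5]

/-- The removals `l`, the last one first, are stored. -/
def Stored (σ : State) : List Removal → Prop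
  | [] => True
  | r :: l => (σ.narr 13 l.length = r.vertex ∧ σ.narr 14 l.length = r.left ∧
      σ.narr 15 l.length = r.right ∧ σ.narr 16 l.length = r.slot) ∧ Stored σ l

theorem Stored.congr {σ σ' : State} {l : List Removal} (h : Stored σ l)
    (h' : ∀ a, 13 ≤ a → a ≤ 16 → ∀ i < l.length, σ'.narr a i = σ.narr a i) : Stored σ' l := by
  induction l with
  | nil => trivial
  | cons r l ih =>
    have hl : l.length < (r :: l).length := by simp
    refine ⟨?_, ih h.2 fun a ha ha' i hi => h' a ha ha' i (hi.trans hl)⟩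
    rw [h' 13 (by simp) (by simp) _ hl, h' 14 (by simp) (by simp) _ hl,
      h' 15 (by simp) (by simp) _ hl, h' 16 (by simp) (by simp) _ hl]
    exact h.1

/-- The memory represents the state of an elimination. -/
structure Sim (n : ℕ) (R : ℕ → ℕ → Prop) (l : List Removal) (edge c : ℕ → ℕ → ℕ) (σ : State) :
    Prop where
  elim : Elim n R l edge c
  tables : Tables n σ
  length : σ.nvar 2 = l.length
  edge_eq : ∀ x ≤ n, ∀ y ≤ n, σ.narr 6 (x * (n + 1) + y) = edge x y
  cnt_eq : ∀ x ≤ n, ∀ y ≤ n, σ.narr 7 (x * (n + 1) + y) = c x y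
  deg : ∀ x ∈ alive n l, σ.narr 8 x = ∑ _y ∈ nbrs n l edge x, 1
  sum : ∀ x ∈ alive n l, σ.narr 9 x = ∑ y ∈ nbrs n l edge x, y
  sumSq : ∀ x ∈ alive n l, σ.narr 10 x = ∑ y ∈ nbrs n l edge x, y * y
  dead : ∀ x ≤ n, σ.narr 11 x = 0 ↔ x ∈ alive n l
  stored : Stored σ l

variable {n : ℕ} {R : ℕ → ℕ → Prop} {l : List Removal} {edge c : ℕ → ℕ → ℕ} {σ σ' : State}

theorem Tables.congr (h : Tables n σ) (h0 : σ'.nvar 0 = σ.nvar 0) (h2 : σ'.narr 2 = σ.narr 2)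
    (h3 : σ'.narr 3 = σ.narr 3) (h4 : σ'.narr 4 = σ.narr 4) (h5 : σ'.narr 5 = σ.narr 5) :
    Tables n σ' :=
  ⟨h0 ▸ h.size, h2 ▸ h.row, h3 ▸ h.sq, h4 ▸ h.rt, h5 ▸ h.half⟩

theorem Sim.congr (h : Sim n R l edge c σ) (h0 : σ'.nvar 0 = σ.nvar 0) (h2 : σ'.nvar 2 = σ.nvar 2)
    (ha : σ'.narr = σ.narr) : Sim n R l edge c σ' := by
  obtain ⟨a1, a2, a3, a4, a5, a6, a7, a8, a9, a10⟩ := h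
  refine ⟨a1, a2.congr h0 ?_ ?_ ?_ ?_, h2 ▸ a3, ?_, ?_, ?_, ?_, ?_, ?_, a10.congr ?_⟩ <;> rw [ha]
  all_goals first | assumption | (intros; rfl)

/-- The sum over a single neighbour is this neighbour. -/
theorem Sim.findNbr (h : Sim n R l edge c σ) {w : ℕ} (hw : w ∈ alive n l) (h3 : σ.nvar 3 = w)
    (hd : σ.narr 8 w < 2) : ∃ u, findNbr.step σ = σ.nset 4 u ∧
      (nbrs n l edge w = {u} ∨ (nbrs n l edge w = ∅ ∧ u = n)) := by
  have hdeg := h.deg w hw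
  rw [Finset.sum_const, smul_eq_mul, mul_one] at hdeg
  by_cases h0 : σ.narr 8 w = 0
  · refine ⟨n, ?_, Or.inr ⟨Finset.card_eq_zero.1 (by omega), rfl⟩⟩
    simp [RealRAM.findNbr, h3, h0, h.tables.size]
  · obtain ⟨u, hu⟩ := Finset.card_eq_one.1 (show (nbrs n l edge w).card = 1 by omega)
    refine ⟨u, ?_, Or.inl hu⟩
    have := h.sum w hw
    rw [hu, Finset.sum_singleton] at this
    simp [RealRAM.findNbr, h3, h0, this]

theorem Sim.pendant (h : Sim n R l edge c σ) {w u : ℕ} (hw : w ∈ alive n l) (h3 : σ.nvar 3 = w)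
    (h4 : σ.nvar 4 = u) (hN : nbrs n l edge w = {u} ∨ (nbrs n l edge w = ∅ ∧ u = n)) :
    Sim n R (⟨w, u, u, 0⟩ :: l) edge c (pendantCmd.step σ) := by
  have hwn := (mem_alive.1 hw).1
  have huw : u ≠ w := by
    rcases hN with hN | ⟨_, rfl⟩
    · rintro rfl
      have := (mem_nbrs.1 (show u ∈ nbrs n l edge u by simp [hN])).2
      exact this (h.elim.edge_self u)
    · exact hwn.ne'
  -- If `u` is the root, its sums become meaningless, but the invariant only speaks of vertices in
  -- `alive`.
  have hwu : u ∈ alive n l → w ∈ nbrs n l edge u := by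
    intro hu
    rcases hN with hN | ⟨_, rfl⟩
    · have := (mem_nbrs.1 (show u ∈ nbrs n l edge w by simp [hN])).2
      rw [h.elim.edge_symm] at this
      exact mem_nbrs.2 ⟨hw, this⟩
    · exact absurd (mem_alive.1 hu).1 (lt_irrefl _)
  have hwx : ∀ x ∈ alive n l, x ≠ u → w ∉ nbrs n l edge x := by
    intro x hx hxu hm
    have : x ∈ nbrs n l edge w := mem_nbrs.2 ⟨hx, by rw [h.elim.edge_symm]; exact (mem_nbrs.1 hm).2⟩
    rcases hN with hN | ⟨hN, _⟩ <;> rw [hN] at this <;> simp [hxu] at this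
  have hu : u ∈ alive n l ∨ u = n := by
    rcases hN with hN | ⟨_, rfl⟩
    · exact Or.inl (mem_nbrs.1 (show u ∈ nbrs n l edge w by simp [hN])).1
    · exact Or.inr rfl
  have other : ∀ a, a < 8 → (pendantCmd.step σ).narr a = σ.narr a := by
    intro a ha
    funext i
    have : a ≠ 8 ∧ a ≠ 9 ∧ a ≠ 10 ∧ a ≠ 11 ∧ a ≠ 12 ∧ a ≠ 13 ∧ a ≠ 14 ∧ a ≠ 15 ∧ a ≠ 16 := by
      omega
    simp [pendantCmd, recordCmd, dropCmd, pushCmd, this]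
  have hsq := h.tables.sq w (by omega)
  have weight : ∀ (f : ℕ → ℕ) (x s : ℕ), x ∈ alive n (⟨w, u, u, 0⟩ :: l) →
      s = ∑ y ∈ nbrs n l edge x, f y →
      (if x = u then s - f w else s) = ∑ y ∈ nbrs n (⟨w, u, u, 0⟩ :: l) edge x, f y := by
    rintro f x s hx rfl
    rw [mem_alive_cons] at hx
    split_ifs with e
    · subst e; rw [sum_nbrs_remove f (hwu hx.1)]
    · rw [nbrs_cons_of_notMem (hwx x hx.1 e)]
  constructor
  · exact h.elim.pendant hw hu huw (by rcases hN with hN | ⟨hN, _⟩ <;> simp [hN])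
  · exact h.tables.congr (by simp [pendantCmd, recordCmd, dropCmd, pushCmd]) (other 2 (by simp))
      (other 3 (by simp)) (other 4 (by simp)) (other 5 (by simp))
  · simp [pendantCmd, recordCmd, dropCmd, pushCmd, h.length]
  · rw [other 6 (by simp)]; exact h.edge_eq
  · rw [other 7 (by simp)]; exact h.cnt_eq
  · intro x hx
    rw [← weight (fun _ => 1) x _ hx (h.deg x (mem_alive_cons.1 hx).1)]
    simp [pendantCmd, recordCmd, dropCmd, pushCmd, h4]
    split_ifs with e <;> simp [e]
  · intro x hx
    rw [← weight (fun y => y) x _ hx (h.sum x (mem_alive_cons.1 hx).1)]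
    simp [pendantCmd, recordCmd, dropCmd, pushCmd, h4, h3]
    split_ifs with e <;> simp [e]
  · intro x hx
    rw [← weight (fun y => y * y) x _ hx (h.sumSq x (mem_alive_cons.1 hx).1)]
    simp [pendantCmd, recordCmd, dropCmd, pushCmd, h4, h3, hsq]
    split_ifs with e <;> simp [e]
  · intro x hx
    rw [mem_alive_cons, ← h.dead x hx]
    simp [pendantCmd, recordCmd, dropCmd, pushCmd, h3]
    split_ifs with e <;> simp [e]
  · refine ⟨?_, h.stored.congr ?_⟩
    · simp [pendantCmd, recordCmd, dropCmd, pushCmd, h3, h4, h.length]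
    · intro a ha ha' i hi
      have : a ≠ 8 ∧ a ≠ 9 ∧ a ≠ 10 ∧ a ≠ 11 ∧ a ≠ 12 := by omega
      simp [pendantCmd, recordCmd, dropCmd, pushCmd, h.length, hi.ne, this]

/-- From `s = u + v` and `q = u² + v²` one gets `2q - s² = (u - v)²`; the table of roots gives the
difference, and half of `s + (u - v)` is the larger neighbour `u`. -/
theorem Sim.findNbrs (h : Sim n R l edge c σ) {w : ℕ} (hw : w ∈ alive n l) (h3 : σ.nvar 3 = w)
    (hd : σ.narr 8 w = 2) : ∃ d u v, findNbrs.step σ = ((σ.nset 7 d).nset 4 u).nset 5 v ∧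
      u ≠ v ∧ nbrs n l edge w = {u, v} := by
  have hdeg := h.deg w hw
  rw [Finset.sum_const, smul_eq_mul, mul_one] at hdeg
  have key : ∃ u v, v < u ∧ nbrs n l edge w = {u, v} := by
    obtain ⟨u, v, huv, hN⟩ := Finset.card_eq_two.1 (show (nbrs n l edge w).card = 2 by omega)
    rcases huv.lt_or_gt with h' | h'
    · exact ⟨v, u, h', by rw [hN, Finset.pair_comm]⟩
    · exact ⟨u, v, h', hN⟩
  obtain ⟨u, v, huv, hN⟩ := key
  have hu : u < n := (mem_alive.1 (mem_nbrs.1 (show u ∈ nbrs n l edge w by simp [hN])).1).1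
  refine ⟨u - v, u, v, ?_, huv.ne', hN⟩
  have hsum := h.sum w hw
  have hsumSq := h.sumSq w hw
  rw [hN, Finset.sum_pair huv.ne'] at hsum hsumSq
  have hsq := h.tables.sq (u + v) (by omega)
  have e1 : u * u + v * v + (u * u + v * v) - (u + v) * (u + v) = (u - v) * (u - v) := by
    obtain ⟨d, rfl⟩ := Nat.exists_eq_add_of_le huv.le
    rw [Nat.add_sub_cancel_left]
    apply Nat.sub_eq_of_eq_add
    ring
  have e2 : u + v + (u - v) = u + u := by omega
  have hrt := h.tables.rt (u - v) (by omega)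
  have hhalf := h.tables.half u hu.le
  simp [RealRAM.findNbrs, h3, hsum, hsumSq, hsq, e1, hrt, e2, hhalf]

end RealRAM

/-! ### Removing an ear in the memory -/

namespace RealRAM

variable {n : ℕ} {R : ℕ → ℕ → Prop} {l : List Removal} {edge c : ℕ → ℕ → ℕ} {σ σ' : State}

-- If `u v` is not yet an edge, then `u` and `v` replace `w` in each other's sums and keep their
-- degrees; if it is one, `w` is just dropped from both. The local fact `weight` treats the three
-- sums alike in both cases.
set_option maxHeartbeats 4000000 in
theorem Sim.ear (h : Sim n R l edge c σ) {w u v : ℕ} (hw : w ∈ alive n l) (h3 : σ.nvar 3 = w)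
    (h4 : σ.nvar 4 = u) (h5 : σ.nvar 5 = v) (huv : u ≠ v) (hN : nbrs n l edge w = {u, v})
    (cu : c u w ≤ 1) (cv : c v w ≤ 1) :
    Sim n R (⟨w, u, v, c u v⟩ :: l) (fillEdge edge u v) (raise c u v) (earCmd.step σ) := by
  have hwn := (mem_alive.1 hw).1
  have hu := mem_nbrs.1 (show u ∈ nbrs n l edge w by simp [hN])
  have hv := mem_nbrs.1 (show v ∈ nbrs n l edge w by simp [hN])
  have hun := (mem_alive.1 hu.1).1
  have hvn := (mem_alive.1 hv.1).1
  have huw : u ≠ w := by rintro rfl; exact hu.2 (h.elim.edge_self _)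
  have hvw : v ≠ w := by rintro rfl; exact hv.2 (h.elim.edge_self _)
  have hwu : w ∈ nbrs n l edge u := mem_nbrs.2 ⟨hw, by rw [h.elim.edge_symm]; exact hu.2⟩
  have hwv : w ∈ nbrs n l edge v := mem_nbrs.2 ⟨hw, by rw [h.elim.edge_symm]; exact hv.2⟩
  have hwx : ∀ x ∈ alive n l, x ≠ u → x ≠ v → w ∉ nbrs n l edge x := by
    intro x hx hxu hxv hm
    have : x ∈ nbrs n l edge w := mem_nbrs.2 ⟨hx, by rw [h.elim.edge_symm]; exact (mem_nbrs.1 hm).2⟩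
    rw [hN] at this
    simp [hxu, hxv] at this
  have ru := h.tables.row u hun.le
  have rv := h.tables.row v hvn.le
  have su := h.tables.sq u (by omega)
  have sv := h.tables.sq v (by omega)
  have sw := h.tables.sq w (by omega)
  have cuv := h.cnt_eq u hun.le v hvn.le
  have euv := h.edge_eq u hun.le v hvn.le
  have es := h.elim.edge_symm
  have cs := h.elim.history.symm
  have ci : ∀ {a b a' b' : ℕ}, b ≤ n → b' ≤ n →
    (a * (n + 1) + b = a' * (n + 1) + b' ↔ a = a' ∧ b = b') := code_inj
  have weight : ∀ (f : ℕ → ℕ) (x s : ℕ), x ∈ alive n (⟨w, u, v, c u v⟩ :: l) →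
      s = ∑ y ∈ nbrs n l edge x, f y →
      (if x = v then (if edge u v = 0 then s + f u - f w else s - f w) else
        if x = u then (if edge u v = 0 then s + f v - f w else s - f w) else s) =
      ∑ y ∈ nbrs n (⟨w, u, v, c u v⟩ :: l) (fillEdge edge u v) x, f y := by
    rintro f x s hx rfl
    rw [mem_alive_cons] at hx
    by_cases e : edge u v = 0
    · simp only [e, if_true]
      split_ifs with e1 e2
      · subst e1
        rw [fillEdge_comm, sum_nbrs_swap f huv.symm hu.1 huw (by rw [es, e]) hwv]
      · subst e2
        rw [sum_nbrs_swap f huv hv.1 hvw e hwu]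
      · rw [nbrs_fillEdge_of_ne e2 e1, nbrs_cons_of_notMem (hwx x hx.1 e2 e1)]
    · simp only [e, if_false]
      rw [fillEdge_eq_self es e]
      split_ifs with e1 e2
      · subst e1; rw [sum_nbrs_remove f hwv]
      · subst e2; rw [sum_nbrs_remove f hwu]
      · rw [nbrs_cons_of_notMem (hwx x hx.1 e2 e1)]
  have other : ∀ a, a < 6 → (earCmd.step σ).narr a = σ.narr a := by
    intro a ha
    funext i
    have : a ≠ 6 ∧ a ≠ 7 ∧ a ≠ 8 ∧ a ≠ 9 ∧ a ≠ 10 ∧ a ≠ 11 ∧ a ≠ 12 ∧ a ≠ 13 ∧ a ≠ 14 ∧ a ≠ 15 ∧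
      a ≠ 16 := by omega
    by_cases e : edge u v = 0 <;>
    simp [earCmd, recordCmd, dropCmd, pushCmd, swapCmd, entryAt, this, h4, h5, ru, euv, e]
  constructor
  · exact h.elim.ear hw huv hN cu cv
  · refine h.tables.congr ?_ (other 2 (by simp)) (other 3 (by simp)) (other 4 (by simp))
      (other 5 (by simp))
    by_cases e : edge u v = 0 <;>
    simp [earCmd, recordCmd, dropCmd, pushCmd, swapCmd, entryAt, h4, h5, ru, euv, e]
  · by_cases e : edge u v = 0 <;>
    simp [earCmd, recordCmd, dropCmd, pushCmd, swapCmd, entryAt, h4, h5, ru, euv, e, h.length]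
  · intro x hx y hy
    have exy := h.edge_eq x hx y hy
    by_cases e : edge u v = 0
    · have e' : edge v u = 0 := by rw [es, e]
      simp [earCmd, recordCmd, dropCmd, pushCmd, swapCmd, entryAt, h4, h5, ru, rv, euv, e, fillEdge,
        ci hy hun.le, ci hy hvn.le, exy]
      grind
    · rw [fillEdge_eq_self es e]
      simp [earCmd, recordCmd, dropCmd, pushCmd, swapCmd, entryAt, h4, h5, ru, euv, e, exy]
  · intro x hx y hy
    have cxy := h.cnt_eq x hx y hy
    have cvu := cs v u
    by_cases e : edge u v = 0 <;>
    · simp [earCmd, recordCmd, dropCmd, pushCmd, swapCmd, entryAt, h4, h5, ru, rv, euv, e, raise,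
        ci hy hun.le, ci hy hvn.le, cxy, cuv]
      grind
  · intro x hx
    rw [← weight (fun _ => 1) x _ hx (h.deg x (mem_alive_cons.1 hx).1)]
    by_cases e : edge u v = 0
    · simp [earCmd, recordCmd, dropCmd, pushCmd, swapCmd, entryAt, h4, h5, ru, euv, e]
    · simp [earCmd, recordCmd, dropCmd, pushCmd, swapCmd, entryAt, h4, h5, ru, euv, e, huv.symm]
      grind
  · intro x hx
    rw [← weight (fun y => y) x _ hx (h.sum x (mem_alive_cons.1 hx).1)]
    by_cases e : edge u v = 0 <;>
    · simp [earCmd, recordCmd, dropCmd, pushCmd, swapCmd, entryAt, h3, h4, h5, ru, euv, e, huv.symm]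
      grind
  · intro x hx
    rw [← weight (fun y => y * y) x _ hx (h.sumSq x (mem_alive_cons.1 hx).1)]
    by_cases e : edge u v = 0 <;>
    · simp [earCmd, recordCmd, dropCmd, pushCmd, swapCmd, entryAt, h3, h4, h5, ru, euv, e, huv.symm,
        su, sv, sw]
      grind
  · intro x hx
    rw [mem_alive_cons, ← h.dead x hx]
    by_cases e : edge u v = 0 <;>
    · simp [earCmd, recordCmd, dropCmd, pushCmd, swapCmd, entryAt, h3, h4, h5, ru, euv, e]
      split_ifs with e <;> simp [e]
  · refine ⟨?_, h.stored.congr ?_⟩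
    · by_cases e : edge u v = 0 <;>
      simp [earCmd, recordCmd, dropCmd, pushCmd, swapCmd, entryAt, h3, h4, h5, ru, euv, e, cuv,
        h.length]
    · intro a ha ha' i hi
      have : a ≠ 6 ∧ a ≠ 7 ∧ a ≠ 8 ∧ a ≠ 9 ∧ a ≠ 10 ∧ a ≠ 11 ∧ a ≠ 12 := by omega
      by_cases e : edge u v = 0 <;>
      simp [earCmd, recordCmd, dropCmd, pushCmd, swapCmd, entryAt, h4, h5, ru, euv, e,
        h.length, hi.ne, this]

end RealRAM

/-! ### Newly removable vertices and the stack of candidates -/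

theorem notMem_nbrs_of_notMem {n : ℕ} {l : List Removal} {edge : ℕ → ℕ → ℕ} {w x : ℕ}
    (hs : ∀ x y, edge x y = edge y x) (hx : x ∈ alive n l) (h : x ∉ nbrs n l edge w) :
    w ∉ nbrs n l edge x := by
  intro hm
  exact h (mem_nbrs.2 ⟨hx, by rw [hs]; exact (mem_nbrs.1 hm).2⟩)

theorem Removable.of_pendant {n : ℕ} {l : List Removal} {edge c : ℕ → ℕ → ℕ} {w u x i : ℕ}
    (hs : ∀ x y, edge x y = edge y x) (hN : nbrs n l edge w ⊆ {u})
    (h : Removable n (⟨w, u, u, i⟩ :: l) edge c x) (hxu : x ≠ u) :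
    Removable n l edge c x ∧ x ≠ w := by
  obtain ⟨h1, h2⟩ := h
  rw [mem_alive_cons] at h1
  rw [nbrs_cons_of_notMem (notMem_nbrs_of_notMem hs h1.1
    fun hm => hxu (Finset.mem_singleton.1 (hN hm)))] at h2
  exact ⟨⟨h1.1, h2⟩, h1.2⟩

/-- The neighbourhoods of other vertices and the ears on their edges do not change, so only `u` and
`v` can become removable, and pushing them preserves the stack invariant. -/
theorem Removable.of_ear {n : ℕ} {l : List Removal} {edge c : ℕ → ℕ → ℕ} {w u v x i : ℕ}
    (hs : ∀ x y, edge x y = edge y x) (hN : nbrs n l edge w = {u, v})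
    (h : Removable n (⟨w, u, v, i⟩ :: l) (fillEdge edge u v) (raise c u v) x) (hxu : x ≠ u)
    (hxv : x ≠ v) : Removable n l edge c x ∧ x ≠ w := by
  obtain ⟨h1, h2⟩ := h
  rw [mem_alive_cons] at h1
  rw [nbrs_fillEdge_of_ne hxu hxv, nbrs_cons_of_notMem (notMem_nbrs_of_notMem hs h1.1
    fun hm => by rw [hN] at hm; simp [hxu, hxv] at hm)] at h2
  refine ⟨⟨h1.1, h2.imp_right fun h3 => ⟨h3.1, fun y hy => ?_⟩⟩, h1.2⟩
  have := h3.2 y hy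
  unfold raise at this
  rwa [if_neg (by rintro (⟨_, h⟩ | ⟨_, h⟩) <;> [exact hxv h; exact hxu h])] at this

theorem History.length_le {n : ℕ} {R : ℕ → ℕ → Prop} {l : List Removal} {c : ℕ → ℕ → ℕ}
    (h : History n R l c) : l.length ≤ n := by
  have := Finset.card_le_card (s := (l.map Removal.vertex).toFinset) (t := Finset.range n) (by
    intro x hx
    obtain ⟨r, hr, rfl⟩ := List.mem_map.1 (List.mem_toFinset.1 hx)
    exact Finset.mem_range.2 (h.vertex_lt r hr))
  rwa [List.toFinset_card_of_nodup h.nodup, List.length_map, Finset.card_range] at this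

namespace RealRAM

/-- The test whether the vertex in variable `3` can be removed as an ear. -/
def earTest : BExp :=
  .and (.nlt (.get 7 (entryAt 4 3)) (.const 2)) (.nlt (.get 7 (entryAt 5 3)) (.const 2))

/-- Remove the vertex in variable `3`, if possible. -/
def tryRemove : Cmd :=
  .ite (.nlt (.get 11 (.var 3)) (.const 1))
    (.ite (.nlt (.get 8 (.var 3)) (.const 2)) (.seq findNbr pendantCmd)
      (.ite (.nlt (.get 8 (.var 3)) (.const 3)) (.seq findNbrs (.ite earTest earCmd .skip)) .skip))
    .skip

/-- Take a vertex from the stack. -/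
def popCmd : Cmd := .block [.nset 1 (.sub (.var 1) (.const 1)), .nset 3 (.get 12 (.var 1))]

def elimLoop : Cmd := .loop (.nlt (.const 0) (.var 1)) (.seq popCmd tryRemove)

/-- All vertices that can be removed are on the stack, except possibly for those that satisfy
`P`. -/
structure Stacked (n : ℕ) (l : List Removal) (edge c : ℕ → ℕ → ℕ) (P : ℕ → Prop) (σ : State) :
    Prop where
  le : ∀ i < σ.nvar 1, σ.narr 12 i ≤ n
  mem : ∀ w, Removable n l edge c w → ¬ P w → ∃ i < σ.nvar 1, σ.narr 12 i = w

variable {n : ℕ} {R : ℕ → ℕ → Prop} {l : List Removal} {edge c : ℕ → ℕ → ℕ} {σ σ' : State}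

theorem pendantCmd_stack (σ : State) : (pendantCmd.step σ).nvar 1 = σ.nvar 1 + 1 ∧
    ∀ i, (pendantCmd.step σ).narr 12 i = if i = σ.nvar 1 then σ.nvar 4 else σ.narr 12 i := by
  constructor
  · simp [pendantCmd, recordCmd, dropCmd, pushCmd]
  · intro i
    simp [pendantCmd, recordCmd, dropCmd, pushCmd]

theorem earCmd_stack (σ : State) : (earCmd.step σ).nvar 1 = σ.nvar 1 + 2 ∧
    ∀ i, (earCmd.step σ).narr 12 i = if i = σ.nvar 1 + 1 then σ.nvar 5 else
      if i = σ.nvar 1 then σ.nvar 4 else σ.narr 12 i := by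
  by_cases e : σ.narr 6 (σ.narr 2 (σ.nvar 4) + σ.nvar 5) = 0 <;>
  simp [earCmd, recordCmd, dropCmd, pushCmd, swapCmd, entryAt, e]

/-- The effect of an attempt to remove the vertex `w`. -/
def Attempt (n : ℕ) (R : ℕ → ℕ → Prop) (l : List Removal) (σ σ' : State) : Prop :=
  ∃ l' edge' c', Sim n R l' edge' c' σ' ∧ Stacked n l' edge' c' (fun _ => False) σ' ∧
    σ'.nvar 1 + 3 * (n - l'.length) ≤ σ.nvar 1 + 3 * (n - l.length)

theorem Sim.attempt_skip (h : Sim n R l edge c σ) (hst : Stacked n l edge c (· = σ.nvar 3) σ)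
    (h0 : σ'.nvar 0 = σ.nvar 0) (h1 : σ'.nvar 1 = σ.nvar 1) (h2 : σ'.nvar 2 = σ.nvar 2)
    (ha : σ'.narr = σ.narr) (hno : ¬ Removable n l edge c (σ.nvar 3)) : Attempt n R l σ σ' := by
  refine ⟨l, edge, c, h.congr h0 h2 ha, ⟨?_, fun w hw _ => ?_⟩, by rw [h1]⟩
  · rw [h1, ha]; exact hst.le
  · rw [h1, ha]
    refine hst.mem w hw ?_
    rintro rfl
    exact hno hw

/-- A removal pushes one or two vertices, paid for by the three units that `3 * (n - length)` loses.
A failed attempt changes nothing, and the vertex in question need not be on the stack since it is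
not removable. -/
theorem Sim.tryRemove (h : Sim n R l edge c σ) (hst : Stacked n l edge c (· = σ.nvar 3) σ)
    (h3 : σ.nvar 3 ≤ n) : Attempt n R l σ (tryRemove.step σ) := by
  obtain ⟨w, hw3⟩ : ∃ w, σ.nvar 3 = w := ⟨_, rfl⟩
  by_cases hdead : σ.narr 11 w = 0
  swap
  · refine h.attempt_skip hst ?_ ?_ ?_ ?_ (fun hr => hdead ?_)
    rotate_right
    · exact (h.dead w (hw3 ▸ h3)).2 (hw3 ▸ hr.1)
    all_goals simp [RealRAM.tryRemove, hdead, hw3]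
  have hw := (h.dead w (hw3 ▸ h3)).1 hdead
  have hdeg := h.deg w hw
  rw [Finset.sum_const, smul_eq_mul, mul_one] at hdeg
  by_cases hd : σ.narr 8 w < 2
  · obtain ⟨u, hs, hN⟩ := h.findNbr hw hw3 hd
    have he : RealRAM.tryRemove.step σ = pendantCmd.step (σ.nset 4 u) := by
      rw [RealRAM.tryRemove, Cmd.step, if_pos (by simp [hw3, hdead]), Cmd.step,
        if_pos (by simpa [hw3] using hd), Cmd.step, hs]
    rw [he]
    have h' := (h.congr (σ' := σ.nset 4 u) (by simp) (by simp) (by simp)).pendant hw (by simp [hw3])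
      (by simp) hN
    refine ⟨_, _, _, h', ?_, ?_⟩
    · obtain ⟨e1, e2⟩ := pendantCmd_stack (σ.nset 4 u)
      simp only [State.nset_nvar, State.nset_narr, if_true,
        if_neg (by omega : ¬ (1 : ℕ) = 4)] at e1 e2
      have hu : u ≤ n := by
        rcases hN with hN | ⟨_, rfl⟩
        · exact (mem_alive.1 (mem_nbrs.1 (show u ∈ nbrs n l edge w by simp [hN])).1).1.le
        · exact le_rfl
      constructor
      · intro i hi
        rw [e2]
        split_ifs with e
        · exact hu
        · exact hst.le i (by omega)
      · intro x hx _
        rw [e1]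
        simp only [e2]
        by_cases hxu : x = u
        · exact ⟨σ.nvar 1, by omega, by rw [if_pos rfl, hxu]⟩
        · obtain ⟨h1, h2⟩ := hx.of_pendant h.elim.edge_symm
            (by rcases hN with hN | ⟨hN, _⟩ <;> simp [hN]) hxu
          obtain ⟨i, hi, e⟩ := hst.mem x h1 (hw3 ▸ h2)
          exact ⟨i, by omega, by rw [if_neg hi.ne, e]⟩
    · rw [(pendantCmd_stack _).1]
      have := h'.elim.history.length_le
      simp at this ⊢
      omega
  by_cases hd' : σ.narr 8 w = 2
  swap
  · refine h.attempt_skip hst ?_ ?_ ?_ ?_ fun hr => ?_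
    rotate_right
    · rw [hw3] at hr
      have := hr.2
      omega
    all_goals simp [RealRAM.tryRemove, hdead, hw3, hd, show ¬ σ.narr 8 w < 3 by omega]
  obtain ⟨d, u, v, hs, huv, hN⟩ := h.findNbrs hw hw3 hd'
  have he : RealRAM.tryRemove.step σ =
      (Cmd.ite earTest earCmd .skip).step (((σ.nset 7 d).nset 4 u).nset 5 v) := by
    rw [RealRAM.tryRemove, Cmd.step, if_pos (by simp [hw3, hdead]), Cmd.step,
      if_neg (by simpa [hw3] using hd), Cmd.step, if_pos (by simp [hw3, hd']), Cmd.step, hs]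
  rw [he]
  have hu := (mem_alive.1 (mem_nbrs.1 (show u ∈ nbrs n l edge w by simp [hN])).1).1
  have hv := (mem_alive.1 (mem_nbrs.1 (show v ∈ nbrs n l edge w by simp [hN])).1).1
  have hwn := (mem_alive.1 hw).1
  have ht : earTest.Holds (((σ.nset 7 d).nset 4 u).nset 5 v) ↔ c u w < 2 ∧ c v w < 2 := by
    simp [earTest, entryAt, h.tables.row u hu.le, h.tables.row v hv.le, hw3,
      h.cnt_eq u hu.le w hwn.le, h.cnt_eq v hv.le w hwn.le]
  by_cases hc : c u w < 2 ∧ c v w < 2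
  swap
  · rw [Cmd.step, if_neg (ht.not.2 hc)]
    refine h.attempt_skip hst (by simp) (by simp) (by simp) (by simp) fun hr => hc ?_
    rw [hw3] at hr
    have hr := (hr.2.resolve_left (by omega)).2
    have := hr u (by simp [hN])
    have := hr v (by simp [hN])
    omega
  rw [Cmd.step, if_pos (ht.2 hc)]
  have h' := (h.congr (σ' := ((σ.nset 7 d).nset 4 u).nset 5 v) (by simp) (by simp) (by simp)).ear hw
    (by simp [hw3]) (by simp) (by simp) huv hN (by omega) (by omega)
  refine ⟨_, _, _, h', ?_, ?_⟩
  · obtain ⟨e1, e2⟩ := earCmd_stack (((σ.nset 7 d).nset 4 u).nset 5 v)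
    simp [-Cmd.step] at e1 e2
    constructor
    · intro i hi
      rw [e2]
      split_ifs with e e'
      · exact hv.le
      · exact hu.le
      · exact hst.le i (by omega)
    · intro x hx _
      rw [e1]
      simp only [e2]
      by_cases hxu : x = u
      · exact ⟨σ.nvar 1, by omega, by rw [if_neg (by omega), if_pos rfl, hxu]⟩
      by_cases hxv : x = v
      · exact ⟨σ.nvar 1 + 1, by omega, by rw [if_pos rfl, hxv]⟩
      obtain ⟨h1, h2⟩ := hx.of_ear h.elim.edge_symm hN hxu hxv
      obtain ⟨i, hi, e⟩ := hst.mem x h1 (hw3 ▸ h2)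
      exact ⟨i, by omega, by rw [if_neg (by omega), if_neg hi.ne, e]⟩
  · rw [(earCmd_stack _).1]
    have := h'.elim.history.length_le
    simp at this ⊢
    omega

/-- Taking a vertex from the stack makes the potential, initially `4 * n`, strictly smaller in each
round. With an empty stack no vertex is removable, hence none is left by `Elim.exists_removable`. -/
theorem exec_elim : ∃ C, ∀ (n : ℕ) (R : ℕ → ℕ → Prop) (edge c : ℕ → ℕ → ℕ) (σ₀ : State),
    Sim n R [] edge c σ₀ → Stacked n [] edge c (fun _ => False) σ₀ → σ₀.nvar 1 = n →
    Exec elimLoop σ₀ (C * (n + 1)) fun σ =>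
      ∃ l edge c, Sim n R l edge c σ ∧ alive n l = ∅ := by
  refine ⟨(BExp.cost (.nlt (.const 0) (.var 1)) + (Cmd.seq popCmd tryRemove).bound) * 4,
    fun n R edge c σ₀ hS hst h1 => ?_⟩
  have h := Exec.loop (b := .nlt (.const 0) (.var 1)) (c := .seq popCmd RealRAM.tryRemove)
    (by simp [popCmd, RealRAM.tryRemove, findNbr, pendantCmd, recordCmd, dropCmd, pushCmd, findNbrs,
      earCmd, swapCmd])
    (I := fun σ => ∃ l edge c, Sim n R l edge c σ ∧ Stacked n l edge c (fun _ => False) σ)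
    (μ := fun σ => σ.nvar 1 + 3 * (n - σ.nvar 2)) (σ := σ₀) (fun σ hI hb => by
      obtain ⟨l, edge, c, hS, hst⟩ := hI
      have hpos : 0 < σ.nvar 1 := by simpa using hb
      have hS' : Sim n R l edge c (popCmd.step σ) :=
        hS.congr (by simp [popCmd]) (by simp [popCmd]) (by simp [popCmd])
      have p1 : (popCmd.step σ).nvar 1 = σ.nvar 1 - 1 := by simp [popCmd]
      have p3 : (popCmd.step σ).nvar 3 = σ.narr 12 (σ.nvar 1 - 1) := by simp [popCmd]
      have pa : (popCmd.step σ).narr = σ.narr := by simp [popCmd]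
      obtain ⟨l', edge', c', hS2, hst2, hle⟩ := hS'.tryRemove (by
        constructor
        · rw [p1, pa]; exact fun i hi => hst.le i (by omega)
        · intro w hw hne
          rw [p3] at hne
          obtain ⟨i, hi, e⟩ := hst.mem w hw (by simp)
          rw [p1, pa]
          refine ⟨i, ?_, e⟩
          rcases Nat.lt_or_ge i (σ.nvar 1 - 1) with h | h
          · exact h
          · obtain rfl : i = σ.nvar 1 - 1 := by omega
            exact absurd e.symm hne) (by rw [p3]; exact hst.le _ (by omega))
      refine ⟨⟨l', edge', c', hS2, hst2⟩, ?_⟩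
      rw [p1] at hle
      rw [Cmd.step, hS2.length, hS.length]
      omega) ⟨[], edge, c, hS, hst⟩
  refine h.mono ?_ ?_
  · rw [h1, hS.length, Nat.mul_assoc]
    refine Nat.mul_le_mul_left _ ?_
    simp; omega
  · rintro σ ⟨⟨l, edge, c, hS, hst⟩, hb⟩
    refine ⟨l, edge, c, hS, ?_⟩
    by_contra hne
    obtain ⟨w, hw⟩ := hS.elim.exists_removable (Finset.nonempty_iff_ne_empty.2 hne)
    obtain ⟨i, hi, -⟩ := hst.mem w hw (by simp)
    exact hb (by simpa using Nat.zero_lt_of_lt hi)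

end RealRAM

namespace RealRAM

/-! ### Drawing the triangles -/

/-- The point that is stored at the index `i` of the arrays `2 * k` and `2 * k + 1`. -/
def State.point (σ : State) (k i : ℕ) : ℝ × ℝ := (σ.rarr (2 * k) i, σ.rarr (2 * k + 1) i)

/-- Store a point at the index `i` of the arrays `2 * k` and `2 * k + 1`. -/
noncomputable def State.putPoint (σ : State) (k i : ℕ) (z : ℝ × ℝ) : State :=
  (σ.rput (2 * k) i z.1).rput (2 * k + 1) i z.2

theorem State.point_putPoint (σ : State) (k i k' i' : ℕ) (z : ℝ × ℝ) :
    (σ.putPoint k i z).point k' i' = if (k', i') = (k, i) then z else σ.point k' i' := by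
  have h1 : ¬ 2 * k' = 2 * k + 1 := by omega
  have h2 : ¬ 2 * k' + 1 = 2 * k := by omega
  simp [State.putPoint, State.point, h1, h2]
  split_ifs <;> rfl

/-- Store several points. -/
noncomputable def State.putPoints (σ : State) : List ((ℕ × ℕ) × (ℝ × ℝ)) → State
  | [] => σ
  | e :: es => (σ.putPoint e.1.1 e.1.2 e.2).putPoints es

theorem State.putPoints_nvar (σ : State) (es : List ((ℕ × ℕ) × (ℝ × ℝ))) :
    (σ.putPoints es).nvar = σ.nvar := by
  induction es generalizing σ with
  | nil => rfl
  | cons e es ih => rw [State.putPoints, ih]; rfl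

theorem State.putPoints_narr (σ : State) (es : List ((ℕ × ℕ) × (ℝ × ℝ))) :
    (σ.putPoints es).narr = σ.narr := by
  induction es generalizing σ with
  | nil => rfl
  | cons e es ih => rw [State.putPoints, ih]; rfl

theorem State.point_putPoints_of_notMem (σ : State) {es : List ((ℕ × ℕ) × (ℝ × ℝ))} {k i : ℕ}
    (h : (k, i) ∉ es.map Prod.fst) : (σ.putPoints es).point k i = σ.point k i := by
  induction es generalizing σ with
  | nil => rfl
  | cons e es ih =>
    rw [List.map_cons, List.mem_cons, not_or] at h
    rw [State.putPoints, ih _ h.2, State.point_putPoint, if_neg h.1]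

theorem State.point_putPoints (σ : State) {es : List ((ℕ × ℕ) × (ℝ × ℝ))} {k i : ℕ} {z : ℝ × ℝ}
    (hn : (es.map Prod.fst).Nodup) (h : ((k, i), z) ∈ es) : (σ.putPoints es).point k i = z := by
  induction es generalizing σ with
  | nil => simp at h
  | cons e es ih =>
    rw [List.map_cons, List.nodup_cons] at hn
    rw [State.putPoints]
    rcases List.mem_cons.1 h with rfl | h
    · rw [State.point_putPoints_of_notMem _ hn.1, State.point_putPoint, if_pos rfl]
    · exact ih _ hn.2 h

/-- The expression does not refer to arrays. -/
def RExp.ArrayFree : RExp → Prop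
  | .const _ => True
  | .var _ => True
  | .get _ _ => False
  | .add e f => e.ArrayFree ∧ f.ArrayFree
  | .sub e f => e.ArrayFree ∧ f.ArrayFree
  | .mul e f => e.ArrayFree ∧ f.ArrayFree
  | .div e f => e.ArrayFree ∧ f.ArrayFree

theorem RExp.ArrayFree.eval_congr {e : RExp} (h : e.ArrayFree) {σ σ' : State}
    (h' : σ'.rvar = σ.rvar) : e.eval σ' = e.eval σ := by
  induction e with
  | const k => rfl
  | var x => simp [h']
  | get a i => exact h.elim
  | add e f he hf => simp [he h.1, hf h.2]
  | sub e f he hf => simp [he h.1, hf h.2]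
  | mul e f he hf => simp [he h.1, hf h.2]
  | div e f he hf => simp [he h.1, hf h.2]

theorem NExp.eval_congr (e : NExp) {σ σ' : State} (h : σ'.nvar = σ.nvar) (h' : σ'.narr = σ.narr) :
    e.eval σ' = e.eval σ := by
  induction e with
  | const k => rfl
  | var x => simp [h]
  | get a i ih => simp [h', ih]
  | add e f he hf => simp [he, hf]
  | sub e f he hf => simp [he, hf]

/-- The coordinate frame in the real variables `0`, …, `5`. -/
def State.frame (σ : State) (z : ℝ × ℝ) : ℝ × ℝ :=
  (σ.rvar 0 + (z.1 * σ.rvar 2 + z.2 * σ.rvar 4), σ.rvar 1 + (z.1 * σ.rvar 3 + z.2 * σ.rvar 5))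

/-- A point to be stored: its position, and its coordinates with respect to the frame. -/
structure Spot where
  array : ℕ
  index : NExp
  fst : RExp
  snd : RExp

/-- Store a point that is given by coordinates with respect to the frame. -/
def Spot.cmd (e : Spot) : Cmd := .seq
  (.rput (2 * e.array) e.index
    (.add (.var 0) (.add (.mul e.fst (.var 2)) (.mul e.snd (.var 4)))))
  (.rput (2 * e.array + 1) e.index
    (.add (.var 1) (.add (.mul e.fst (.var 3)) (.mul e.snd (.var 5)))))

def Spot.ArrayFree (e : Spot) : Prop := e.fst.ArrayFree ∧ e.snd.ArrayFree

/-- The position and the value of the point. -/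
noncomputable def Spot.entry (σ : State) (e : Spot) : (ℕ × ℕ) × (ℝ × ℝ) :=
  ((e.array, e.index.eval σ), σ.frame (e.fst.eval σ, e.snd.eval σ))

theorem Spot.step_cmd {e : Spot} (h : e.ArrayFree) (σ : State) :
    e.cmd.step σ = σ.putPoint (e.entry σ).1.1 (e.entry σ).1.2 (e.entry σ).2 := by
  unfold Spot.cmd
  simp only [Cmd.step, RExp.eval]
  rw [NExp.eval_congr e.index (σ' := σ.rput _ _ _) (σ := σ) rfl rfl,
    h.1.eval_congr (σ' := σ.rput _ _ _) (σ := σ) rfl,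
    h.2.eval_congr (σ' := σ.rput _ _ _) (σ := σ) rfl]
  rfl

/-- Store several points. -/
def drawCmd (es : List Spot) : Cmd := .block (es.map Spot.cmd)

/-- The stored values depend on real variables and natural numbers only, which storing a point does
not change; so all of them may be evaluated in the initial state. -/
theorem step_drawCmd {es : List Spot} (h : ∀ e ∈ es, e.ArrayFree) (σ : State) :
    (drawCmd es).step σ = σ.putPoints (es.map (Spot.entry σ)) := by
  induction es generalizing σ with
  | nil => rfl
  | cons e es ih =>
    rw [drawCmd, List.map_cons, Cmd.block, Cmd.step, Spot.step_cmd (h e List.mem_cons_self),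
      ← drawCmd, ih (fun e he => h e (List.mem_cons_of_mem _ he)), List.map_cons, State.putPoints]
    congr 1
    refine List.map_congr_left fun e' he' => ?_
    have h' := h e' (List.mem_cons_of_mem _ he')
    unfold Spot.entry
    rw [NExp.eval_congr e'.index (σ' := σ.putPoint _ _ _) (σ := σ) rfl rfl,
      h'.1.eval_congr (σ' := σ.putPoint _ _ _) (σ := σ) rfl,
      h'.2.eval_congr (σ' := σ.putPoint _ _ _) (σ := σ) rfl]
    rfl

theorem loopFree_drawCmd (es : List Spot) : (drawCmd es).LoopFree := by
  induction es with
  | nil => simp [drawCmd]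
  | cons e es ih => exact ⟨by simp [Spot.cmd], ih⟩

/-- The index of the region with the key `(a, b, k)`. -/
def code (n a b k : ℕ) : ℕ := a * (n + 1) + b + k * ((n + 1) * (n + 1))

/-- The code has `k`, `a`, `b` as digits in base `n + 1`, the leading digit being unrestricted. -/
theorem code_inj_iff {n a b k a' b' k' : ℕ} (ha : a ≤ n) (hb : b ≤ n) (ha' : a' ≤ n)
    (hb' : b' ≤ n) : code n a b k = code n a' b' k' ↔ a = a' ∧ b = b' ∧ k = k' := by
  have h : ∀ a b k, code n a b k = (k * (n + 1) + a) * (n + 1) + b := fun a b k => by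
    unfold code; ring
  rw [h, h, code_inj hb hb', code_inj ha ha']
  tauto

/-- The corners of triangles in the memory. -/
def State.triangle (σ : State) (x : ℕ) (i : Fin 3) : ℝ × ℝ := σ.point i x

/-- The points of regions in the memory. -/
def State.keyed (σ : State) (n j a b k : ℕ) : ℝ × ℝ :=
  if a ≤ n ∧ b ≤ n ∧ k < 2 then σ.point j (code n a b k) else 0

/-- The position of the second region for the vertices in variables `y` and `z`. -/
def entryAt' (y z : ℕ) : NExp := .add (entryAt y z) (.var 6)

/-- Set the frame to the region with the apex at the index `i` and the arms at `j` and `k`. -/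
def frameCmd (i j k : NExp) : Cmd := .block
  [.rset 0 (.get 6 i), .rset 1 (.get 7 i),
   .rset 2 (.div (.sub (.get 8 j) (.var 0)) (.const 16)),
   .rset 3 (.div (.sub (.get 9 j) (.var 1)) (.const 16)),
   .rset 4 (.div (.sub (.get 8 k) (.var 0)) (.const 16)),
   .rset 5 (.div (.sub (.get 9 k) (.var 1)) (.const 16))]

/-- Set the real variable `x` to one if the vertex in variable `y` was a neighbour of that in
variable `3` in the beginning, and to zero otherwise. -/
def realCmd (x y : ℕ) : Cmd :=
  .ite (.nlt (.const 1) (.get 6 (entryAt y 3))) (.rset x (.const 1)) (.rset x (.const 0))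

/-- The first entries of the spots `0`, `1`, `2` are corners, `3` stands for apexes and `4` for ends
of arms, with the coordinates of `Layout.ear`. The real variables `6` and `7` hold its parameters
`l` and `m`. -/
def earSpots : List Spot :=
  [⟨0, .var 3, .const 0, .const 0⟩,
   ⟨1, .var 3, .add (.const 6) (.mul (.const 2) (.var 6)),
    .sub (.const 2) (.mul (.const 2) (.var 6))⟩,
   ⟨2, .var 3, .sub (.const 2) (.mul (.const 2) (.var 7)),
    .add (.const 6) (.mul (.const 2) (.var 7))⟩,
   ⟨3, entryAt 4 3, .mul (.const 8) (.var 6), .const 0⟩,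
   ⟨3, entryAt 3 4, .mul (.const 8) (.var 6), .const 0⟩,
   ⟨3, entryAt 5 3, .const 0, .mul (.const 8) (.var 7)⟩,
   ⟨3, entryAt 3 5, .const 0, .mul (.const 8) (.var 7)⟩,
   ⟨3, entryAt 3 3, .const 5, .const 3⟩,
   ⟨4, entryAt 4 3, .const 12, .const 0⟩,
   ⟨4, entryAt 3 4, .const 6, .const 2⟩,
   ⟨4, entryAt 5 3, .const 0, .const 12⟩,
   ⟨4, entryAt 3 5, .const 2, .const 6⟩,
   ⟨4, entryAt 3 3, .const 3, .const 5⟩,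
   ⟨4, entryAt' 3 3, .const 6, .const 6⟩]

/-- The coordinates of `Layout.pendant`, with its parameter `l` in the real variable `6`. -/
def pendantSpots : List Spot :=
  [⟨0, .var 3, .const 4, .const 0⟩,
   ⟨1, .var 3, .add (.const 6) (.mul (.const 2) (.var 6)),
    .sub (.const 2) (.mul (.const 2) (.var 6))⟩,
   ⟨2, .var 3, .const 4, .const 4⟩,
   ⟨3, entryAt 4 3, .const 4, .const 0⟩,
   ⟨3, entryAt 3 4, .const 4, .const 0⟩,
   ⟨3, entryAt' 4 3, .add (.const 4) (.mul (.const 4) (.var 6)), .const 0⟩,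
   ⟨3, entryAt' 3 4, .add (.const 4) (.mul (.const 4) (.var 6)), .const 0⟩,
   ⟨3, entryAt 3 3, .const 5, .const 3⟩,
   ⟨3, entryAt 4 4, .const 12, .const 0⟩,
   ⟨4, entryAt 4 3, .const 2, .const 0⟩,
   ⟨4, entryAt 3 4, .const 4, .const 2⟩,
   ⟨4, entryAt' 4 3, .const 10, .const 0⟩,
   ⟨4, entryAt' 3 4, .const 6, .const 2⟩,
   ⟨4, entryAt 3 3, .const 4, .const 4⟩,
   ⟨4, entryAt' 3 3, .const 6, .const 4⟩,
   ⟨4, entryAt 4 4, .const 16, .const 0⟩,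
   ⟨4, entryAt' 4 4, .const 12, .const 2⟩]

/-- Insert the triangle of an ear. -/
def drawEar : Cmd := .block
  [frameCmd (.add (entryAt 4 5) (.var 7)) (.add (entryAt 4 5) (.var 7))
    (.add (entryAt 5 4) (.var 7)), realCmd 6 4, realCmd 7 5, drawCmd earSpots]

/-- Insert a triangle that is attached to a single triangle. -/
def drawPendant : Cmd := .block
  [frameCmd (entryAt 4 4) (entryAt 4 4) (entryAt' 4 4), realCmd 6 4, drawCmd pendantSpots]

/-- Read the last removal. -/
def recallCmd : Cmd := .block
  [.nset 2 (.sub (.var 2) (.const 1)), .nset 3 (.get 13 (.var 2)), .nset 4 (.get 14 (.var 2)),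
   .nset 5 (.get 15 (.var 2)),
   .ite (.nlt (.get 16 (.var 2)) (.const 1)) (.nset 7 (.const 0)) (.nset 7 (.var 6))]

/-- Undo the last removal. -/
def undoCmd : Cmd := .seq recallCmd
  (.ite (.and (.not (.nlt (.var 4) (.var 5))) (.not (.nlt (.var 5) (.var 4)))) drawPendant drawEar)

def undoLoop : Cmd := .loop (.nlt (.const 0) (.var 2)) undoCmd

/-- Draw the triangle of the root. -/
def rootCmd : Cmd := .block
  [.nset 6 (.add (.get 2 (.var 0)) (.add (.var 0) (.const 1))), .nset 3 (.var 0),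
   .rput 0 (.var 3) (.const 0), .rput 1 (.var 3) (.const 1),
   .rput 2 (.var 3) (.const 1), .rput 3 (.var 3) (.const 1),
   .rput 4 (.var 3) (.const 0), .rput 5 (.var 3) (.const 0),
   .rput 6 (entryAt 3 3) (.const 0), .rput 7 (entryAt 3 3) (.const 1),
   .rput 8 (entryAt 3 3) (.const 1), .rput 9 (entryAt 3 3) (.const 1),
   .rput 8 (entryAt' 3 3) (.const 0), .rput 9 (entryAt' 3 3) (.const 2)]

/-- The natural numbers in the memory while the triangles are drawn. -/
structure Prepared (n : ℕ) (R : ℕ → ℕ → Prop) (σ : State) : Prop where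
  size : σ.nvar 0 = n
  row : ∀ x ≤ n, σ.narr 2 x = x * (n + 1)
  real : ∀ x ≤ n, ∀ y ≤ n, 1 < σ.narr 6 (x * (n + 1) + y) ↔ R x y
  shift : σ.nvar 6 = (n + 1) * (n + 1)

variable {n : ℕ} {R : ℕ → ℕ → Prop} {l : List Removal} {c : ℕ → ℕ → ℕ} {σ σ' : State}

theorem Prepared.congr (h : Prepared n R σ) (h0 : σ'.nvar 0 = σ.nvar 0)
    (h6 : σ'.nvar 6 = σ.nvar 6) (ha : σ'.narr = σ.narr) : Prepared n R σ' := by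
  obtain ⟨a1, a2, a3, a4⟩ := h
  exact ⟨h0 ▸ a1, ha ▸ a2, ha ▸ a3, h6 ▸ a4⟩

theorem State.keyed_eq {a b k : ℕ} (σ : State) (j : ℕ) (ha : a ≤ n) (hb : b ≤ n) (hk : k < 2) :
    σ.keyed n j a b k = σ.point j (code n a b k) := if_pos ⟨ha, hb, hk⟩

end RealRAM

/-! ### Correctness of a single drawing step -/

namespace RealRAM

variable {n : ℕ} {R : ℕ → ℕ → Prop} {l : List Removal} {c : ℕ → ℕ → ℕ} {σ σ' : State}

theorem Prepared.entryAt (h : Prepared n R σ) {y z a b : ℕ} (hy : σ.nvar y = a) (hz : σ.nvar z = b)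
    (ha : a ≤ n) : (entryAt y z).eval σ = code n a b 0 := by
  simp [RealRAM.entryAt, code, hy, hz, h.row a ha]

theorem Prepared.entryAt' (h : Prepared n R σ) {y z a b : ℕ} (hy : σ.nvar y = a)
    (hz : σ.nvar z = b) (ha : a ≤ n) : (entryAt' y z).eval σ = code n a b 1 := by
  simp [RealRAM.entryAt', RealRAM.entryAt, code, hy, hz, h.row a ha, h.shift]

theorem frameCmd_step (σ : State) (i j k : NExp) :
    ((frameCmd i j k).step σ).nvar = σ.nvar ∧ ((frameCmd i j k).step σ).narr = σ.narr ∧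
    ((frameCmd i j k).step σ).rarr = σ.rarr ∧
    ((frameCmd i j k).step σ).frame = _root_.frame (σ.point 3 (i.eval σ)) (σ.point 4 (j.eval σ))
      (σ.point 4 (k.eval σ)) := by
  refine ⟨rfl, rfl, rfl, ?_⟩
  have e : ∀ (e : NExp) (σ : State) (x : ℕ) (r : ℝ), e.eval (σ.rset x r) = e.eval σ :=
    fun e σ x r => e.eval_congr rfl rfl
  funext z
  ext
  · simp [frameCmd, State.frame, _root_.frame, State.point, e]
    ring
  · simp [frameCmd, State.frame, _root_.frame, State.point, e]
    ring

/-- Original edges keep the matrix entry `2` throughout the elimination and additional ones have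
`1`, so one comparison decides whether the contact has to be a segment. -/
theorem Prepared.realCmd (h : Prepared n R σ) {x y u w : ℕ} (h3 : σ.nvar 3 = w)
    (hy : σ.nvar y = u) (hu : u ≤ n) (hw : w ≤ n) : ∃ s : ℝ,
    ((R u w ∧ s = 1) ∨ (¬ R u w ∧ s = 0)) ∧ (realCmd x y).step σ = σ.rset x s := by
  have := h.real u hu w hw
  by_cases hR : R u w
  · refine ⟨1, Or.inl ⟨hR, rfl⟩, ?_⟩
    rw [← this] at hR
    simp [RealRAM.realCmd, RealRAM.entryAt, h3, hy, h.row u hu, hR]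
  · refine ⟨0, Or.inr ⟨hR, rfl⟩, ?_⟩
    rw [← this] at hR
    simp [RealRAM.realCmd, RealRAM.entryAt, h3, hy, h.row u hu, hR]

theorem frame_rset (σ : State) {x : ℕ} (hx : 6 ≤ x) (r : ℝ) : (σ.rset x r).frame = σ.frame := by
  funext z
  simp only [State.frame, State.rset_rvar]
  rw [if_neg, if_neg, if_neg, if_neg, if_neg, if_neg] <;> omega

theorem point_congr (h : σ'.rarr = σ.rarr) (k i : ℕ) : σ'.point k i = σ.point k i := by
  simp [State.point, h]

theorem earSpots_arrayFree : ∀ e ∈ earSpots, e.ArrayFree := by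
  simp [earSpots, Spot.ArrayFree, RExp.ArrayFree]

theorem pendantSpots_arrayFree : ∀ e ∈ pendantSpots, e.ArrayFree := by
  simp [pendantSpots, Spot.ArrayFree, RExp.ArrayFree]

/-- The layout in the memory. -/
def InMemory (n : ℕ) (R : ℕ → ℕ → Prop) (l : List Removal) (c : ℕ → ℕ → ℕ) (σ : State) : Prop :=
  LayoutAt n R l c σ.triangle (σ.keyed n 3) (σ.keyed n 4)

/-- The list `es` of stored points supplies, entry by entry, the equations that
`LayoutAt.undo_pendant` demands; no entry spoils another because their positions are distinct. -/
theorem InMemory.drawPendant {u w i : ℕ} (L : InMemory n R (⟨w, u, u, i⟩ :: l) c σ)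
    (hp : Prepared n R σ) (h3 : σ.nvar 3 = w) (h4 : σ.nvar 4 = u)
    (hR : ∀ x y, R x y → R y x) (hc : ∀ a b, c a b = c b a)
    (hw : Present n l w) (hu : Present n l u) (huw : u ≠ w) (cu : c u w ≤ 2)
    (hx : ∀ x, Present n l x → x ≠ u → x ≠ w → c x w = 0 ∧ ¬ R x w) :
    (drawPendant.step σ).nvar = σ.nvar ∧ (drawPendant.step σ).narr = σ.narr ∧
      InMemory n R l c (drawPendant.step σ) := by
  have hun := hu.1
  have hwn := hw.1
  have hwu := huw.symm
  obtain ⟨f1, f2, f3, f4⟩ := frameCmd_step σ (entryAt 4 4) (entryAt 4 4) (entryAt' 4 4)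
  set ρ₀ := (frameCmd (entryAt 4 4) (entryAt 4 4) (entryAt' 4 4)).step σ
  have hp₀ : Prepared n R ρ₀ := hp.congr (by rw [f1]) (by rw [f1]) f2
  obtain ⟨s, hs, er⟩ := hp₀.realCmd (x := 6) (by rw [f1, h3]) (by rw [f1, h4]) hun hwn
  set ρ := ρ₀.rset 6 s with hρ
  have hpρ : Prepared n R ρ := hp₀.congr rfl rfl rfl
  have hstep : RealRAM.drawPendant.step σ = ρ.putPoints (pendantSpots.map (Spot.entry ρ)) := by
    rw [← step_drawCmd pendantSpots_arrayFree, ← er]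
    rfl
  have e3 : ρ.nvar 3 = w := by rw [hρ, State.rset_nvar, f1, h3]
  have e4 : ρ.nvar 4 = u := by rw [hρ, State.rset_nvar, f1, h4]
  have e6 : ρ.rvar 6 = s := by rw [hρ, State.rset_rvar, if_pos rfl]
  have hφ : ρ.frame = frame (σ.keyed n 3 u u 0) (σ.keyed n 4 u u 0) (σ.keyed n 4 u u 1) := by
    rw [hρ, frame_rset _ le_rfl, f4, hp.entryAt h4 h4 hun, hp.entryAt' h4 h4 hun,
      σ.keyed_eq 3 hun hun two_pos, σ.keyed_eq 4 hun hun two_pos, σ.keyed_eq 4 hun hun one_lt_two]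
  have hpt : ∀ k i, ρ.point k i = σ.point k i := point_congr f3
  set φ := ρ.frame
  have hes : pendantSpots.map (Spot.entry ρ) =
      [((0, w), φ (4, 0)), ((1, w), φ (6 + 2 * s, 2 - 2 * s)), ((2, w), φ (4, 4)),
       ((3, code n u w 0), φ (4, 0)), ((3, code n w u 0), φ (4, 0)),
       ((3, code n u w 1), φ (4 + 4 * s, 0)), ((3, code n w u 1), φ (4 + 4 * s, 0)),
       ((3, code n w w 0), φ (5, 3)), ((3, code n u u 0), φ (12, 0)),
       ((4, code n u w 0), φ (2, 0)), ((4, code n w u 0), φ (4, 2)),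
       ((4, code n u w 1), φ (10, 0)), ((4, code n w u 1), φ (6, 2)),
       ((4, code n w w 0), φ (4, 4)), ((4, code n w w 1), φ (6, 4)),
       ((4, code n u u 0), φ (16, 0)), ((4, code n u u 1), φ (12, 2))] := by
    simp only [pendantSpots, Spot.entry, List.map_cons, List.map_nil, RExp.eval, NExp.eval,
      hpρ.entryAt e3 e3 hwn, hpρ.entryAt e3 e4 hwn, hpρ.entryAt e4 e3 hun, hpρ.entryAt e4 e4 hun,
      hpρ.entryAt' e3 e3 hwn, hpρ.entryAt' e3 e4 hwn, hpρ.entryAt' e4 e3 hun,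
      hpρ.entryAt' e4 e4 hun, e3, e6, Nat.cast_ofNat, Nat.cast_zero]
    rfl
  rw [hstep]
  set es := pendantSpots.map (Spot.entry ρ)
  have hnd : (es.map Prod.fst).Nodup := by
    rw [hes]
    simp [code_inj_iff, hun, hwn, huw, hwu]
  refine ⟨by rw [State.putPoints_nvar]; exact f1, by rw [State.putPoints_narr]; exact f2, ?_⟩
  have get : ∀ {k i z}, ((k, i), z) ∈ es → (ρ.putPoints es).point k i = z :=
    fun h => State.point_putPoints ρ hnd h
  have key : ∀ {j a b k z}, a ≤ n → b ≤ n → k < 2 → ((j, code n a b k), z) ∈ es →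
      (ρ.putPoints es).keyed n j a b k = z := by
    intro j a b k z ha hb hk h
    rw [State.keyed_eq _ _ ha hb hk, get h]
  -- For keys out of range `keyed` is zero on both sides; within the range codes are injective, so
  -- no stored position coincides with this one.
  have hold : ∀ a b k, a ≠ w → b ≠ w → ¬ (a = u ∧ b = u) → ∀ j, j = 3 ∨ j = 4 →
      (ρ.putPoints es).keyed n j a b k = σ.keyed n j a b k := by
    intro a b k ha hb hab j hj
    unfold State.keyed
    split_ifs with h
    · rw [State.point_putPoints_of_notMem, hpt]
      rw [hes]
      obtain rfl | rfl := hj <;> simp [code_inj_iff, hun, hwn, h, ha, hb] <;> tauto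
    · rfl
  refine LayoutAt.undo_pendant L hR hc hw hu huw cu hx hs hφ ?_ ?_ ?_ ?_
    (fun a b k ha hb hab => ⟨hold a b k ha hb hab 3 (Or.inl rfl),
      hold a b k ha hb hab 4 (Or.inr rfl)⟩)
    ?_ ?_ ?_ ?_ ?_ ?_ ?_ ?_ ?_ ?_ ?_ ?_ ?_ ?_
  · intro x hx
    funext i
    unfold State.triangle
    rw [State.point_putPoints_of_notMem, hpt]
    rw [hes]
    fin_cases i <;> simp [hx]
  · exact get (by rw [hes]; simp)
  · exact get (by rw [hes]; simp)
  · exact get (by rw [hes]; simp)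
  all_goals exact key (by assumption) (by assumption) (by norm_num) (by rw [hes]; simp)

theorem InMemory.drawEar {u v w : ℕ} (L : InMemory n R (⟨w, u, v, c u v⟩ :: l) (raise c u v) σ)
    (hp : Prepared n R σ) (h3 : σ.nvar 3 = w) (h4 : σ.nvar 4 = u) (h5 : σ.nvar 5 = v)
    (h7 : σ.nvar 7 = c u v * ((n + 1) * (n + 1)))
    (hR : ∀ x y, R x y → R y x) (hc : ∀ a b, c a b = c b a)
    (hw : Present n l w) (hu : Present n l u) (hv : Present n l v) (huw : u ≠ w) (hvw : v ≠ w)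
    (huv : u ≠ v) (cu : c u w ≤ 1) (cv : c v w ≤ 1) (cuv : c u v ≤ 1)
    (hx : ∀ x, Present n l x → x ≠ u → x ≠ v → x ≠ w → c x w = 0 ∧ ¬ R x w) :
    (drawEar.step σ).nvar = σ.nvar ∧ (drawEar.step σ).narr = σ.narr ∧
      InMemory n R l c (drawEar.step σ) := by
  have hun := hu.1
  have hvn := hv.1
  have hwn := hw.1
  have hwu := huw.symm
  have hwv := hvw.symm
  have hvu := huv.symm
  obtain ⟨f1, f2, f3, f4⟩ := frameCmd_step σ (.add (entryAt 4 5) (.var 7))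
    (.add (entryAt 4 5) (.var 7)) (.add (entryAt 5 4) (.var 7))
  set ρ₀ := (frameCmd (.add (entryAt 4 5) (.var 7)) (.add (entryAt 4 5) (.var 7))
    (.add (entryAt 5 4) (.var 7))).step σ
  have hp₀ : Prepared n R ρ₀ := hp.congr (by rw [f1]) (by rw [f1]) f2
  obtain ⟨s, hs, er⟩ := hp₀.realCmd (x := 6) (by rw [f1, h3]) (by rw [f1, h4]) hun hwn
  set ρ₁ := ρ₀.rset 6 s with hρ₁
  have hp₁ : Prepared n R ρ₁ := hp₀.congr rfl rfl rfl
  obtain ⟨m, hm, er'⟩ := hp₁.realCmd (x := 7) (w := w) (u := v) (y := 5)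
    (by rw [hρ₁, State.rset_nvar, f1, h3]) (by rw [hρ₁, State.rset_nvar, f1, h5]) hvn hwn
  set ρ := ρ₁.rset 7 m with hρ
  have hpρ : Prepared n R ρ := hp₁.congr rfl rfl rfl
  have hstep : RealRAM.drawEar.step σ = ρ.putPoints (earSpots.map (Spot.entry ρ)) := by
    rw [← step_drawCmd earSpots_arrayFree, ← er', ← er]
    rfl
  have e3 : ρ.nvar 3 = w := by rw [hρ, State.rset_nvar, hρ₁, State.rset_nvar, f1, h3]
  have e4 : ρ.nvar 4 = u := by rw [hρ, State.rset_nvar, hρ₁, State.rset_nvar, f1, h4]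
  have e5 : ρ.nvar 5 = v := by rw [hρ, State.rset_nvar, hρ₁, State.rset_nvar, f1, h5]
  have e6 : ρ.rvar 6 = s := by simp [hρ, hρ₁]
  have e7 : ρ.rvar 7 = m := by simp [hρ]
  have c2 : c u v < 2 := by omega
  -- The natural variable `7` holds the offset of the slot, which is added to the code with last
  -- entry zero.
  have shift : ∀ a b, code n a b 0 + c u v * ((n + 1) * (n + 1)) = code n a b (c u v) := by
    intro a b; simp [code]
  have hφ : ρ.frame = frame (σ.keyed n 3 u v (c u v)) (σ.keyed n 4 u v (c u v))
      (σ.keyed n 4 v u (c u v)) := by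
    rw [hρ, frame_rset _ (by norm_num), hρ₁, frame_rset _ le_rfl, f4]
    simp only [NExp.eval]
    rw [hp.entryAt h4 h5 hun, hp.entryAt h5 h4 hvn, h7, shift, shift,
      σ.keyed_eq 3 hun hvn c2, σ.keyed_eq 4 hun hvn c2, σ.keyed_eq 4 hvn hun c2]
  have hpt : ∀ k i, ρ.point k i = σ.point k i := point_congr f3
  set φ := ρ.frame
  have hes : earSpots.map (Spot.entry ρ) =
      [((0, w), φ (0, 0)), ((1, w), φ (6 + 2 * s, 2 - 2 * s)), ((2, w), φ (2 - 2 * m, 6 + 2 * m)),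
       ((3, code n u w 0), φ (8 * s, 0)), ((3, code n w u 0), φ (8 * s, 0)),
       ((3, code n v w 0), φ (0, 8 * m)), ((3, code n w v 0), φ (0, 8 * m)),
       ((3, code n w w 0), φ (5, 3)),
       ((4, code n u w 0), φ (12, 0)), ((4, code n w u 0), φ (6, 2)),
       ((4, code n v w 0), φ (0, 12)), ((4, code n w v 0), φ (2, 6)),
       ((4, code n w w 0), φ (3, 5)), ((4, code n w w 1), φ (6, 6))] := by
    simp only [earSpots, Spot.entry, List.map_cons, List.map_nil, RExp.eval, NExp.eval,
      hpρ.entryAt e3 e3 hwn, hpρ.entryAt e3 e4 hwn, hpρ.entryAt e4 e3 hun, hpρ.entryAt e3 e5 hwn,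
      hpρ.entryAt e5 e3 hvn, hpρ.entryAt' e3 e3 hwn, e3, e6, e7, Nat.cast_ofNat, Nat.cast_zero]
    rfl
  rw [hstep]
  set es := earSpots.map (Spot.entry ρ)
  have hnd : (es.map Prod.fst).Nodup := by
    rw [hes]
    simp [code_inj_iff, hun, hvn, hwn, huw, hwu, hvw, hwv, huv, hvu]
  refine ⟨by rw [State.putPoints_nvar]; exact f1, by rw [State.putPoints_narr]; exact f2, ?_⟩
  have get : ∀ {k i z}, ((k, i), z) ∈ es → (ρ.putPoints es).point k i = z :=
    fun h => State.point_putPoints ρ hnd h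
  have key : ∀ {j a b k z}, a ≤ n → b ≤ n → k < 2 → ((j, code n a b k), z) ∈ es →
      (ρ.putPoints es).keyed n j a b k = z := by
    intro j a b k z ha hb hk h
    rw [State.keyed_eq _ _ ha hb hk, get h]
  have hold : ∀ a b k, a ≠ w → b ≠ w → ∀ j, j = 3 ∨ j = 4 →
      (ρ.putPoints es).keyed n j a b k = σ.keyed n j a b k := by
    intro a b k ha hb j hj
    unfold State.keyed
    split_ifs with h
    · rw [State.point_putPoints_of_notMem, hpt]
      rw [hes]
      obtain rfl | rfl := hj <;> simp [code_inj_iff, hun, hvn, hwn, h, ha, hb]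
    · rfl
  refine LayoutAt.undo_ear L hR hc hw hu hv huw hvw huv cu cv hx hs hm hφ ?_ ?_ ?_ ?_
    (fun a b k ha hb => ⟨hold a b k ha hb 3 (Or.inl rfl), hold a b k ha hb 4 (Or.inr rfl)⟩)
    ?_ ?_ ?_ ?_ ?_ ?_ ?_ ?_ ?_ ?_ ?_
  · intro x hx
    funext i
    unfold State.triangle
    rw [State.point_putPoints_of_notMem, hpt]
    rw [hes]
    fin_cases i <;> simp [hx]
  · exact get (by rw [hes]; simp)
  · exact get (by rw [hes]; simp)
  · exact get (by rw [hes]; simp)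
  all_goals exact key (by assumption) (by assumption) (by norm_num) (by rw [hes]; simp)

end RealRAM

/-! ### Undoing all removals -/

namespace RealRAM

variable {n : ℕ} {R : ℕ → ℕ → Prop} {l : List Removal} {edge c : ℕ → ℕ → ℕ} {σ σ' : State}

theorem InMemory.congr (L : InMemory n R l c σ) (h : σ'.rarr = σ.rarr) : InMemory n R l c σ' := by
  have hp : ∀ k i, σ'.point k i = σ.point k i := point_congr h
  have h1 : σ'.triangle = σ.triangle := by
    funext x i; exact hp _ _
  have h2 : ∀ j, σ'.keyed n j = σ.keyed n j := by
    intro j; funext a b k; simp only [State.keyed, hp]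
  unfold InMemory
  rw [h1, h2, h2]
  exact L

/-- The invariant while removals are undone. -/
def Undoing (n : ℕ) (R : ℕ → ℕ → Prop) (σ : State) : Prop :=
  ∃ l c, History n R l c ∧ InMemory n R l c σ ∧ Prepared n R σ ∧ σ.nvar 2 = l.length ∧ Stored σ l

theorem Undoing.step (h : Undoing n R σ) (hR : ∀ x y, R x y → R y x) (hpos : 0 < σ.nvar 2) :
    Undoing n R (undoCmd.step σ) ∧ (undoCmd.step σ).nvar 2 = σ.nvar 2 - 1 := by
  obtain ⟨l, c, hH, hL, hp, hlen, hst⟩ := h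
  cases l with
  | nil => rw [hlen] at hpos; exact absurd hpos (lt_irrefl _)
  | cons r l =>
    obtain ⟨⟨s1, s2, s3, s4⟩, hst'⟩ := hst
    have hlen' : σ.nvar 2 - 1 = l.length := by rw [hlen]; simp
    set ρ := recallCmd.step σ with hρ
    have hrarr : ρ.rarr = σ.rarr := by
      by_cases e : r.slot = 0 <;> simp [hρ, recallCmd, hlen', s4, e]
    have hnarr : ρ.narr = σ.narr := by
      by_cases e : r.slot = 0 <;> simp [hρ, recallCmd, hlen', s4, e]
    have e0 : ρ.nvar 0 = σ.nvar 0 := by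
      by_cases e : r.slot = 0 <;> simp [hρ, recallCmd, hlen', s4, e]
    have e2 : ρ.nvar 2 = l.length := by
      by_cases e : r.slot = 0 <;> simp [hρ, recallCmd, hlen', s4, e]
    have e3 : ρ.nvar 3 = r.vertex := by
      by_cases e : r.slot = 0 <;> simp [hρ, recallCmd, hlen', s1, s4, e]
    have e4 : ρ.nvar 4 = r.left := by
      by_cases e : r.slot = 0 <;> simp [hρ, recallCmd, hlen', s2, s4, e]
    have e5 : ρ.nvar 5 = r.right := by
      by_cases e : r.slot = 0 <;> simp [hρ, recallCmd, hlen', s3, s4, e]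
    have e6 : ρ.nvar 6 = σ.nvar 6 := by
      by_cases e : r.slot = 0 <;> simp [hρ, recallCmd, hlen', s4, e]
    have e7 : ρ.nvar 7 = if r.slot = 0 then 0 else σ.nvar 6 := by
      by_cases e : r.slot = 0 <;> simp [hρ, recallCmd, hlen', s4, e]
    have hpρ : Prepared n R ρ := hp.congr e0 e6 hnarr
    have hLρ : InMemory n R (r :: l) c ρ := hL.congr hrarr
    have hstep : undoCmd.step σ =
        if r.left = r.right then drawPendant.step ρ else drawEar.step ρ := by
      rw [undoCmd, Cmd.step, ← hρ, Cmd.step]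
      congr 1
      simp only [BExp.Holds, NExp.eval, e4, e5, eq_iff_iff]
      omega
    have fin : ∀ {τ : State} {c : ℕ → ℕ → ℕ}, History n R l c → τ.nvar = ρ.nvar →
        τ.narr = ρ.narr → InMemory n R l c τ → Undoing n R τ ∧ τ.nvar 2 = σ.nvar 2 - 1 := by
      intro τ c hH h1 h2 h3
      refine ⟨⟨l, c, hH, h3, hpρ.congr (by rw [h1]) (by rw [h1]) h2, by rw [h1, e2],
        hst'.congr fun a _ _ i _ => by rw [h2, hnarr]⟩, by rw [h1, e2, hlen']⟩
    rw [hstep]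
    cases hH with
    | pendant hH hwn hw hu huw cu hx =>
      rw [if_pos rfl]
      obtain ⟨h1, h2, h3⟩ := hLρ.drawPendant hpρ e3 e4 hR hH.symm hw hu huw cu hx
      exact fin hH h1 h2 h3
    | ear hH hwn hw hu hv huw hvw huv cu cv cuv hx =>
      rw [if_neg huv]
      obtain ⟨h1, h2, h3⟩ := hLρ.drawEar hpρ e3 e4 e5 (by
        rw [e7, hp.shift]
        simp only
        split_ifs with h
        · rw [h, zero_mul]
        -- A slot is `0` or `1`, so the product of slot and `(n + 1)²` can be selected without a
        -- multiplication.
        · have h1 := Nat.le_antisymm cuv (Nat.pos_of_ne_zero h)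
          rw [h1, one_mul]) hR hH.symm hw hu hv huw hvw huv cu cv cuv hx
      exact fin hH h1 h2 h3

/-- Once every vertex is removed only the root is present, and `LayoutAt.single` is the layout from
which the removals are undone. -/
theorem Sim.rootCmd (h : Sim n R l edge c σ) (hA : alive n l = ∅) :
    Undoing n R (rootCmd.step σ) ∧ (rootCmd.step σ).nvar 2 = l.length := by
  have hrow := h.tables.row n le_rfl
  have h0 := h.tables.size
  have hnarr : (RealRAM.rootCmd.step σ).narr = σ.narr := by simp [RealRAM.rootCmd]
  have h2 : (RealRAM.rootCmd.step σ).nvar 2 = l.length := by simp [RealRAM.rootCmd, h.length]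
  have hcode' : n * (n + 1) + n + (n + 1) * (n + 1) =
      n * (n + 1) + n + (n * (n + 1) + (n + 1)) := by
    ring
  refine ⟨⟨l, c, h.elim.history, ?_, ⟨?_, ?_, ?_, ?_⟩, h2, ?_⟩, h2⟩
  · refine LayoutAt.single (fun x => ?_) ?_ ?_ ?_ ?_ ?_ ?_
    · rw [h.elim.history.present_iff, hA]; simp
    · simp [State.triangle, State.point, RealRAM.rootCmd, RealRAM.entryAt, RealRAM.entryAt', h0,
        hrow]
    · simp [State.triangle, State.point, RealRAM.rootCmd, RealRAM.entryAt, RealRAM.entryAt', h0,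
        hrow]
    · simp [State.triangle, State.point, RealRAM.rootCmd, RealRAM.entryAt, RealRAM.entryAt', h0,
        hrow]
    · simp [State.keyed, code, State.point, RealRAM.rootCmd, RealRAM.entryAt, RealRAM.entryAt', h0,
        hrow]
    · simp [State.keyed, code, State.point, RealRAM.rootCmd, RealRAM.entryAt, RealRAM.entryAt', h0,
        hrow]
    · simp [State.keyed, code, State.point, RealRAM.rootCmd, RealRAM.entryAt, RealRAM.entryAt', h0,
        hrow, hcode']
  · simp [RealRAM.rootCmd, h0]
  · rw [hnarr]; exact h.tables.row
  · rw [hnarr]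
    intro x hx y hy
    rw [h.edge_eq x hx y hy]
    exact h.elim.real x y
  · simp [RealRAM.rootCmd, h0, hrow]
    ring
  · exact h.stored.congr fun a _ _ i _ => by rw [hnarr]

theorem exec_undo : ∃ C, ∀ (n : ℕ) (R : ℕ → ℕ → Prop) (l : List Removal) (edge c : ℕ → ℕ → ℕ)
    (σ₀ : State), (∀ x y, R x y → R y x) → Sim n R l edge c σ₀ → alive n l = ∅ →
    Exec (.seq rootCmd undoLoop) σ₀ (C * (n + 1)) fun σ => ∃ c, InMemory n R [] c σ := by
  refine ⟨rootCmd.bound + (BExp.cost (.nlt (.const 0) (.var 2)) + undoCmd.bound),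
    fun n R l edge c σ₀ hR hS hA => ?_⟩
  obtain ⟨h1, h2⟩ := hS.rootCmd hA
  refine Exec.mono (Exec.seq (P := fun σ => Undoing n R σ ∧ σ.nvar 2 = l.length)
    (Exec.of_step (by simp [RealRAM.rootCmd]) ⟨h1, h2⟩) fun σ hσ => ?_)
    (B := rootCmd.bound +
      (BExp.cost (.nlt (.const 0) (.var 2)) + undoCmd.bound) * (l.length + 1)) ?_ fun _ h => h
  · have h := Exec.loop (b := .nlt (.const 0) (.var 2)) (c := undoCmd)
      (by
        simp [undoCmd, recallCmd, drawPendant, drawEar, frameCmd, RealRAM.realCmd,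
          loopFree_drawCmd]) (I := Undoing n R) (μ := fun σ => σ.nvar 2) (σ := σ)
      (fun σ hI hb => by
        have hpos : 0 < σ.nvar 2 := by simpa using hb
        obtain ⟨h1, h2⟩ := hI.step hR hpos
        exact ⟨h1, by simp only [h2]; omega⟩) hσ.1
    rw [hσ.2] at h
    refine h.mono le_rfl ?_
    rintro σ' ⟨⟨l', c', hH, hL, hp, hlen, hst⟩, hb⟩
    have : l' = [] := by
      rw [← List.length_eq_zero_iff, ← hlen]
      simpa using hb
    subst this
    exact ⟨c', hL⟩
  · have := hS.elim.history.length_le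
    rw [Nat.add_mul rootCmd.bound]
    exact Nat.add_le_add (Nat.le_mul_of_pos_right _ (by omega))
      (Nat.mul_le_mul_left _ (by omega))

end RealRAM

/-! ### The main theorem -/

theorem Avoiding.map {α β : Type*} {E : α → α → Prop} {F : β → β → Prop} {f : β → α} {S : Set β}
    (hF : ∀ x y, F x y → x ∈ S ∧ y ∈ S ∧ E (f x) (f y)) (hf : Set.InjOn f S) {c d a b : β}
    (hc : c ∈ S) (hd : d ∈ S) (h : Avoiding F c d a b) : Avoiding E (f c) (f d) (f a) (f b) := by
  refine Relation.ReflTransGen.lift f ?_ _ _ h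
  rintro x y ⟨h1, h2, h3, h4, h5⟩
  obtain ⟨hx, hy, h6⟩ := hF x y h1
  exact ⟨h6, fun e => h2 (hf hx hc e), fun e => h3 (hf hx hd e), fun e => h4 (hf hy hc e),
    fun e => h5 (hf hy hd e)⟩

/-- Injectivity is needed only on a set `S` that contains both ends of every edge; this allows a
graph on `Fin n` to be read as a relation on all natural numbers. -/
theorem Tripodless.comap {α β : Type*} {E : α → α → Prop} (hE : Tripodless E) {F : β → β → Prop}
    {f : β → α} {S : Set β} (hF : ∀ x y, F x y → x ∈ S ∧ y ∈ S ∧ E (f x) (f y))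
    (hf : Set.InjOn f S) : Tripodless F := by
  intro u a b c ha hb hc hab hbc hca h1 h2 h3
  obtain ⟨su, sa, ea⟩ := hF u a ha
  obtain ⟨-, sb, eb⟩ := hF u b hb
  obtain ⟨-, sc, ec⟩ := hF u c hc
  exact hE (f u) (f a) (f b) (f c) ea eb ec (fun e => hab (hf sa sb e)) (fun e => hbc (hf sb sc e))
    (fun e => hca (hf sc sa e)) (h1.map hF hf su sc) (h2.map hF hf su sa) (h3.map hF hf su sb)

/-- Adjacency as a relation on natural numbers. -/
def finAdj {n : ℕ} (G : SimpleGraph (Fin n)) (x y : ℕ) : Prop :=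
  ∃ (hx : x < n) (hy : y < n), G.Adj ⟨x, hx⟩ ⟨y, hy⟩

theorem finAdj_coe {n : ℕ} {G : SimpleGraph (Fin n)} (u v : Fin n) : finAdj G u v ↔ G.Adj u v :=
  ⟨fun ⟨_, _, h⟩ => h, fun h => ⟨u.2, v.2, h⟩⟩

theorem finAdj_symm {n : ℕ} {G : SimpleGraph (Fin n)} (x y : ℕ) (h : finAdj G x y) :
    finAdj G y x :=
  let ⟨hx, hy, h⟩ := h
  ⟨hy, hx, h.symm⟩

theorem tripodless_finAdj {n : ℕ} {G : SimpleGraph (Fin n)} (h : Tripodless G.Adj) :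
    Tripodless (finAdj G) := by
  rcases Nat.eq_zero_or_pos n with rfl | hn
  · rintro u a b c ⟨hu, -⟩
    exact absurd hu (Nat.not_lt_zero _)
  · refine h.comap (f := fun x => if hx : x < n then ⟨x, hx⟩ else ⟨0, hn⟩) (S := {x | x < n}) ?_ ?_
    · rintro x y ⟨hx, hy, hxy⟩
      refine ⟨hx, hy, ?_⟩
      rw [dif_pos hx, dif_pos hy]
      exact hxy
    · intro x hx y hy hxy
      simp only [Set.mem_ofPred_eq] at hx hy
      simpa [hx, hy] using hxy

namespace RealRAM

theorem mem_listAt {n : ℕ} {G : SimpleGraph (Fin n)} {L : Fin n → List (Fin n)}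
    (hL : IsAdjLists G L) (a b : ℕ) : b ∈ listAt L a ↔ finAdj G a b := by
  unfold listAt finAdj
  split_ifs with h
  · simp only [List.mem_map, (hL _).2]
    constructor
    · rintro ⟨w, hw, rfl⟩; exact ⟨h, w.2, hw⟩
    · rintro ⟨_, hb, hw⟩; exact ⟨⟨b, hb⟩, hw, rfl⟩
  · simp [h]

theorem nodup_listAt {n : ℕ} {G : SimpleGraph (Fin n)} {L : Fin n → List (Fin n)}
    (hL : IsAdjLists G L) (a : ℕ) : (listAt L a).Nodup := by
  unfold listAt
  split_ifs with h
  · exact (hL _).1.map Fin.val_injective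
  · exact List.nodup_nil

/-- The entries of the adjacency matrix in the beginning. -/
def initialEdge (A : ℕ → List ℕ) (x y : ℕ) : ℕ := if y ∈ A x then 2 else 0

theorem nbrs_initialEdge {n : ℕ} {G : SimpleGraph (Fin n)} {L : Fin n → List (Fin n)}
    (hL : IsAdjLists G L) (x : ℕ) :
    nbrs n [] (initialEdge (listAt L)) x = (listAt L x).toFinset := by
  ext y
  simp only [mem_nbrs, mem_alive, initialEdge, List.mem_toFinset]
  by_cases h : y ∈ listAt L x
  · obtain ⟨_, hy, _⟩ := (mem_listAt hL x y).1 h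
    simp [h, hy]
  · simp [h]

theorem sum_nbrs_initialEdge {n : ℕ} {G : SimpleGraph (Fin n)} {L : Fin n → List (Fin n)}
    (hL : IsAdjLists G L) (f : ℕ → ℕ) (x : ℕ) :
    ∑ y ∈ nbrs n [] (initialEdge (listAt L)) x, f y = ((listAt L x).map f).sum := by
  rw [nbrs_initialEdge hL, List.sum_toFinset f (nodup_listAt hL x)]

theorem sum_length_listAt {n : ℕ} {G : SimpleGraph (Fin n)} {L : Fin n → List (Fin n)}
    (hL : IsAdjLists G L) (hG : Tripodless (finAdj G)) :
    ∑ a ∈ Finset.range n, (listAt L a).length ≤ 4 * n := by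
  classical
  have := hG.sum_degree_le finAdj_symm (fun x h => by
    obtain ⟨_, _, h⟩ := h; exact G.loopless.irrefl _ h) (Finset.range n)
  rw [Finset.card_range] at this
  refine le_trans (Finset.sum_le_sum fun a _ => ?_) this
  rw [← List.toFinset_card_of_nodup (nodup_listAt hL a)]
  refine Finset.card_le_card fun b hb => ?_
  have hb := (mem_listAt hL a b).1 (List.mem_toFinset.1 hb)
  exact Finset.mem_filter.2 ⟨Finset.mem_range.2 hb.2.1, hb⟩

/-- The program that computes a representation. -/
def program : Cmd :=
  .seq (.seq tablesLoop tablesInit) (.seq readLoop (.seq elimLoop (.seq rootCmd undoLoop)))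

theorem sim_initial {n : ℕ} {G : SimpleGraph (Fin n)} {L : Fin n → List (Fin n)}
    (hL : IsAdjLists G L) (hG : Tripodless (finAdj G)) {σ : State} (hT : Tables n σ)
    (hA : Recorded n (listAt L) σ) (h2 : σ.nvar 2 = 0) (h7 : ∀ i, σ.narr 7 i = 0)
    (h11 : ∀ x, σ.narr 11 x = if x = n then 1 else 0) :
    Sim n (finAdj G) [] (initialEdge (listAt L)) (fun _ _ => 0) σ where
  elim := by
    have hne : ∀ x y, initialEdge (listAt L) x y ≠ 0 ↔ finAdj G x y := by
      intro x y
      rw [← mem_listAt hL]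
      simp [initialEdge]
    refine .initial (fun x y => ?_) (fun x => ?_) (fun x y h => ((hne x y).1 h).1) hne
      (fun x y h => ?_) hG
    · unfold initialEdge
      congr 1
      rw [mem_listAt hL, mem_listAt hL]
      exact propext ⟨finAdj_symm _ _, finAdj_symm _ _⟩
    · by_contra h
      obtain ⟨_, _, h⟩ := (hne x x).1 h
      exact G.loopless.irrefl _ h
    · unfold initialEdge at *
      split_ifs at * <;> simp_all
  tables := hT
  length := h2
  edge_eq := hA.edge
  cnt_eq := fun _ _ _ _ => h7 _
  deg x hx := by
    rw [sum_nbrs_initialEdge hL, hA.deg x (mem_alive.1 hx).1.le]; simp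
  sum x hx := by
    rw [sum_nbrs_initialEdge hL, hA.sum x (mem_alive.1 hx).1.le]; simp
  sumSq x hx := by
    rw [sum_nbrs_initialEdge hL, hA.sumSq x (mem_alive.1 hx).1.le]
  dead x hx := by
    rw [h11, mem_alive]
    split_ifs with h
    · simp [h]
    · simp; omega
  stored := trivial

/-- The four phases hand over their invariants. At the end the list of removals is empty, the layout
contains all vertices, and the triangle of the root is left out of the output. -/
theorem exec_program : ∃ C, ∀ (n : ℕ) (G : SimpleGraph (Fin n)) (L : Fin n → List (Fin n)),
    Tripodless G.Adj → IsAdjLists G L → Exec program (inputState L) (C * (n + 1)) fun σ =>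
      IsTouchingTriangles G (outputTriangles n σ) := by
  obtain ⟨C₁, h₁⟩ := exec_tables
  obtain ⟨C₂, h₂⟩ := exec_read
  obtain ⟨C₃, h₃⟩ := exec_elim
  obtain ⟨C₄, h₄⟩ := exec_undo
  refine ⟨C₁ + (C₂ + (C₃ + C₄)), fun n G L hG hL => ?_⟩
  have hG' := tripodless_finAdj hG
  rw [Nat.add_mul, Nat.add_mul, Nat.add_mul]
  have hin := holdsLists_inputState L
  have hzero : ∀ a, a ≠ 0 → a ≠ 1 → ∀ i, (inputState L).narr a i = 0 := by
    intro a h0 h1 i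
    simp [inputState, h0, h1]
  refine (h₁ n (inputState L) (by simp [inputState]) (by simp [inputState]) (by simp [inputState])
    (by simp [inputState])).seq fun σ₁ ⟨hT, hst, s1, s2, s3, s4, s11, ho⟩ => ?_
  have o0 := ho 0 (by simp) (by simp) (by simp) (by simp) (by simp) (by simp)
  have o1 := ho 1 (by simp) (by simp) (by simp) (by simp) (by simp) (by simp)
  have hz : ∀ a, a ∈ [6, 7, 8, 9, 10] → ∀ i, σ₁.narr a i = 0 := by
    intro a ha i
    simp only [List.mem_cons, List.not_mem_nil, or_false] at ha
    rw [ho a (by omega) (by omega) (by omega) (by omega) (by omega) (by omega)]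
    exact hzero a (by omega) (by omega) i
  have hin' : HoldsLists n (listAt L) σ₁ := by
    constructor
    · rw [o0]; exact hin.zero
    · rw [o0]; exact hin.succ
    · rw [o0, o1]; exact hin.entry
  refine (h₂ n (listAt L) σ₁ hT hin' (fun a b hb => ((mem_listAt hL a b).1 hb).2.1.le)
    (by simp [listAt]) (sum_length_listAt hL hG') s3 s4 (hz 6 (by simp)) (hz 8 (by simp))
    (hz 9 (by simp)) (hz 10 (by simp))).seq fun σ₂ ⟨hT₂, hrec, t1, t2, hto⟩ => ?_
  have hS : Sim n (finAdj G) [] (initialEdge (listAt L)) (fun _ _ => 0) σ₂ :=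
    sim_initial hL hG' hT₂ hrec (by rw [t2, s2]; simp [inputState])
      (by rw [hto 7 (by simp) (by simp) (by simp) (by simp)]; exact hz 7 (by simp))
      (by
        rw [hto 11 (by simp) (by simp) (by simp) (by simp)]
        intro x
        rw [s11, hzero 11 (by simp) (by simp)])
  have hstack : ∀ x ≤ n, σ₂.narr 12 x = x := by
    rw [hto 12 (by simp) (by simp) (by simp) (by simp)]; exact hst
  refine (h₃ n (finAdj G) _ _ σ₂ hS ⟨fun i hi => ?_, fun w hw _ => ?_⟩ (by rw [t1, s1])).seq
    fun σ₃ ⟨l, edge, c, hS₃, hA⟩ => ?_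
  · rw [t1, s1] at hi
    rw [hstack i hi.le]; exact hi.le
  · have hwn := (mem_alive.1 hw.1).1
    exact ⟨w, by rw [t1, s1]; exact hwn, hstack w hwn.le⟩
  refine (h₄ n (finAdj G) l edge c σ₃ finAdj_symm hS₃ hA).mono le_rfl ?_
  rintro σ₄ ⟨c', hM⟩
  exact Layout.isTouchingTriangles hM (fun v => ⟨v.2.le, by simp⟩) finAdj_coe

end RealRAM

theorem mainTheorem1 :
    (∀ (V : Type*) [Finite V] (G : SimpleGraph V), IsOuterplanar G →
      ∃ T : V → Fin 3 → ℝ × ℝ, IsTouchingTriangles G T) ∧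
    (∃ (P : RealRAM.Cmd) (C : ℕ), ∀ (n : ℕ) (G : SimpleGraph (Fin n)) (L : Fin n → List (Fin n)),
      IsOuterplanar G → RealRAM.IsAdjLists G L →
      ∃ (t : ℕ) (σ : RealRAM.State), RealRAM.Run P (RealRAM.inputState L) t σ ∧
        t ≤ C * (n + 1) ∧ IsTouchingTriangles G (RealRAM.outputTriangles n σ)) := by
  classical
  obtain ⟨C, hC⟩ := RealRAM.exec_program
  refine ⟨fun V _ G hG => ?_, RealRAM.program, C, fun n G L hG hL => hC n G L hG.tripodless hL⟩
  obtain ⟨n, ⟨e⟩⟩ := Finite.exists_equiv_fin V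
  -- No drawing has to be transported to `Fin n`, since the program only relies on the absence of
  -- tripods.
  have hT : Tripodless (G.comap e.symm).Adj :=
    hG.tripodless.comap (f := e.symm) (S := Set.univ) (fun x y h => ⟨trivial, trivial, h⟩)
      e.symm.injective.injOn
  obtain ⟨t, σ, -, -, h⟩ := hC n (G.comap e.symm)
    (fun v => ((G.comap e.symm).neighborFinset v).toList) hT
    (fun v => ⟨Finset.nodup_toList _, fun w => by simp⟩)
  refine ⟨fun v => RealRAM.outputTriangles n σ (e v), fun v => h.nondegenerate (e v),
    fun u v huv => h.interior_disjoint _ _ (e.injective.ne huv), fun u v huv => ?_⟩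
  rw [← h.adj_iff _ _ (e.injective.ne huv)]
  simp
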